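/- Let $\mathcal M\subset\mathbb R^N$ be a compact smooth embedded submanifold (with the induced metric). A tubular neighbourhood of $\mathcal M$ is an open set $V\supseteq\mathcal M$ on which every point $p$ has a unique nearest point $\pi(p)\in\mathcal M$ and $\pi$ is smooth; on such a $V$ put $\Pi(p,v)=(\pi(p),\,\mathrm{pr}_{T_{\pi(p)}\mathcal M}v)$, where $\mathrm{pr}_W$ is the Euclidean orthogonal projection onto the linear subspace $W$. Fix a smooth radial function $\chi:\mathbb R^2\to\mathbb R$ with $\chi=1$ on $|\xi|\le1$ and $\chi=0$ on $|\xi|\ge2$; let $P_{<k}$ ($k\in\mathbb Z$) be the Fourier multiplier on $\mathbb R^2$ with symbol $\chi(2^{-k}\xi)$ (acting by convolution), and $P_k=P_{<k+1}-P_{<k}$. An initial data set is a measurable pair $\phi[0]=(\phi_0,\phi_1)$ of functions $\mathbb R^2\to\mathbb R^N$ with $\phi_0(x)\in\mathcal M$ and $\phi_1(x)\in T_{\phi_0(x)}\mathcal M$ for almost every $x$; its energy is $\|\phi[0]\|_{\dot H^1\times L^2}^2=\int_{\mathbb R^2}|\phi_1|^2+|\nabla\phi_0|^2\,dx$ and its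 energy dispersion is $\sup_{k\in\mathbb Z}\|P_k\phi_0\|_{L^\infty}$. Then $\mathcal M$ has a tubular neighbourhood, and for every tubular neighbourhood $V$ of $\mathcal M$ there is a function $K:(0,\infty)\to(0,\infty)$ of at most polynomial growth at infinity (depending only on $\mathcal M$, $V$, $\chi$) such that the following holds. For each $E>0$ there is $\epsilon_0>0$ such that for every initial data set $\phi[0]$ with energy $E$, every $0<\epsilon\le\epsilon_0$ with energy dispersion of $\phi[0]$ at most $\epsilon$, and all $k,k_*\in\mathbb Z$: (i) $P_{<k_*}\phi_0(x)\in V$ for all $x\in\mathbb R^2$, so that $\Pi(P_{<k_*}\phi[0])$ is well defined; (ii) $\displaystyle \big\|P_k\big(P_{<k_*}\phi[0]-\Pi(P_{<k_*}\phi[0])\big)\big\|_{\dot H^1\times L^2}\ \le\ K(E)\,\min\{\epsilon|\ln\epsilon|^2,\,2^{-|k-k_*|}\}$; (iii) $\displaystyle \big\|P_k\big(P_{<k_*}\phi[0]-\Pi(P_{<k_*}\phi[0])\big)\big\|_{\dot H^1\times L^2}\ \le\ K(E)\,\epsilon^{1/4}\,2^{-\frac12|k-k_*|}$. -/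

import Mathlib

open MeasureTheory Filter
open scoped ENNReal ContDiff FourierTransform

noncomputable section

/-- The physical space `ℝ²` with its Euclidean norm. -/
abbrev Plane : Type := EuclideanSpace ℝ (Fin 2)

/-- The ambient space `ℝᴺ` with its Euclidean norm. -/
abbrev Ambient (N : ℕ) : Type := EuclideanSpace ℝ (Fin N)

section Target

variable {N : ℕ}

/-- `M` is an embedded `C^∞` submanifold of `ℝᴺ` of dimension `n` (without boundary): near each
of its points a smooth diffeomorphism between open sets of `ℝᴺ` straightens it to a piece of an
`n`-dimensional linear subspace. -/
def IsSmoothSubmanifold (n : ℕ) (M : Set (Ambient N)) : Prop :=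
  ∀ p ∈ M, ∃ (e : OpenPartialHomeomorph (Ambient N) (Ambient N)) (W : Submodule ℝ (Ambient N)),
    p ∈ e.source ∧ ContDiffOn ℝ ∞ e e.source ∧ ContDiffOn ℝ ∞ e.symm e.target ∧
      Module.finrank ℝ W = n ∧ e.IsImage M (W : Set (Ambient N))

/-- The tangent space `T_p M ⊆ ℝᴺ`: the velocities at `p` of curves in `M` through `p`.
(For a submanifold these velocities already form a linear subspace.) -/
def tangentAt (M : Set (Ambient N)) (p : Ambient N) : Submodule ℝ (Ambient N) :=
  Submodule.span ℝ {v | ∃ γ : ℝ → Ambient N, γ 0 = p ∧ (∀ᶠ t in nhds 0, γ t ∈ M) ∧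
    HasDerivAt γ v 0}

/-- `q` is a point of `M` nearest to `p`. -/
def IsNearest (M : Set (Ambient N)) (p q : Ambient N) : Prop :=
  q ∈ M ∧ dist p q = Metric.infDist p M

/-- The nearest-point projection onto `M`; it is only used where the nearest point exists and is
unique. -/
def nearestPoint (M : Set (Ambient N)) (p : Ambient N) : Ambient N :=
  Classical.epsilon (IsNearest M p)

/-- `V` is a tubular neighbourhood of `M`: an open set containing `M` on which the nearest point
in `M` is unique and depends smoothly on the point. -/
structure IsTubularNhd (M V : Set (Ambient N)) : Prop where
  isOpen : IsOpen V
  subset : M ⊆ V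
  existsUnique : ∀ p ∈ V, ∃! q, IsNearest M p q
  contDiffOn : ContDiffOn ℝ ∞ (nearestPoint M) V

/-- The second component of the projection `Π : TV → TM`, `(p, v) ↦ (π p, π' v)`: the orthogonal
projection of `v` onto the tangent space of `M` at the nearest point `π p`. -/
def fiberProj (M : Set (Ambient N)) (p v : Ambient N) : Ambient N :=
  (tangentAt M (nearestPoint M p)).starProjection v

end Target

section LittlewoodPaley

/-- An admissible cutoff for the Littlewood-Paley multipliers on `ℝ²`: smooth, radial,
equal to `1` on the unit disc and to `0` outside the disc of radius `2`. -/
structure IsLPCutoff (χ : Plane → ℝ) : Prop where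
  contDiff : ContDiff ℝ ∞ χ
  radial : ∀ ξ η : Plane, ‖ξ‖ = ‖η‖ → χ ξ = χ η
  eq_one : ∀ ξ : Plane, ‖ξ‖ ≤ 1 → χ ξ = 1
  eq_zero : ∀ ξ : Plane, 2 ≤ ‖ξ‖ → χ ξ = 0

/-- The convolution kernel of `P_{<k}`, the inverse Fourier transform of `χ (2^{-k} ξ)`
(which is real valued since `χ` is radial). -/
def lowKernel (χ : Plane → ℝ) (k : ℤ) (y : Plane) : ℝ :=
  (𝓕⁻ (fun ξ : Plane => ((χ ((2 : ℝ) ^ (-k) • ξ) : ℝ) : ℂ)) y).re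

variable {F : Type*} [NormedAddCommGroup F] [NormedSpace ℝ F]

/-- The Littlewood-Paley multiplier `P_{<k}`, as a convolution operator; it acts on bounded
functions as well as on square integrable ones. -/
def lpLow (χ : Plane → ℝ) (k : ℤ) (f : Plane → F) : Plane → F :=
  convolution (lowKernel χ k) f (ContinuousLinearMap.lsmul ℝ ℝ) volume

/-- The Littlewood-Paley multiplier `P_k = P_{<k+1} - P_{<k}`. -/
def lpBlock (χ : Plane → ℝ) (k : ℤ) (f : Plane → F) : Plane → F :=
  fun x => lpLow χ (k + 1) f x - lpLow χ k f x

/-- The energy dispersion `sup_k ‖P_k f‖_{L^∞}`. -/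
def energyDispersion (χ : Plane → ℝ) (f : Plane → F) : ℝ≥0∞ :=
  ⨆ k : ℤ, eLpNorm (lpBlock χ k f) ∞ volume

end LittlewoodPaley

section Energy

variable {F : Type*} [NormedAddCommGroup F] [NormedSpace ℝ F]

/-- `(D 0, D 1)` is the distributional gradient of `f` on `ℝ²`. -/
structure IsWeakGrad (f : Plane → F) (D : Fin 2 → Plane → F) : Prop where
  locallyIntegrable : LocallyIntegrable f volume
  locallyIntegrable_grad : ∀ j, LocallyIntegrable (D j) volume
  integral_eq : ∀ ψ : Plane → ℝ, ContDiff ℝ ∞ ψ → HasCompactSupport ψ → ∀ j,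
    ∫ x, fderiv ℝ ψ x (EuclideanSpace.single j 1) • f x = - ∫ x, ψ x • D j x

/-- The energy `∫ |g|² + |∇ f|²` of the pair `(f, g)`. The weak gradient is unique up to null sets,
so the infimum is over one value, or is `∞` if there is no locally integrable weak gradient. -/
def energy (f g : Plane → F) : ℝ≥0∞ :=
  ⨅ (D : Fin 2 → Plane → F) (_ : IsWeakGrad f D),
    ∫⁻ x, (‖g x‖ₑ ^ 2 + ∑ j, ‖D j x‖ₑ ^ 2)

/-- The norm of `(f, g)` in `Ḣ¹ × L²`. -/
def energyNorm (f g : Plane → F) : ℝ≥0∞ :=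
  energy f g ^ (1 / 2 : ℝ)

end Energy

/-- `(φ₀, φ₁) : ℝ² → TM`: measurable, with `φ₀ ∈ M` and `φ₁ ∈ T_{φ₀} M` almost everywhere. -/
structure IsInitialData {N : ℕ} (M : Set (Ambient N)) (φ₀ φ₁ : Plane → Ambient N) : Prop where
  aestronglyMeasurable₀ : AEStronglyMeasurable φ₀ volume
  aestronglyMeasurable₁ : AEStronglyMeasurable φ₁ volume
  mem : ∀ᵐ x, φ₀ x ∈ M
  mem_tangent : ∀ᵐ x, φ₁ x ∈ tangentAt M (φ₀ x)

/-- The norm `‖P_k (P_{<l} φ - Π (P_{<l} φ))‖` in `Ḣ¹ × L²`, for `φ = (φ₀, φ₁)`. -/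
def truncationError {N : ℕ} (M : Set (Ambient N)) (χ : Plane → ℝ) (k l : ℤ)
    (φ₀ φ₁ : Plane → Ambient N) : ℝ≥0∞ :=
  energyNorm
    (lpBlock χ k fun x => lpLow χ l φ₀ x - nearestPoint M (lpLow χ l φ₀ x))
    (lpBlock χ k fun x => lpLow χ l φ₁ x - fiberProj M (lpLow χ l φ₀ x) (lpLow χ l φ₁ x))

/-- A positive function `K` on `(0, ∞)` with `K y ≤ y ^ m` for some `m` and all large `y`. -/
def IsPolynomialType (K : ℝ → ℝ) : Prop :=
  (∀ y, 0 < y → 0 < K y) ∧ ∃ m : ℕ, ∀ᶠ y in atTop, K y ≤ y ^ m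

end

/-! ### Cauchy-Schwarz and Minkowski inequalities -/

section LIntegralInequalities

open scoped NNReal

/-! Let `κ` be the kernel of `P_{<l}`, `u = P_{<l} φ₀`, and let `P` be a compactly supported smooth
map that agrees with the nearest-point projection near `M`. At points of `M` the differential `DP`
is the orthogonal projection onto the tangent space. Hence the gradient of `u - P(u)` and the second
component of the error both have the form `z = κ∗ψ - B(u)(κ∗ψ)` (`normalPart`): `ψ = ∂φ₀` and `B =
DP` for the gradient, `ψ = φ₁` and `B(p) = DP(P p)` for the second component. The data being
tangent, `ψ = B(φ₀)ψ`, so `z(x) = ∫ κ(y) (B(φ₀(x-y)) - B(u(x))) ψ(x-y) dy`. As `B` is Lipschitz,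
`|z(x)|` is at most a constant times `∫ |κ(y)| |φ₀(x-y) - u(x)| |ψ(x-y)| dy`.

With `A² = 2E`, and constants depending only on `M`, `V`, `χ`, three bounds for `z` follow
(`IsDispersed.normalBounds`). In `L²`: insert `v = P_{<l+J} φ₀` between `φ₀` and `u`. The product
`(φ₀ - v)ψ` has `L¹` norm `O(2^{-l-J} A²)`, and `κ` maps `L¹` to `L²` with norm `O(2^l)`. Small
dispersion gives `|v(x-y) - u(x)| ≤ 3Jε + O(2^{l-J}|y|)`. With `2^{-J} ≤ ε` and `J` of size `|ln
ε|`, the result is `O(ε |ln ε|)`. In `L¹`: `φ₀(x-y) - φ₀(x)` is `O(|y| A)` in `L²` and `φ₀ - u` is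
`O(2^{-l} A)`, so `z` is `O(2^{-l} A²)`. Bernstein's inequality for `P_k` then gives `2^{k-l}`,
which serves `k ≤ l`. For increments: `z(· + h) - z` is `O(2^l A |h|)` in `L²`. The kernel of `P_k`
has mean zero, which gives `2^{l-k}` and serves `k ≥ l`. Together these prove (ii), with one
logarithm to spare; (iii) follows because a minimum is at most the geometric mean.

For (i), `φ₀ - v` is so small in `L²` that every disc of radius `2^{-l}` contains a point where `v`
is within `O(2^{-J} A)` of `φ₀`, hence of `M`; small dispersion makes `v` close to `u(x)` on that
disc (`infDist_lpLow_le`).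

Weak derivatives of `φ₀` are never inserted for `ψ`. Difference quotients take their place: they are
tangent up to a Taylor remainder that vanishes in `L¹`, and Fatou's lemma passes to the limit
(`IsDispersed.normalBounds_fderiv`). The existence of a tubular neighbourhood comes from the inverse
function theorem applied to the critical point equation of the squared distance. -/

theorem sq_lintegral_mul_le {α : Type*} [MeasurableSpace α] {μ : Measure α} {f g : α → ℝ≥0∞}
    (hf : AEMeasurable f μ) (hg : AEMeasurable g μ) :
    (∫⁻ a, f a * g a ∂μ) ^ 2 ≤ (∫⁻ a, f a ^ 2 ∂μ) * ∫⁻ a, g a ^ 2 ∂μ := by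
  have h := ENNReal.lintegral_mul_le_Lp_mul_Lq μ Real.HolderConjugate.two_two hf hg
  have h2 : ∀ a : ℝ≥0∞, (a ^ (1 / 2 : ℝ)) ^ 2 = a := fun a => by
    rw [← ENNReal.rpow_natCast, ← ENNReal.rpow_mul]; norm_num
  calc (∫⁻ a, f a * g a ∂μ) ^ 2
      ≤ ((∫⁻ a, f a ^ (2 : ℝ) ∂μ) ^ (1 / 2 : ℝ) * (∫⁻ a, g a ^ (2 : ℝ) ∂μ) ^ (1 / 2 : ℝ)) ^ 2 := by
        gcongr; exact h
    _ = _ := by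
        rw [mul_pow, h2, h2]
        simp only [ENNReal.rpow_ofNat]

/-- Weighted Cauchy-Schwarz inequality. -/
theorem sq_lintegral_weight_mul_le {α : Type*} [MeasurableSpace α] {μ : Measure α}
    {F H : α → ℝ≥0∞} (hF : AEMeasurable F μ) (hH : AEMeasurable H μ) :
    (∫⁻ a, F a * H a ∂μ) ^ 2 ≤ (∫⁻ a, F a ∂μ) * ∫⁻ a, F a * H a ^ 2 ∂μ := by
  have h2 : ∀ a : ℝ≥0∞, (a ^ (1 / 2 : ℝ)) ^ 2 = a := fun a => by
    rw [← ENNReal.rpow_natCast, ← ENNReal.rpow_mul]; norm_num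
  have h := sq_lintegral_mul_le (μ := μ) (f := fun a => F a ^ (1 / 2 : ℝ))
    (g := fun a => F a ^ (1 / 2 : ℝ) * H a) (hF.pow_const _) ((hF.pow_const _).mul hH)
  simp only [mul_pow, h2, ← mul_assoc, ← sq] at h
  exact h

/-- Minkowski's integral inequality in `L²`, in a weighted quadratic form. -/
theorem lintegral_sq_lintegral_weight_mul_le {α β : Type*} [MeasurableSpace α] [MeasurableSpace β]
    {μ : Measure α} {ν : Measure β} [SFinite μ] [SFinite ν] {F : β → ℝ≥0∞} {H : α → β → ℝ≥0∞}
    (hF : Measurable F) (hH : Measurable (Function.uncurry H)) :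
    ∫⁻ x, (∫⁻ y, F y * H x y ∂ν) ^ 2 ∂μ
      ≤ (∫⁻ y, F y ∂ν) * ∫⁻ y, F y * ∫⁻ x, H x y ^ 2 ∂μ ∂ν := by
  calc ∫⁻ x, (∫⁻ y, F y * H x y ∂ν) ^ 2 ∂μ
      ≤ ∫⁻ x, (∫⁻ y, F y ∂ν) * ∫⁻ y, F y * H x y ^ 2 ∂ν ∂μ := by
        refine lintegral_mono fun x => ?_
        exact sq_lintegral_weight_mul_le hF.aemeasurable
          (hH.comp measurable_prodMk_left).aemeasurable
    _ = (∫⁻ y, F y ∂ν) * ∫⁻ x, ∫⁻ y, F y * H x y ^ 2 ∂ν ∂μ := by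
        rw [lintegral_const_mul]
        refine Measurable.lintegral_prod_right' (f := fun p : α × β => F p.2 * H p.1 p.2 ^ 2) ?_
        exact (hF.comp measurable_snd).mul (hH.pow_const 2)
    _ = _ := by
        rw [lintegral_lintegral_swap]
        · congr 1
          refine lintegral_congr fun y => ?_
          rw [lintegral_const_mul]
          exact (hH.comp measurable_prodMk_right).pow_const 2
        · exact ((hF.comp measurable_snd).mul (hH.pow_const 2)).aemeasurable

theorem add_sq_le_two_mul (a b : ℝ≥0∞) : (a + b) ^ 2 ≤ 2 * (a ^ 2 + b ^ 2) := by
  have := ENNReal.rpow_add_le_mul_rpow_add_rpow a b (p := 2) (by norm_num)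
  norm_num at this
  exact this

end LIntegralInequalities

/-! ### Young inequalities and translation increments on the plane -/

section PlaneConvolution

open scoped NNReal

variable {F : Type*} [NormedAddCommGroup F] [NormedSpace ℝ F]

theorem lintegral_comp_smul_plane (f : Plane → ℝ≥0∞) {s : ℝ≥0} (hs : s ≠ 0) :
    ∫⁻ y, f ((s : ℝ) • y) = ((s⁻¹ : ℝ≥0) : ℝ≥0∞) ^ 2 * ∫⁻ y, f y := by
  have hs' : (s : ℝ) ≠ 0 := by exact_mod_cast hs
  have h1 : ∫⁻ y, f ((s : ℝ) • y)
      = ∫⁻ y, f y ∂(Measure.map (fun y : Plane => (s : ℝ) • y) volume) := by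
    exact ((Homeomorph.smulOfNeZero (s : ℝ) hs').measurableEmbedding.lintegral_map f).symm
  rw [h1, Measure.map_addHaar_smul _ hs', lintegral_smul_measure]
  congr 1
  simp only [finrank_euclideanSpace, Fintype.card_fin]
  rw [abs_of_nonneg (by positivity), ← inv_pow, ENNReal.ofReal_pow (by positivity)]
  congr 1
  rw [← NNReal.coe_inv, ENNReal.ofReal_coe_nnreal]

theorem lintegral_weight_sub_sq_le {k G : Plane → ℝ≥0∞} (hk : Measurable k) (hG : Measurable G) :
    ∫⁻ x, (∫⁻ y, k y * G (x - y)) ^ 2 ≤ (∫⁻ y, k y) ^ 2 * ∫⁻ x, G x ^ 2 := by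
  refine (lintegral_sq_lintegral_weight_mul_le (H := fun x y => G (x - y)) hk
    (hG.comp (measurable_fst.sub measurable_snd))).trans ?_
  simp only [lintegral_sub_right_eq_self (fun x => G x ^ 2)]
  rw [lintegral_mul_const _ hk, ← mul_assoc, ← sq]

/-- Convolution is commutative, so the square integrability may be carried by the kernel. For a
kernel of frequency scale `s` this is Bernstein's inequality, with the factor `s` coming from the
`L²` norm of the kernel. -/
theorem lintegral_weight_sub_sq_le' {k G : Plane → ℝ≥0∞} (hk : Measurable k) (hG : Measurable G) :
    ∫⁻ x, (∫⁻ y, k y * G (x - y)) ^ 2 ≤ (∫⁻ x, k x ^ 2) * (∫⁻ y, G y) ^ 2 := by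
  have : ∀ x, ∫⁻ y, k y * G (x - y) = ∫⁻ y, G y * k (x - y) := fun x => by
    rw [← lintegral_sub_left_eq_self _ x]
    simp [mul_comm]
  simp only [this]
  rw [mul_comm]
  exact lintegral_weight_sub_sq_le hG hk

theorem lintegral_lintegral_weight_sub {k G : Plane → ℝ≥0∞} (hk : Measurable k)
    (hG : Measurable G) :
    ∫⁻ x, ∫⁻ y, k y * G (x - y) = (∫⁻ y, k y) * ∫⁻ x, G x := by
  rw [lintegral_lintegral_swap]
  · simp only [fun y => lintegral_const_mul (k y) (f := fun x => G (x - y)) (μ := volume)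
      (hG.comp (measurable_id.sub_const y)), lintegral_sub_right_eq_self G]
    rw [lintegral_mul_const _ hk]
  · exact ((hk.comp measurable_snd).mul
      (hG.comp (measurable_fst.sub measurable_snd))).aemeasurable

theorem enorm_add_sub_le_lintegral [CompleteSpace F] {f : Plane → F} (hf : ContDiff ℝ 1 f)
    (z h : Plane) :
    ‖f (z + h) - f z‖ₑ
      ≤ ∫⁻ t in Set.Ioc (0 : ℝ) 1, ‖fderiv ℝ f (z + t • h) h‖ₑ := by
  have hd : ∀ t ∈ Set.uIcc (0 : ℝ) 1,
      HasDerivAt (fun t : ℝ => f (z + t • h)) (fderiv ℝ f (z + t • h) h) t := by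
    intro t _
    have h1 : HasDerivAt (fun t : ℝ => z + t • h) h t := by
      simpa using ((hasDerivAt_id t).smul_const h).const_add z
    exact ((hf.differentiable one_ne_zero _).hasFDerivAt).comp_hasDerivAt t h1
  have hc : Continuous fun t : ℝ => fderiv ℝ f (z + t • h) h :=
    ((hf.continuous_fderiv one_ne_zero).comp (by fun_prop)).clm_apply continuous_const
  have := intervalIntegral.integral_eq_sub_of_hasDerivAt hd (hc.intervalIntegrable _ _)
  simp only [one_smul, zero_smul, add_zero] at this
  rw [← this, intervalIntegral.integral_of_le zero_le_one]
  exact enorm_integral_le_lintegral_enorm _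

/-- The increment is the integral of the derivative along a segment, and translation invariance
makes each point of the segment contribute equally. -/
theorem lintegral_enorm_add_sub_le [CompleteSpace F] {f : Plane → F} (hf : ContDiff ℝ 1 f)
    (h : Plane) :
    ∫⁻ z, ‖f (z + h) - f z‖ₑ ≤ (∫⁻ z, ‖fderiv ℝ f z‖ₑ) * ‖h‖ₑ := by
  have hc : Continuous fun p : Plane × ℝ => fderiv ℝ f (p.1 + p.2 • h) h :=
    ((hf.continuous_fderiv one_ne_zero).comp (by fun_prop)).clm_apply continuous_const
  calc ∫⁻ z, ‖f (z + h) - f z‖ₑ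
      ≤ ∫⁻ z, ∫⁻ t in Set.Ioc (0 : ℝ) 1, ‖fderiv ℝ f (z + t • h) h‖ₑ :=
        lintegral_mono fun z => enorm_add_sub_le_lintegral hf z h
    _ = ∫⁻ t in Set.Ioc (0 : ℝ) 1, ∫⁻ z, ‖fderiv ℝ f (z + t • h) h‖ₑ := by
        rw [lintegral_lintegral_swap]
        exact hc.enorm.measurable.aemeasurable
    _ = ∫⁻ t in Set.Ioc (0 : ℝ) 1, ∫⁻ z, ‖fderiv ℝ f z h‖ₑ := by
        refine lintegral_congr fun t => ?_
        exact lintegral_add_right_eq_self (fun z => ‖fderiv ℝ f z h‖ₑ) (t • h)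
    _ = ∫⁻ z, ‖fderiv ℝ f z h‖ₑ := by simp
    _ ≤ ∫⁻ z, ‖fderiv ℝ f z‖ₑ * ‖h‖ₑ :=
        lintegral_mono fun z => ContinuousLinearMap.le_opENorm _ _
    _ = _ := by
        rw [lintegral_mul_const]
        exact (hf.continuous_fderiv one_ne_zero).enorm.measurable

theorem lintegral_sq_enorm_add_sub_le [CompleteSpace F] {f : Plane → F} (hf : ContDiff ℝ 1 f)
    (h : Plane) :
    ∫⁻ z, ‖f (z + h) - f z‖ₑ ^ 2 ≤ ∫⁻ z, ‖fderiv ℝ f z h‖ₑ ^ 2 := by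
  have hc : Continuous fun p : Plane × ℝ => fderiv ℝ f (p.1 + p.2 • h) h :=
    ((hf.continuous_fderiv one_ne_zero).comp (by fun_prop)).clm_apply continuous_const
  have := lintegral_sq_lintegral_weight_mul_le (μ := (volume : Measure Plane))
    (ν := volume.restrict (Set.Ioc (0 : ℝ) 1)) (F := fun _ => 1)
    (H := fun z t => ‖fderiv ℝ f (z + t • h) h‖ₑ) measurable_const hc.enorm.measurable
  simp only [one_mul, lintegral_const, MeasurableSet.univ, Measure.restrict_apply, Set.univ_inter,
    Real.volume_Ioc, sub_zero, ENNReal.ofReal_one, mul_one,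
    fun t : ℝ => lintegral_add_right_eq_self (μ := (volume : Measure Plane))
      (fun z => ‖fderiv ℝ f z h‖ₑ ^ 2) (t • h)] at this
  exact (lintegral_mono fun z => by gcongr; exact enorm_add_sub_le_lintegral hf z h).trans this

end PlaneConvolution

/-! ### Kernels of the frequency truncations -/

section Kernels

open scoped NNReal SchwartzMap

/-- The quantitative properties of an `L¹`-normalised convolution kernel of frequency scale `s`
on the plane: bounds for its moments, its `L²` norm and its translates, all with constant `c`. -/
structure IsKernelAtScale (c s : ℝ≥0) (κ : Plane → ℝ) : Prop where
  continuous : Continuous κ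
  integrable : Integrable κ
  integral_eq_one : ∫ y, κ y = 1
  lintegral_le : ∫⁻ y, ‖κ y‖ₑ ≤ c
  moment_le : ∫⁻ y, ‖κ y‖ₑ * ‖y‖ₑ ≤ c * (s⁻¹ : ℝ≥0)
  moment_sq_le : ∫⁻ y, ‖κ y‖ₑ * ‖y‖ₑ ^ 2 ≤ c * (s⁻¹ : ℝ≥0) ^ 2
  lintegral_sq_le : ∫⁻ y, ‖κ y‖ₑ ^ 2 ≤ c * s ^ 2
  lintegral_add_sub_le : ∀ h, ∫⁻ y, ‖κ (y + h) - κ y‖ₑ ≤ c * s * ‖h‖ₑ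
  exists_deriv : ∃ (κ' : Plane → Plane →L[ℝ] ℝ) (C : ℝ≥0), Integrable κ' ∧
    ∀ h, ∫⁻ y, ‖κ (y + h) - κ y - κ' y h‖ₑ ≤ C * ‖h‖ₑ ^ 2

theorem SchwartzMap.lintegral_enorm_mul_pow_ne_top {F : Type*} [NormedAddCommGroup F]
    [NormedSpace ℝ F] (f : 𝓢(Plane, F)) (n : ℕ) : ∫⁻ y, ‖f y‖ₑ * ‖y‖ₑ ^ n ≠ ⊤ := by
  have h := (f.integrable_pow_mul volume n).2
  rw [HasFiniteIntegral] at h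
  convert h.ne using 3 with y
  rw [enorm_mul, enorm_pow, enorm_norm, enorm_norm, mul_comm]

theorem SchwartzMap.lintegral_enorm_ne_top {F : Type*} [NormedAddCommGroup F]
    [NormedSpace ℝ F] (f : 𝓢(Plane, F)) : ∫⁻ y, ‖f y‖ₑ ≠ ⊤ := by
  simpa using f.lintegral_enorm_mul_pow_ne_top 0

/-- The increment bound is used twice: pointwise for `f` minus its linear part at `y`, then in `L¹`
for `fderiv ℝ f`. This first-order expansion in `L¹` is what makes the convolution with a merely
bounded function differentiable. -/
theorem SchwartzMap.lintegral_remainder_le (f : 𝓢(Plane, ℝ)) (h : Plane) :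
    ∫⁻ y, ‖f (y + h) - f y - fderiv ℝ f y h‖ₑ
      ≤ (∫⁻ y, ‖fderiv ℝ (fderiv ℝ f) y‖ₑ) * ‖h‖ₑ ^ 2 := by
  have hf : ContDiff ℝ ∞ f := f.smooth ⊤
  have hf' : ContDiff ℝ 1 (fderiv ℝ f) := hf.fderiv_right (by norm_cast)
  have hc1 : Continuous fun p : Plane × ℝ => fderiv ℝ f (p.1 + p.2 • h) :=
    hf'.continuous.comp (by fun_prop)
  have hc2 : Continuous fun p : Plane × ℝ => fderiv ℝ f p.1 :=
    hf'.continuous.comp (by fun_prop)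
  have key : ∀ y, ‖f (y + h) - f y - fderiv ℝ f y h‖ₑ
      ≤ ∫⁻ t in Set.Ioc (0 : ℝ) 1, ‖fderiv ℝ f (y + t • h) - fderiv ℝ f y‖ₑ * ‖h‖ₑ := by
    intro y
    have := enorm_add_sub_le_lintegral (f := fun z => f z - fderiv ℝ f y z)
      ((hf.of_le (by norm_cast)).sub (ContinuousLinearMap.contDiff _)) y h
    have e : f (y + h) - fderiv ℝ f y (y + h) - (f y - fderiv ℝ f y y)
        = f (y + h) - f y - fderiv ℝ f y h := by rw [(fderiv ℝ f y).map_add]; ring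
    rw [e] at this
    refine this.trans (lintegral_mono fun t => ?_)
    have e2 : fderiv ℝ (fun z => f z - fderiv ℝ f y z) (y + t • h)
        = fderiv ℝ f (y + t • h) - fderiv ℝ f y := by
      rw [fderiv_fun_sub (f.differentiable _) (ContinuousLinearMap.differentiableAt _),
        ContinuousLinearMap.fderiv]
    rw [e2]
    exact ContinuousLinearMap.le_opENorm _ _
  calc ∫⁻ y, ‖f (y + h) - f y - fderiv ℝ f y h‖ₑ
      ≤ ∫⁻ y, ∫⁻ t in Set.Ioc (0 : ℝ) 1, ‖fderiv ℝ f (y + t • h) - fderiv ℝ f y‖ₑ * ‖h‖ₑ :=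
        lintegral_mono key
    _ = ∫⁻ t in Set.Ioc (0 : ℝ) 1, ∫⁻ y, ‖fderiv ℝ f (y + t • h) - fderiv ℝ f y‖ₑ * ‖h‖ₑ := by
        rw [lintegral_lintegral_swap]
        exact ((hc1.sub hc2).enorm.measurable.mul_const _).aemeasurable
    _ ≤ ∫⁻ t in Set.Ioc (0 : ℝ) 1, (∫⁻ y, ‖fderiv ℝ (fderiv ℝ f) y‖ₑ) * ‖h‖ₑ ^ 2 := by
        refine setLIntegral_mono measurable_const fun t ht => ?_
        rw [lintegral_mul_const' _ _ enorm_ne_top]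
        have := lintegral_enorm_add_sub_le hf' (t • h)
        calc _ ≤ (∫⁻ z, ‖fderiv ℝ (fderiv ℝ f) z‖ₑ) * ‖t • h‖ₑ * ‖h‖ₑ := by gcongr
          _ ≤ (∫⁻ z, ‖fderiv ℝ (fderiv ℝ f) z‖ₑ) * ‖h‖ₑ * ‖h‖ₑ := by
            gcongr
            rw [enorm_le_iff_norm_le, norm_smul, Real.norm_of_nonneg ht.1.le]
            exact mul_le_of_le_one_left (norm_nonneg _) ht.2
          _ = _ := by ring
    _ = _ := by simp

theorem SchwartzMap.exists_isKernelAtScale (f : 𝓢(Plane, ℝ)) (hf : ∫ y, f y = 1) :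
    ∃ c : ℝ≥0, ∀ s : ℝ≥0, s ≠ 0 →
      IsKernelAtScale c s fun y => (s : ℝ) ^ 2 * f ((s : ℝ) • y) := by
  set f1 : 𝓢(Plane, Plane →L[ℝ] ℝ) := SchwartzMap.fderivCLM ℝ Plane ℝ f
  set f2 := SchwartzMap.fderivCLM ℝ Plane _ f1
  have h1 : ∀ y, f1 y = fderiv ℝ f y := fun y => rfl
  have h2 : ∀ y, f2 y = fderiv ℝ (fderiv ℝ f) y := fun y => rfl
  have t0 := f.lintegral_enorm_mul_pow_ne_top 0
  have t1 := f.lintegral_enorm_mul_pow_ne_top 1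
  have t2 := f.lintegral_enorm_mul_pow_ne_top 2
  have t3 := f1.lintegral_enorm_ne_top
  have t4 := f2.lintegral_enorm_ne_top
  have t5 : ∫⁻ y, ‖f y‖ₑ ^ 2 ≠ ⊤ := by
    have := (f.memLp 2 (volume : Measure Plane)).2
    rw [eLpNorm_lt_top_iff_lintegral_rpow_enorm_lt_top (by norm_num) (by norm_num)] at this
    simpa using this.ne
  lift (∫⁻ y, ‖f y‖ₑ * ‖y‖ₑ ^ 0) to ℝ≥0 using t0 with c0 hc0
  lift (∫⁻ y, ‖f y‖ₑ * ‖y‖ₑ ^ 1) to ℝ≥0 using t1 with c1 hc1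
  lift (∫⁻ y, ‖f y‖ₑ * ‖y‖ₑ ^ 2) to ℝ≥0 using t2 with c2 hc2
  lift (∫⁻ y, ‖f1 y‖ₑ) to ℝ≥0 using t3 with c3 hc3
  lift (∫⁻ y, ‖f2 y‖ₑ) to ℝ≥0 using t4 with c4 hc4
  lift (∫⁻ y, ‖f y‖ₑ ^ 2) to ℝ≥0 using t5 with c5 hc5
  simp only [pow_zero, mul_one, pow_one] at hc0 hc1
  -- The second derivative constant `c4` stays out: it enters only `exists_deriv`, where the
  -- constant may depend on `s`.
  set c := c0 + c1 + c2 + c3 + c5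
  have l0 : (c0 : ℝ≥0∞) ≤ c := by norm_cast; simp only [c, add_assoc]; exact le_self_add
  have l1 : (c1 : ℝ≥0∞) ≤ c := by
    norm_cast; calc c1 ≤ c1 + (c0 + c2 + c3 + c5) := le_self_add
      _ = c := by simp only [c]; ring
  have l2 : (c2 : ℝ≥0∞) ≤ c := by
    norm_cast; calc c2 ≤ c2 + (c0 + c1 + c3 + c5) := le_self_add
      _ = c := by simp only [c]; ring
  have l3 : (c3 : ℝ≥0∞) ≤ c := by
    norm_cast; calc c3 ≤ c3 + (c0 + c1 + c2 + c5) := le_self_add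
      _ = c := by simp only [c]; ring
  have l5 : (c5 : ℝ≥0∞) ≤ c := by
    norm_cast; exact le_add_self
  refine ⟨c, fun s hs => ?_⟩
  have hsr : (s : ℝ) ≠ 0 := by exact_mod_cast hs
  have hse : (s : ℝ≥0∞) * (s⁻¹ : ℝ≥0) = 1 := by
    rw [← ENNReal.coe_mul, mul_inv_cancel₀ hs, ENNReal.coe_one]
  have ns : ∀ y : ℝ, ‖(s : ℝ) ^ 2 * y‖ₑ = s ^ 2 * ‖y‖ₑ := fun y => by
    rw [enorm_mul, enorm_pow]; simp
  have ny : ∀ y : Plane, ‖y‖ₑ = (s⁻¹ : ℝ≥0) * ‖(s : ℝ) • y‖ₑ := fun y => by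
    rw [enorm_smul, ← mul_assoc]
    have : ‖(s : ℝ)‖ₑ = s := by simp
    rw [this, mul_comm _ (s : ℝ≥0∞), hse, one_mul]
  have fin2 : ((s : ℝ≥0∞)) ^ 2 ≠ ⊤ := by finiteness
  -- The factor `s²` is the Jacobian of the dilation in dimension two, so each integral reduces to
  -- the one at scale `1`; every weight `‖y‖` then costs `s⁻¹` and every increment `h` costs `s`.
  have sc : ∀ g : Plane → ℝ≥0∞, ∫⁻ y, (s : ℝ≥0∞) ^ 2 * g ((s : ℝ) • y) = ∫⁻ y, g y := fun g => by
    rw [lintegral_const_mul' _ _ fin2, lintegral_comp_smul_plane g hs, ← mul_assoc, ← mul_pow,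
      hse, one_pow, one_mul]
  refine ⟨by fun_prop, ?_, ?_, ?_, ?_, ?_, ?_, ?_, ?_⟩
  · exact ((f.integrable (μ := volume)).comp_smul hsr).const_mul _
  · rw [integral_const_mul, Measure.integral_comp_smul, hf]
    simp
    field_simp
  · simp only [ns]
    rw [sc fun y => ‖f y‖ₑ, ← hc0]; exact l0
  · simp only [ns]
    calc ∫⁻ y, s ^ 2 * ‖f ((s : ℝ) • y)‖ₑ * ‖y‖ₑ
        = ∫⁻ y, (s : ℝ≥0∞) ^ 2 * ((s⁻¹ : ℝ≥0) * (‖f ((s : ℝ) • y)‖ₑ * ‖(s : ℝ) • y‖ₑ)) := by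
          refine lintegral_congr fun y => ?_
          rw [ny y]; ring
      _ = (s⁻¹ : ℝ≥0) * ∫⁻ y, ‖f y‖ₑ * ‖y‖ₑ := by
          rw [sc fun y => ((s⁻¹ : ℝ≥0) : ℝ≥0∞) * (‖f y‖ₑ * ‖y‖ₑ),
            lintegral_const_mul' _ _ ENNReal.coe_ne_top]
      _ ≤ _ := by rw [← hc1, mul_comm]; gcongr
  · simp only [ns]
    calc ∫⁻ y, s ^ 2 * ‖f ((s : ℝ) • y)‖ₑ * ‖y‖ₑ ^ 2
        = ∫⁻ y, (s : ℝ≥0∞) ^ 2 * ((s⁻¹ : ℝ≥0) ^ 2 * (‖f ((s : ℝ) • y)‖ₑ * ‖(s : ℝ) • y‖ₑ ^ 2)) := by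
          refine lintegral_congr fun y => ?_
          rw [ny y]; ring
      _ = (s⁻¹ : ℝ≥0) ^ 2 * ∫⁻ y, ‖f y‖ₑ * ‖y‖ₑ ^ 2 := by
          rw [sc fun y => ((s⁻¹ : ℝ≥0) : ℝ≥0∞) ^ 2 * (‖f y‖ₑ * ‖y‖ₑ ^ 2),
            lintegral_const_mul' _ _ (by finiteness)]
      _ ≤ _ := by rw [← hc2, mul_comm]; gcongr
  · simp only [ns]
    calc ∫⁻ y, (s ^ 2 * ‖f ((s : ℝ) • y)‖ₑ) ^ 2
        = ∫⁻ y, (s : ℝ≥0∞) ^ 2 * (s ^ 2 * ‖f ((s : ℝ) • y)‖ₑ ^ 2) := by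
          refine lintegral_congr fun y => ?_
          ring
      _ = s ^ 2 * ∫⁻ y, ‖f y‖ₑ ^ 2 := by
          rw [sc fun y => (s : ℝ≥0∞) ^ 2 * ‖f y‖ₑ ^ 2, lintegral_const_mul' _ _ fin2]
      _ ≤ _ := by rw [← hc5, mul_comm]; gcongr
  · intro h
    simp only [← mul_sub, ns, smul_add]
    rw [sc fun y => ‖f (y + (s : ℝ) • h) - f y‖ₑ]
    refine (lintegral_enorm_add_sub_le (f.smooth 1) _).trans ?_
    simp only [← h1, ← hc3]
    rw [enorm_smul, ← mul_assoc]
    have : ‖(s : ℝ)‖ₑ = s := by simp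
    rw [this]
    gcongr
  · refine ⟨fun y => ((s : ℝ) ^ 3) • f1 ((s : ℝ) • y), c4 * s ^ 2, ?_, ?_⟩
    · exact ((f1.integrable (μ := volume)).comp_smul hsr).smul ((s : ℝ) ^ 3)
    · intro h
      have e : ∀ y, (s : ℝ) ^ 2 * f ((s : ℝ) • (y + h)) - (s : ℝ) ^ 2 * f ((s : ℝ) • y)
          - (((s : ℝ) ^ 3) • f1 ((s : ℝ) • y)) h
          = (s : ℝ) ^ 2 * (f ((s : ℝ) • y + (s : ℝ) • h) - f ((s : ℝ) • y)
            - fderiv ℝ f ((s : ℝ) • y) ((s : ℝ) • h)) := fun y => by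
        rw [h1, smul_add, (fderiv ℝ f ((s : ℝ) • y)).map_smul]
        simp only [FunLike.coe_smul, Pi.smul_apply, smul_eq_mul]
        ring
      simp only [e, ns]
      rw [sc fun y => ‖f (y + (s : ℝ) • h) - f y - fderiv ℝ f y ((s : ℝ) • h)‖ₑ]
      refine (f.lintegral_remainder_le _).trans ?_
      simp only [← h2, ← hc4]
      rw [enorm_smul]
      have : ‖(s : ℝ)‖ₑ = s := by simp
      rw [this]
      push_cast
      rw [mul_pow, mul_assoc]

theorem IsLPCutoff.hasCompactSupport {χ : Plane → ℝ} (hχ : IsLPCutoff χ) :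
    HasCompactSupport χ :=
  HasCompactSupport.of_support_subset_isCompact (isCompact_closedBall (0 : Plane) 2) fun ξ hξ => by
    rw [mem_closedBall_zero_iff]
    by_contra h
    exact hξ (hχ.eq_zero ξ (not_le.mp h).le)

/-- The kernels of the multipliers `P_{<k}` are dilates of one Schwartz function of mean one. -/
theorem IsLPCutoff.exists_schwartz {χ : Plane → ℝ} (hχ : IsLPCutoff χ) :
    ∃ f : 𝓢(Plane, ℝ), ∫ y, f y = 1 ∧ ∀ (k : ℤ) (y : Plane),
      lowKernel χ k y = ((2 : ℝ) ^ k) ^ 2 * f ((2 : ℝ) ^ k • y) := by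
  have hc : HasCompactSupport fun ξ => ((χ ξ : ℝ) : ℂ) :=
    hχ.hasCompactSupport.comp_left (g := fun x : ℝ => (x : ℂ)) Complex.ofReal_zero
  set X : 𝓢(Plane, ℂ) := hc.toSchwartzMap (Complex.ofRealCLM.contDiff.comp hχ.contDiff) with hX
  have hXa : ∀ ξ, X ξ = χ ξ := fun ξ => rfl
  have hXc : (X : Plane → ℂ) = fun ξ => ((χ ξ : ℝ) : ℂ) := rfl
  set g : 𝓢(Plane, ℂ) := 𝓕⁻ X with hg
  set f : 𝓢(Plane, ℝ) := SchwartzMap.postcompCLM (𝕜 := ℝ) Complex.reCLM g with hf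
  have hfa : ∀ y, f y = (g y).re := fun y => rfl
  refine ⟨f, ?_, ?_⟩
  · have h1 : 𝓕 g = X := by simp [hg]
    have h2 : ∫ y, g y = 1 := by
      -- The integral is the value of the Fourier transform at the origin, where the cutoff equals
      -- `1`.
      have h3 : (𝓕 g) 0 = X 0 := by rw [h1]
      rw [SchwartzMap.fourier_coe, Real.fourier_eq'] at h3
      simpa [hXa, hχ.eq_one 0 (by simp)] using h3
    have h4 : ∫ y, f y = (∫ y, g y).re := by
      simp only [hfa]
      exact integral_re (g.integrable (μ := volume))
    rw [h4, h2, Complex.one_re]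
  · intro k y
    rw [hfa, hg, SchwartzMap.fourierInv_coe, hXc]
    unfold lowKernel
    have h2k : (2 : ℝ) ^ k ≠ 0 := zpow_ne_zero _ two_ne_zero
    have e : 𝓕⁻ (fun ξ : Plane => ((χ ((2 : ℝ) ^ (-k) • ξ) : ℝ) : ℂ)) y
        = (((2 : ℝ) ^ k) ^ 2 : ℝ) • 𝓕⁻ (fun ξ : Plane => ((χ ξ : ℝ) : ℂ)) ((2 : ℝ) ^ k • y) := by
      rw [Real.fourierInv_eq', Real.fourierInv_eq']
      have := Measure.integral_comp_smul (volume : Measure Plane) (fun v : Plane =>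
        Complex.exp (↑(2 * Real.pi * inner ℝ v ((2 : ℝ) ^ k • y)) * Complex.I) • ((χ v : ℝ) : ℂ))
        ((2 : ℝ) ^ (-k))
      have e2 : |(((2 : ℝ) ^ (-k)) ^ Module.finrank ℝ Plane)⁻¹| = ((2 : ℝ) ^ k) ^ 2 := by
        rw [finrank_euclideanSpace, Fintype.card_fin, zpow_neg, inv_pow, inv_inv,
          abs_of_nonneg (by positivity)]
      rw [e2] at this
      rw [← this]
      congr 1
      ext v
      rw [real_inner_smul_left, real_inner_smul_right, ← mul_assoc ((2 : ℝ) ^ (-k)), zpow_neg,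
        inv_mul_cancel₀ h2k, one_mul]
    rw [e, Complex.real_smul, Complex.re_ofReal_mul]

theorem IsLPCutoff.exists_isKernelAtScale {χ : Plane → ℝ} (hχ : IsLPCutoff χ) :
    ∃ c : ℝ≥0, ∀ k : ℤ, IsKernelAtScale c ((2 : ℝ≥0) ^ k) (lowKernel χ k) := by
  obtain ⟨f, hf, hk⟩ := hχ.exists_schwartz
  obtain ⟨c, hc⟩ := f.exists_isKernelAtScale hf
  refine ⟨c, fun k => ?_⟩
  convert hc ((2 : ℝ≥0) ^ k) (zpow_ne_zero _ two_ne_zero) using 2 with y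
  rw [hk]
  simp

end Kernels

/-! ### Convolution estimates for kernels at a given scale -/

section Smoothing

open scoped NNReal

set_option linter.unusedSectionVars false

variable {F : Type*} [NormedAddCommGroup F] [NormedSpace ℝ F]

/-- Convolution of a vector valued function with a scalar kernel on the plane. -/
noncomputable def smoothing (κ : Plane → ℝ) (f : Plane → F) : Plane → F :=
  convolution κ f (ContinuousLinearMap.lsmul ℝ ℝ) volume

theorem smoothing_apply (κ : Plane → ℝ) (f : Plane → F) (x : Plane) :
    smoothing κ f x = ∫ y, κ y • f (x - y) := rfl

theorem lpLow_eq_smoothing (χ : Plane → ℝ) (k : ℤ) (f : Plane → F) :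
    lpLow χ k f = smoothing (lowKernel χ k) f := rfl

theorem enorm_smoothing_le (κ : Plane → ℝ) (f : Plane → F) (x : Plane) :
    ‖smoothing κ f x‖ₑ ≤ ∫⁻ y, ‖κ y‖ₑ * ‖f (x - y)‖ₑ := by
  rw [smoothing_apply]
  refine (enorm_integral_le_lintegral_enorm _).trans (le_of_eq ?_)
  simp only [enorm_smul]

theorem smoothing_congr_ae (κ : Plane → ℝ) {f g : Plane → F} (h : f =ᵐ[volume] g) :
    smoothing κ f = smoothing κ g :=
  convolution_congr _ (ae_eq_refl _) h

theorem smoothing_add_right (κ : Plane → ℝ) (f : Plane → F) (x h : Plane) :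
    smoothing κ f (x + h) = ∫ y, κ (y + h) • f (x - y) := by
  rw [smoothing_apply, ← integral_add_right_eq_self _ h]
  simp only [add_sub_add_right_eq_sub]

theorem smoothing_comp_add_right (κ : Plane → ℝ) (f : Plane → F) (x h : Plane) :
    smoothing κ (fun z => f (z + h)) x = smoothing κ f (x + h) := by
  rw [smoothing_apply, smoothing_apply]
  congr 1
  ext y
  rw [sub_add_eq_add_sub]

/-- The translation is moved onto the kernel, since `f` itself has no regularity to offer. -/
theorem smoothing_add_sub (κ : Plane → ℝ) {f : Plane → F}
    (hi : ∀ x, Integrable fun y => κ y • f (x - y)) (x h : Plane) :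
    smoothing κ f (x + h) - smoothing κ f x = ∫ y, (κ (y + h) - κ y) • f (x - y) := by
  rw [smoothing_add_right, smoothing_apply, ← integral_sub _ (hi x)]
  · simp only [sub_smul]
  · have := (hi (x + h)).comp_add_right h
    simpa only [add_sub_add_right_eq_sub] using this

theorem smoothing_sub_self [CompleteSpace F] {κ : Plane → ℝ} (hκ : Integrable κ)
    (h1 : ∫ y, κ y = 1) {f : Plane → F} {x : Plane}
    (hi : Integrable fun y => κ y • f (x - y)) :
    smoothing κ f x - f x = ∫ y, κ y • (f (x - y) - f x) := by
  simp only [smul_sub]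
  rw [integral_sub hi (hκ.smul_const _), integral_smul_const, h1, one_smul, smoothing_apply]

variable [MeasurableSpace F] [BorelSpace F] [SecondCountableTopology F]

theorem measurable_smoothing {κ : Plane → ℝ} (hκ : Continuous κ) {f : Plane → F}
    (hf : Measurable f) : Measurable (smoothing κ f) := by
  have h : StronglyMeasurable fun p : Plane × Plane => κ p.2 • f (p.1 - p.2) :=
    ((hκ.measurable.comp measurable_snd).smul
      (hf.comp (measurable_fst.sub measurable_snd))).stronglyMeasurable
  exact h.integral_prod_right'.measurable

namespace IsKernelAtScale

variable {c s : ℝ≥0} {κ : Plane → ℝ}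

theorem integrable_of_bound (K : IsKernelAtScale c s κ) {f : Plane → F} (hf : Measurable f)
    {R : ℝ} (hR : ∀ x, ‖f x‖ ≤ R) (x : Plane) : Integrable fun y => κ y • f (x - y) :=
  K.integrable.smul_bdd R (hf.comp (measurable_const.sub measurable_id)).aestronglyMeasurable
    (ae_of_all _ fun _ => hR _)

theorem integrable_of_sq (K : IsKernelAtScale c s κ) {f : Plane → F} (hf : Measurable f)
    (h2 : ∫⁻ x, ‖f x‖ₑ ^ 2 ≠ ⊤) (x : Plane) : Integrable fun y => κ y • f (x - y) := by
  have hm : Measurable fun y => f (x - y) := hf.comp (measurable_const.sub measurable_id)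
  refine ⟨(K.continuous.aestronglyMeasurable.smul hm.aestronglyMeasurable), ?_⟩
  rw [HasFiniteIntegral]
  simp only [enorm_smul]
  have := sq_lintegral_mul_le (μ := (volume : Measure Plane)) K.continuous.enorm.measurable.aemeasurable
    hm.enorm.aemeasurable
  rw [lintegral_sub_left_eq_self (fun y => ‖f y‖ₑ ^ 2) x] at this
  have h3 : (∫⁻ y, ‖κ y‖ₑ ^ 2) * ∫⁻ y, ‖f y‖ₑ ^ 2 < ⊤ :=
    ENNReal.mul_lt_top (K.lintegral_sq_le.trans_lt (by finiteness)) h2.lt_top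
  have h4 := this.trans_lt h3
  by_contra hc
  rw [not_lt, top_le_iff] at hc
  rw [hc] at h4
  simp at h4

theorem lintegral_sq_smoothing_le (K : IsKernelAtScale c s κ) {f : Plane → F}
    (hf : Measurable f) : ∫⁻ x, ‖smoothing κ f x‖ₑ ^ 2 ≤ c ^ 2 * ∫⁻ x, ‖f x‖ₑ ^ 2 := by
  refine (lintegral_mono fun x => pow_le_pow_left' (enorm_smoothing_le κ f x) 2).trans ?_
  refine (lintegral_weight_sub_sq_le K.continuous.enorm.measurable hf.enorm).trans ?_
  gcongr
  exact K.lintegral_le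

theorem lintegral_sq_smoothing_le' (K : IsKernelAtScale c s κ) {f : Plane → F}
    (hf : Measurable f) :
    ∫⁻ x, ‖smoothing κ f x‖ₑ ^ 2 ≤ c * s ^ 2 * (∫⁻ x, ‖f x‖ₑ) ^ 2 := by
  refine (lintegral_mono fun x => pow_le_pow_left' (enorm_smoothing_le κ f x) 2).trans ?_
  refine (lintegral_weight_sub_sq_le' K.continuous.enorm.measurable hf.enorm).trans ?_
  gcongr
  exact K.lintegral_sq_le

/-- As `κ` has mean one, `f x` can be put under the integral, and Minkowski's inequality leaves the
second moment of `κ`. Only the increments of `f` need be in `L²`, so this applies to `M`-valued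
maps. -/
theorem lintegral_sq_smoothing_sub_le [CompleteSpace F] (K : IsKernelAtScale c s κ) {f : Plane → F}
    (hf : Measurable f) (hi : ∀ x, Integrable fun y => κ y • f (x - y)) {G : ℝ≥0∞}
    (hG : ∀ y, ∫⁻ x, ‖f (x - y) - f x‖ₑ ^ 2 ≤ G * ‖y‖ₑ ^ 2) :
    ∫⁻ x, ‖smoothing κ f x - f x‖ₑ ^ 2 ≤ c ^ 2 * (s⁻¹ : ℝ≥0) ^ 2 * G := by
  have h1 : ∀ x, ‖smoothing κ f x - f x‖ₑ ≤ ∫⁻ y, ‖κ y‖ₑ * ‖f (x - y) - f x‖ₑ := fun x => by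
    rw [smoothing_sub_self K.integrable K.integral_eq_one (hi x)]
    refine (enorm_integral_le_lintegral_enorm _).trans (le_of_eq ?_)
    simp only [enorm_smul]
  have hkm := K.continuous.enorm.measurable
  calc ∫⁻ x, ‖smoothing κ f x - f x‖ₑ ^ 2
      ≤ ∫⁻ x, (∫⁻ y, ‖κ y‖ₑ * ‖f (x - y) - f x‖ₑ) ^ 2 :=
        lintegral_mono fun x => pow_le_pow_left' (h1 x) 2
    _ ≤ (∫⁻ y, ‖κ y‖ₑ) * ∫⁻ y, ‖κ y‖ₑ * ∫⁻ x, ‖f (x - y) - f x‖ₑ ^ 2 :=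
        lintegral_sq_lintegral_weight_mul_le (H := fun x y => ‖f (x - y) - f x‖ₑ) hkm
          ((hf.comp (measurable_fst.sub measurable_snd)).sub (hf.comp measurable_fst)).enorm
    _ ≤ c * ∫⁻ y, ‖κ y‖ₑ * (G * ‖y‖ₑ ^ 2) := by
        gcongr with y
        · exact K.lintegral_le
        · exact hG y
    _ = c * (G * ∫⁻ y, ‖κ y‖ₑ * ‖y‖ₑ ^ 2) := by
        rw [← lintegral_const_mul G (f := fun y => ‖κ y‖ₑ * ‖y‖ₑ ^ 2)
          (hkm.mul (measurable_id.enorm.pow_const 2))]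
        congr 2; ext y; ring
    _ ≤ c * (G * (c * (s⁻¹ : ℝ≥0) ^ 2)) := by
        gcongr; exact K.moment_sq_le
    _ = _ := by ring

theorem enorm_smoothing_add_sub_le (K : IsKernelAtScale c s κ) {f : Plane → F} (hf : Measurable f)
    {R : ℝ≥0} (hR : ∀ x, ‖f x‖ ≤ R) (x h : Plane) :
    ‖smoothing κ f (x + h) - smoothing κ f x‖ₑ ≤ c * s * R * ‖h‖ₑ := by
  rw [smoothing_add_sub κ (K.integrable_of_bound hf hR)]
  calc _ ≤ ∫⁻ y, ‖(κ (y + h) - κ y) • f (x - y)‖ₑ := enorm_integral_le_lintegral_enorm _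
    _ ≤ ∫⁻ y, ‖κ (y + h) - κ y‖ₑ * R := by
        refine lintegral_mono fun y => ?_
        rw [enorm_smul]
        gcongr
        exact enorm_le_coe.mpr (hR _)
    _ = (∫⁻ y, ‖κ (y + h) - κ y‖ₑ) * R := lintegral_mul_const' _ _ ENNReal.coe_ne_top
    _ ≤ c * s * ‖h‖ₑ * R := by gcongr; exact K.lintegral_add_sub_le h
    _ = _ := by ring

theorem enorm_smoothing_le_of_bound (K : IsKernelAtScale c s κ) {f : Plane → F}
    {R : ℝ≥0} (hR : ∀ x, ‖f x‖ ≤ R) (x : Plane) :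
    ‖smoothing κ f x‖ₑ ≤ c * R := by
  refine (enorm_smoothing_le κ f x).trans ?_
  calc _ ≤ ∫⁻ y, ‖κ y‖ₑ * R := by
        gcongr with y
        exact enorm_le_coe.mpr (hR _)
    _ = (∫⁻ y, ‖κ y‖ₑ) * R := lintegral_mul_const' _ _ ENNReal.coe_ne_top
    _ ≤ _ := by gcongr; exact K.lintegral_le

theorem lintegral_sq_smoothing_add_sub_le (K : IsKernelAtScale c s κ) {f : Plane → F}
    (hf : Measurable f) (hi : ∀ x, Integrable fun y => κ y • f (x - y)) (h : Plane) :
    ∫⁻ x, ‖smoothing κ f (x + h) - smoothing κ f x‖ₑ ^ 2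
      ≤ (c * s * ‖h‖ₑ) ^ 2 * ∫⁻ x, ‖f x‖ₑ ^ 2 := by
  have h1 : ∀ x, ‖smoothing κ f (x + h) - smoothing κ f x‖ₑ
      ≤ ∫⁻ y, ‖κ (y + h) - κ y‖ₑ * ‖f (x - y)‖ₑ := fun x => by
    rw [smoothing_add_sub κ hi]
    refine (enorm_integral_le_lintegral_enorm _).trans (le_of_eq ?_)
    simp only [enorm_smul]
  refine (lintegral_mono fun x => pow_le_pow_left' (h1 x) 2).trans ?_
  have hc : Continuous fun y => κ (y + h) - κ y :=
    (K.continuous.comp (continuous_add_const h)).sub K.continuous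
  refine (lintegral_weight_sub_sq_le hc.enorm.measurable hf.enorm).trans ?_
  gcongr
  exact K.lintegral_add_sub_le h

/-- The derivative falls on the kernel: its first-order remainder is `O(‖h‖²)` in `L¹`, and `f` is
bounded. -/
theorem differentiableAt_smoothing (K : IsKernelAtScale c s κ) {f : Plane → F} (hf : Measurable f)
    {R : ℝ≥0} (hR : ∀ x, ‖f x‖ ≤ R) (x : Plane) : DifferentiableAt ℝ (smoothing κ f) x := by
  obtain ⟨κ', C, hκ', hrem⟩ := K.exists_deriv
  have hfm : AEStronglyMeasurable (fun y => f (x - y)) volume :=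
    (hf.comp (measurable_const.sub measurable_id)).aestronglyMeasurable
  have hκint : Integrable fun y => (κ' y).smulRight (f (x - y)) := by
    refine (hκ'.norm.mul_const (R : ℝ)).mono' ?_ (ae_of_all _ fun y => ?_)
    · exact (ContinuousLinearMap.smulRightL ℝ Plane F).continuous₂.comp_aestronglyMeasurable₂
        hκ'.aestronglyMeasurable hfm
    · rw [ContinuousLinearMap.norm_smulRight_apply]
      gcongr
      exact hR _
  refine ⟨∫ y, (κ' y).smulRight (f (x - y)), ?_⟩
  rw [hasFDerivAt_iff_isLittleO_nhds_zero]
  have hb : ∀ h, ‖smoothing κ f (x + h) - smoothing κ f x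
      - (∫ y, (κ' y).smulRight (f (x - y))) h‖ ≤ (C * R) * ‖h‖ ^ 2 := by
    intro h
    have hi1 : Integrable fun y => (κ (y + h) - κ y) • f (x - y) := by
      exact ((K.integrable.comp_add_right h).sub K.integrable).smul_bdd R hfm
        (ae_of_all _ fun y => hR _)
    have e : smoothing κ f (x + h) - smoothing κ f x
        - (∫ y, (κ' y).smulRight (f (x - y))) h
        = ∫ y, (κ (y + h) - κ y - κ' y h) • f (x - y) := by
      rw [smoothing_add_sub κ (K.integrable_of_bound hf hR),
        ContinuousLinearMap.integral_apply hκint, ← integral_sub hi1]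
      · simp only [ContinuousLinearMap.smulRight_apply, ← sub_smul]
      · exact hκint.apply_continuousLinearMap h
    rw [e]
    have h2 : ‖∫ y, (κ (y + h) - κ y - κ' y h) • f (x - y)‖ₑ ≤ C * ‖h‖ₑ ^ 2 * R := by
      calc _ ≤ ∫⁻ y, ‖(κ (y + h) - κ y - κ' y h) • f (x - y)‖ₑ :=
            enorm_integral_le_lintegral_enorm _
        _ ≤ ∫⁻ y, ‖κ (y + h) - κ y - κ' y h‖ₑ * R := by
            refine lintegral_mono fun y => ?_
            rw [enorm_smul]
            gcongr
            exact enorm_le_coe.mpr (hR _)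
        _ = (∫⁻ y, ‖κ (y + h) - κ y - κ' y h‖ₑ) * R :=
            lintegral_mul_const' _ _ ENNReal.coe_ne_top
        _ ≤ _ := by gcongr; exact hrem h
    have h3 : ‖∫ y, (κ (y + h) - κ y - κ' y h) • f (x - y)‖₊ ≤ C * ‖h‖₊ ^ 2 * R := by
      simp only [enorm_eq_nnnorm] at h2
      exact_mod_cast h2
    calc _ ≤ ((C * ‖h‖₊ ^ 2 * R : ℝ≥0) : ℝ) := by exact_mod_cast h3
      _ = _ := by push_cast; ring
  refine (Asymptotics.IsBigO.of_bound (C * R) (Eventually.of_forall fun h => ?_)).trans_isLittleO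
    (g := fun h : Plane => ‖h‖ ^ 2) (Asymptotics.isLittleO_norm_pow_id one_lt_two)
  simpa using hb h

end IsKernelAtScale

end Smoothing

/-! ### Bounds for the normal part of a smoothed field -/

section NormalComponent

open scoped NNReal

set_option linter.unusedSectionVars false

variable {F : Type*} [NormedAddCommGroup F] [NormedSpace ℝ F] [MeasurableSpace F] [BorelSpace F]
  [SecondCountableTopology F] [CompleteSpace F]

theorem lintegral_mul_le_mul_of_sq_le {α : Type*} [MeasurableSpace α] {μ : Measure α}
    {f g : α → ℝ≥0∞} (hf : AEMeasurable f μ) (hg : AEMeasurable g μ) {a b : ℝ≥0∞}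
    (ha : ∫⁻ x, f x ^ 2 ∂μ ≤ a ^ 2) (hb : ∫⁻ x, g x ^ 2 ∂μ ≤ b ^ 2) :
    ∫⁻ x, f x * g x ∂μ ≤ a * b := by
  have h : (∫⁻ x, f x * g x ∂μ) ^ 2 ≤ (a * b) ^ 2 := by
    refine (sq_lintegral_mul_le hf hg).trans ?_
    rw [mul_pow]
    gcongr
  exact (ENNReal.pow_le_pow_left_iff two_ne_zero).mp h

/-- The part of `κ ∗ ψ` that the field of operators `B` along `u` fails to reproduce. -/
noncomputable def normalPart (κ : Plane → ℝ) (B : F → F →L[ℝ] F) (u ψ : Plane → F) (x : Plane) : F :=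
  smoothing κ ψ x - B (u x) (smoothing κ ψ x)

variable {c s Λ : ℝ≥0} {κ : Plane → ℝ} {B : F → F →L[ℝ] F} {φ u v ψ : Plane → F}

theorem measurable_clm_comp (hB : Continuous B) (hφ : Measurable φ) (hψ : Measurable ψ) :
    Measurable fun x => B (φ x) (ψ x) := by
  have : Continuous fun p : F × F => B p.1 p.2 := (hB.comp continuous_fst).clm_apply continuous_snd
  exact this.measurable.comp (hφ.prodMk hψ)

theorem enorm_sub_clm_le (hB : LipschitzWith Λ B) (a b w : F) :
    ‖w - B b w‖ₑ ≤ ‖w - B a w‖ₑ + Λ * ‖a - b‖ₑ * ‖w‖ₑ := by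
  have e : w - B b w = (w - B a w) + (B a - B b) w := by
    simp
  rw [e]
  refine (enorm_add_le _ _).trans ?_
  gcongr
  refine (ContinuousLinearMap.le_opENorm _ _).trans ?_
  gcongr
  have := hB a b
  rwa [edist_eq_enorm_sub, edist_eq_enorm_sub] at this

/-- The operator `B (u x)` is constant in the integration variable, so it passes under the integral
and acts on the unsmoothed `ψ`, whose tangency can then be used. -/
theorem IsKernelAtScale.enorm_normalPart_le (K : IsKernelAtScale c s κ) (hψ : Measurable ψ)
    (h2 : ∫⁻ x, ‖ψ x‖ₑ ^ 2 ≠ ⊤) (x : Plane) :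
    ‖normalPart κ B u ψ x‖ₑ ≤ ∫⁻ y, ‖κ y‖ₑ * ‖ψ (x - y) - B (u x) (ψ (x - y))‖ₑ := by
  have hi := K.integrable_of_sq hψ h2 x
  have e : normalPart κ B u ψ x = ∫ y, κ y • (ψ (x - y) - B (u x) (ψ (x - y))) := by
    have hi2 : Integrable fun y => κ y • B (u x) (ψ (x - y)) := by
      simpa using (B (u x)).integrable_comp hi
    simp only [smul_sub]
    rw [integral_sub hi hi2, normalPart, smoothing_apply, ← ContinuousLinearMap.integral_comp_comm _ hi]
    simp
  rw [e]
  refine (enorm_integral_le_lintegral_enorm _).trans (le_of_eq ?_)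
  simp only [enorm_smul]

/-- The reference map `v` splits `φ(x-y) - u(x)` in two. The part `φ - v`, multiplied by `ψ`, lies
only in `L¹`, as does the tangency defect `δ`; both are brought to `L²` by the `L²` norm of `κ`. The
part `v(x-y) - u(x)` is bounded pointwise and is absorbed into the kernel as a weight. -/
theorem IsKernelAtScale.lintegral_sq_normalPart_le (K : IsKernelAtScale c s κ)
    (hB : LipschitzWith Λ B) (hφ : Measurable φ) (hv : Measurable v) (hψ : Measurable ψ)
    {Q D δ η θ : ℝ≥0} (hQ : ∫⁻ x, ‖ψ x‖ₑ ^ 2 ≤ (Q : ℝ≥0∞) ^ 2)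
    (hD : ∫⁻ x, ‖φ x - v x‖ₑ ^ 2 ≤ (D : ℝ≥0∞) ^ 2)
    (hδ : ∫⁻ x, ‖ψ x - B (φ x) (ψ x)‖ₑ ≤ δ)
    (hu : ∀ x y, ‖v (x - y) - u x‖ₑ ≤ η + θ * ‖y‖ₑ) :
    ∫⁻ x, ‖normalPart κ B u ψ x‖ₑ ^ 2
      ≤ 2 * (c * s ^ 2 * (δ + Λ * (D * Q)) ^ 2
        + (Λ * (c * η + c * (s⁻¹ : ℝ≥0) * θ)) ^ 2 * (Q : ℝ≥0∞) ^ 2) := by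
  have hkm := K.continuous.enorm.measurable
  have hym : Measurable fun y : Plane => ‖y‖ₑ := measurable_id.enorm
  have hψe : Measurable fun y => ‖ψ y‖ₑ := hψ.enorm
  have hfin : ∫⁻ x, ‖ψ x‖ₑ ^ 2 ≠ ⊤ := ne_top_of_le_ne_top (by finiteness) hQ
  set G : Plane → ℝ≥0∞ := fun z => ‖ψ z - B (φ z) (ψ z)‖ₑ + Λ * (‖φ z - v z‖ₑ * ‖ψ z‖ₑ) with hG
  set k : Plane → ℝ≥0∞ := fun y => Λ * (‖κ y‖ₑ * (η + θ * ‖y‖ₑ)) with hk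
  have hG1 : Measurable fun z => ‖ψ z - B (φ z) (ψ z)‖ₑ :=
    (hψ.sub (measurable_clm_comp hB.continuous hφ hψ)).enorm
  have hG2 : Measurable fun z => ‖φ z - v z‖ₑ * ‖ψ z‖ₑ := (hφ.sub hv).enorm.mul hψe
  have hGm : Measurable G := hG1.add (hG2.const_mul _)
  have hk1 : Measurable fun y => ‖κ y‖ₑ * (η + θ * ‖y‖ₑ) :=
    hkm.mul ((hym.const_mul _).const_add _)
  have hkmeas : Measurable k := hk1.const_mul _
  have hpt : ∀ x, ‖normalPart κ B u ψ x‖ₑ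
      ≤ (∫⁻ y, ‖κ y‖ₑ * G (x - y)) + ∫⁻ y, k y * ‖ψ (x - y)‖ₑ := by
    intro x
    refine (K.enorm_normalPart_le hψ hfin x).trans ?_
    have hmx : Measurable fun y => ‖κ y‖ₑ * G (x - y) :=
      hkm.mul (hGm.comp (measurable_const.sub measurable_id))
    rw [← lintegral_add_left hmx]
    refine lintegral_mono fun y => ?_
    have h1 := enorm_sub_clm_le hB (φ (x - y)) (u x) (ψ (x - y))
    have h2 : ‖φ (x - y) - u x‖ₑ ≤ ‖φ (x - y) - v (x - y)‖ₑ + (η + θ * ‖y‖ₑ) := by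
      have e : φ (x - y) - u x = (φ (x - y) - v (x - y)) + (v (x - y) - u x) := by abel
      rw [e]
      exact (enorm_add_le _ _).trans (by gcongr; exact hu x y)
    calc _ ≤ ‖κ y‖ₑ * (‖ψ (x - y) - B (φ (x - y)) (ψ (x - y))‖ₑ
          + Λ * (‖φ (x - y) - v (x - y)‖ₑ + (η + θ * ‖y‖ₑ)) * ‖ψ (x - y)‖ₑ) := by
          gcongr
          exact h1.trans (by gcongr)
      _ = _ := by
          simp only [hG, hk]
          ring
  have i1 : ∫⁻ z, G z ≤ δ + Λ * (D * Q) := by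
    rw [hG, lintegral_add_left hG1, lintegral_const_mul _ hG2]
    gcongr
    exact lintegral_mul_le_mul_of_sq_le (hφ.sub hv).enorm.aemeasurable hψe.aemeasurable hD hQ
  have i2 : ∫⁻ y, k y ≤ Λ * (c * η + c * (s⁻¹ : ℝ≥0) * θ) := by
    rw [hk, lintegral_const_mul _ hk1]
    gcongr
    calc ∫⁻ y, ‖κ y‖ₑ * (η + θ * ‖y‖ₑ)
        = ∫⁻ y, ‖κ y‖ₑ * η + θ * (‖κ y‖ₑ * ‖y‖ₑ) := by
          congr 1; ext y; ring
      _ = (∫⁻ y, ‖κ y‖ₑ) * η + θ * ∫⁻ y, ‖κ y‖ₑ * ‖y‖ₑ := by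
          rw [lintegral_add_left (hkm.mul_const _), lintegral_mul_const _ hkm,
            lintegral_const_mul (θ : ℝ≥0∞) (f := fun y => ‖κ y‖ₑ * ‖y‖ₑ) (hkm.mul hym)]
      _ ≤ c * η + θ * (c * (s⁻¹ : ℝ≥0)) := by
          gcongr
          · exact K.lintegral_le
          · exact K.moment_le
      _ = _ := by ring
  calc ∫⁻ x, ‖normalPart κ B u ψ x‖ₑ ^ 2
      ≤ ∫⁻ x, 2 * ((∫⁻ y, ‖κ y‖ₑ * G (x - y)) ^ 2 + (∫⁻ y, k y * ‖ψ (x - y)‖ₑ) ^ 2) :=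
        lintegral_mono fun x => (pow_le_pow_left' (hpt x) 2).trans (add_sq_le_two_mul _ _)
    _ = 2 * ((∫⁻ x, (∫⁻ y, ‖κ y‖ₑ * G (x - y)) ^ 2)
          + ∫⁻ x, (∫⁻ y, k y * ‖ψ (x - y)‖ₑ) ^ 2) := by
        have m1 : Measurable fun x => (∫⁻ y, ‖κ y‖ₑ * G (x - y)) ^ 2 := by
          refine Measurable.pow_const (Measurable.lintegral_prod_right'
            (f := fun p : Plane × Plane => ‖κ p.2‖ₑ * G (p.1 - p.2)) ?_) 2
          exact (hkm.comp measurable_snd).mul (hGm.comp (measurable_fst.sub measurable_snd))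
        rw [lintegral_const_mul' _ _ (by finiteness), lintegral_add_left m1]
    _ ≤ 2 * ((∫⁻ x, ‖κ x‖ₑ ^ 2) * (∫⁻ y, G y) ^ 2
          + (∫⁻ y, k y) ^ 2 * ∫⁻ x, ‖ψ x‖ₑ ^ 2) := by
        gcongr
        · exact lintegral_weight_sub_sq_le' hkm hGm
        · exact lintegral_weight_sub_sq_le hkmeas hψe
    _ ≤ _ := by
        gcongr
        exact K.lintegral_sq_le

/-- Here the split is through `φ x`. Both `φ(x-y) - φ(x)` and `φ(x) - u(x)` are small in `L²`, and
pairing with `ψ` in `L²` gives an `L¹` bound of size `s⁻¹` when `D` is of that size. -/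
theorem IsKernelAtScale.lintegral_normalPart_le (K : IsKernelAtScale c s κ)
    (hB : LipschitzWith Λ B) (hφ : Measurable φ) (hu : Measurable u) (hψ : Measurable ψ)
    {Q D A δ : ℝ≥0} (hQ : ∫⁻ x, ‖ψ x‖ₑ ^ 2 ≤ (Q : ℝ≥0∞) ^ 2)
    (hD : ∫⁻ x, ‖φ x - u x‖ₑ ^ 2 ≤ (D : ℝ≥0∞) ^ 2)
    (hA : ∀ y, ∫⁻ x, ‖φ (x - y) - φ x‖ₑ ^ 2 ≤ (A : ℝ≥0∞) ^ 2 * ‖y‖ₑ ^ 2)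
    (hδ : ∫⁻ x, ‖ψ x - B (φ x) (ψ x)‖ₑ ≤ δ) :
    ∫⁻ x, ‖normalPart κ B u ψ x‖ₑ
      ≤ c * δ + Λ * (c * (s⁻¹ : ℝ≥0) * A * Q + D * (c * Q)) := by
  have hkm := K.continuous.enorm.measurable
  have hψe : Measurable fun y => ‖ψ y‖ₑ := hψ.enorm
  have hfin : ∫⁻ x, ‖ψ x‖ₑ ^ 2 ≠ ⊤ := ne_top_of_le_ne_top (by finiteness) hQ
  have hG1 : Measurable fun z => ‖ψ z - B (φ z) (ψ z)‖ₑ :=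
    (hψ.sub (measurable_clm_comp hB.continuous hφ hψ)).enorm
  set T : Plane → Plane → ℝ≥0∞ := fun x y => ‖κ y‖ₑ * (‖φ (x - y) - φ x‖ₑ * ‖ψ (x - y)‖ₑ) with hT
  have hψ2 : Measurable fun p : Plane × Plane => ‖ψ (p.1 - p.2)‖ₑ :=
    hψe.comp (measurable_fst.sub measurable_snd)
  have hφ2 : Measurable fun p : Plane × Plane => ‖φ (p.1 - p.2) - φ p.1‖ₑ :=
    ((hφ.comp (measurable_fst.sub measurable_snd)).sub (hφ.comp measurable_fst)).enorm
  have hTm : Measurable (Function.uncurry T) :=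
    (hkm.comp measurable_snd).mul (hφ2.mul hψ2)
  have m1 : Measurable fun x => ∫⁻ y, ‖κ y‖ₑ * ‖ψ (x - y)‖ₑ :=
    Measurable.lintegral_prod_right' (f := fun p : Plane × Plane => ‖κ p.2‖ₑ * ‖ψ (p.1 - p.2)‖ₑ)
      ((hkm.comp measurable_snd).mul hψ2)
  have m2 : Measurable fun x => ∫⁻ y, ‖κ y‖ₑ * ‖ψ (x - y) - B (φ (x - y)) (ψ (x - y))‖ₑ :=
    Measurable.lintegral_prod_right' (f := fun p : Plane × Plane => ‖κ p.2‖ₑ *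
        ‖ψ (p.1 - p.2) - B (φ (p.1 - p.2)) (ψ (p.1 - p.2))‖ₑ)
      ((hkm.comp measurable_snd).mul (hG1.comp (measurable_fst.sub measurable_snd)))
  have m3 : Measurable fun x => ∫⁻ y, T x y := Measurable.lintegral_prod_right' hTm
  have hpt : ∀ x, ‖normalPart κ B u ψ x‖ₑ
      ≤ (∫⁻ y, ‖κ y‖ₑ * ‖ψ (x - y) - B (φ (x - y)) (ψ (x - y))‖ₑ)
        + (Λ * (∫⁻ y, T x y) + Λ * (‖φ x - u x‖ₑ * ∫⁻ y, ‖κ y‖ₑ * ‖ψ (x - y)‖ₑ)) := by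
    intro x
    refine (K.enorm_normalPart_le hψ hfin x).trans ?_
    have hsub : Measurable fun y : Plane => x - y := measurable_const.sub measurable_id
    have hGx : Measurable fun y => ‖κ y‖ₑ * ‖ψ (x - y) - B (φ (x - y)) (ψ (x - y))‖ₑ :=
      hkm.mul (hG1.comp hsub)
    have hTx : Measurable fun y => T x y := hTm.comp measurable_prodMk_left
    rw [← lintegral_const_mul' _ _ enorm_ne_top, ← lintegral_const_mul' _ _ ENNReal.coe_ne_top,
      ← lintegral_const_mul' _ _ ENNReal.coe_ne_top,
      ← lintegral_add_left (hTx.const_mul _), ← lintegral_add_left hGx]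
    refine lintegral_mono fun y => ?_
    have h1 := enorm_sub_clm_le hB (φ (x - y)) (u x) (ψ (x - y))
    have h2 : ‖φ (x - y) - u x‖ₑ ≤ ‖φ (x - y) - φ x‖ₑ + ‖φ x - u x‖ₑ := by
      have e : φ (x - y) - u x = (φ (x - y) - φ x) + (φ x - u x) := by abel
      rw [e]
      exact enorm_add_le _ _
    calc _ ≤ ‖κ y‖ₑ * (‖ψ (x - y) - B (φ (x - y)) (ψ (x - y))‖ₑ
          + Λ * (‖φ (x - y) - φ x‖ₑ + ‖φ x - u x‖ₑ) * ‖ψ (x - y)‖ₑ) := by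
          gcongr
          exact h1.trans (by gcongr)
      _ = _ := by
          simp only [hT]
          ring
  have i1 : ∫⁻ x, ∫⁻ y, ‖κ y‖ₑ * ‖ψ (x - y) - B (φ (x - y)) (ψ (x - y))‖ₑ ≤ c * δ := by
    rw [lintegral_lintegral_weight_sub hkm hG1]
    gcongr
    exact K.lintegral_le
  have i2 : ∫⁻ x, ∫⁻ y, T x y ≤ c * (s⁻¹ : ℝ≥0) * A * Q := by
    rw [lintegral_lintegral_swap hTm.aemeasurable]
    calc ∫⁻ y, ∫⁻ x, T x y ≤ ∫⁻ y, ‖κ y‖ₑ * (A * ‖y‖ₑ * Q) := by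
          refine lintegral_mono fun y => ?_
          simp only [hT]
          rw [lintegral_const_mul' _ _ enorm_ne_top]
          gcongr
          have hsub : Measurable fun x : Plane => x - y := measurable_id.sub measurable_const
          refine lintegral_mul_le_mul_of_sq_le ((hφ.comp hsub).sub hφ).enorm.aemeasurable
            (hψe.comp hsub).aemeasurable ?_ ?_
          · rw [mul_pow]; exact hA y
          · simp only [Function.comp_apply]
            rw [lintegral_sub_right_eq_self (fun x => ‖ψ x‖ₑ ^ 2)]; exact hQ
      _ = ∫⁻ y, (A * Q) * (‖κ y‖ₑ * ‖y‖ₑ) := by congr 1; ext y; ring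
      _ = (A * Q) * ∫⁻ y, ‖κ y‖ₑ * ‖y‖ₑ := lintegral_const_mul' _ _ (by finiteness)
      _ ≤ (A * Q) * (c * (s⁻¹ : ℝ≥0)) := by gcongr; exact K.moment_le
      _ = _ := by ring
  have i3 : ∫⁻ x, ‖φ x - u x‖ₑ * ∫⁻ y, ‖κ y‖ₑ * ‖ψ (x - y)‖ₑ ≤ D * (c * Q) := by
    refine lintegral_mul_le_mul_of_sq_le (hφ.sub hu).enorm.aemeasurable m1.aemeasurable hD ?_
    refine (lintegral_weight_sub_sq_le hkm hψe).trans ?_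
    rw [mul_pow]
    gcongr
    exact K.lintegral_le
  refine (lintegral_mono hpt).trans ?_
  rw [lintegral_add_left m2, lintegral_add_left (m3.const_mul _),
    lintegral_const_mul' _ _ ENNReal.coe_ne_top, lintegral_const_mul' _ _ ENNReal.coe_ne_top,
    mul_add]
  gcongr

/-- Product rule for increments of `(1 - B(u))(κ∗ψ)`: the increment falls either on `κ∗ψ`, hence on
the kernel, or on `u`, which is Lipschitz. No cancellation from tangency is needed. -/
theorem IsKernelAtScale.lintegral_sq_normalPart_add_sub_le (K : IsKernelAtScale c s κ)
    (hB : LipschitzWith Λ B) {b : ℝ≥0} (hb : ∀ a w, ‖w - B a w‖ₑ ≤ b * ‖w‖ₑ)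
    (hψ : Measurable ψ) {Q ℓ : ℝ≥0} (hQ : ∫⁻ x, ‖ψ x‖ₑ ^ 2 ≤ (Q : ℝ≥0∞) ^ 2)
    (hu : ∀ x h, ‖u (x + h) - u x‖ₑ ≤ ℓ * ‖h‖ₑ) (h : Plane) :
    ∫⁻ x, ‖normalPart κ B u ψ (x + h) - normalPart κ B u ψ x‖ₑ ^ 2
      ≤ 2 * ((b * (c * s)) ^ 2 + (Λ * ℓ * c) ^ 2) * (Q : ℝ≥0∞) ^ 2 * ‖h‖ₑ ^ 2 := by
  have hfin : ∫⁻ x, ‖ψ x‖ₑ ^ 2 ≠ ⊤ := ne_top_of_le_ne_top (by finiteness) hQ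
  set g := smoothing κ ψ with hg
  have hgm : Measurable g := measurable_smoothing K.continuous hψ
  have hpt : ∀ x, ‖normalPart κ B u ψ (x + h) - normalPart κ B u ψ x‖ₑ
      ≤ b * ‖g (x + h) - g x‖ₑ + (Λ * ℓ * ‖h‖ₑ) * ‖g x‖ₑ := by
    intro x
    have e : normalPart κ B u ψ (x + h) - normalPart κ B u ψ x
        = ((g (x + h) - g x) - B (u (x + h)) (g (x + h) - g x))
          - (B (u (x + h)) - B (u x)) (g x) := by
      simp only [normalPart, ← hg, map_sub, FunLike.coe_sub, Pi.sub_apply]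
      abel
    rw [e]
    refine (enorm_sub_le).trans ?_
    gcongr
    · exact hb _ _
    · refine (ContinuousLinearMap.le_opENorm _ _).trans ?_
      gcongr
      have h1 := hB (u (x + h)) (u x)
      rw [edist_eq_enorm_sub, edist_eq_enorm_sub] at h1
      refine h1.trans ?_
      rw [mul_assoc]
      gcongr
      exact hu x h
  have i1 := K.lintegral_sq_smoothing_add_sub_le hψ (K.integrable_of_sq hψ hfin) h
  have i2 := K.lintegral_sq_smoothing_le hψ
  calc _ ≤ ∫⁻ x, 2 * ((b * ‖g (x + h) - g x‖ₑ) ^ 2 + ((Λ * ℓ * ‖h‖ₑ) * ‖g x‖ₑ) ^ 2) :=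
        lintegral_mono fun x => (pow_le_pow_left' (hpt x) 2).trans (add_sq_le_two_mul _ _)
    _ ≤ 2 * ((b : ℝ≥0∞) ^ 2 * (∫⁻ x, ‖g (x + h) - g x‖ₑ ^ 2)
          + (Λ * ℓ * ‖h‖ₑ) ^ 2 * ∫⁻ x, ‖g x‖ₑ ^ 2) := by
        rw [lintegral_const_mul' _ _ (by finiteness)]
        simp only [mul_pow (b : ℝ≥0∞), fun x => mul_pow (Λ * ℓ * ‖h‖ₑ) ‖g x‖ₑ 2]
        rw [lintegral_add_right _ ((hgm.enorm.pow_const 2).const_mul _),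
          lintegral_const_mul' _ _ (by finiteness), lintegral_const_mul' _ _ (by finiteness)]
    _ ≤ 2 * ((b : ℝ≥0∞) ^ 2 * ((c * s * ‖h‖ₑ) ^ 2 * (Q : ℝ≥0∞) ^ 2)
          + (Λ * ℓ * ‖h‖ₑ) ^ 2 * (c ^ 2 * (Q : ℝ≥0∞) ^ 2)) := by
        gcongr
        · exact i1.trans (by gcongr)
        · exact i2.trans (by gcongr)
    _ = _ := by ring

end NormalComponent

/-! ### Difference quotients and the weak gradient -/

section WeakGradient

open scoped NNReal

set_option linter.unusedSectionVars false

variable {F : Type*} [NormedAddCommGroup F] [NormedSpace ℝ F] [CompleteSpace F]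

/-- The derivative falls on `ρ`, and the definition of the weak gradient is tested with the
reflected translate `t ↦ ρ (x - t)`. -/
theorem IsWeakGrad.fderiv_smoothing {f : Plane → F} {D : Fin 2 → Plane → F} (h : IsWeakGrad f D)
    {ρ : Plane → ℝ} (hρ : ContDiff ℝ ∞ ρ) (hc : HasCompactSupport ρ) (x v : Plane) :
    fderiv ℝ (smoothing ρ f) x v = ∑ j, v j • smoothing ρ (D j) x := by
  have h1 := (hc.hasFDerivAt_convolution_left (ContinuousLinearMap.lsmul ℝ ℝ)
    (hρ.of_le (by norm_cast)) h.locallyIntegrable x).fderiv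
  have h2 : fderiv ℝ (smoothing ρ f) x v = ∫ t, fderiv ℝ ρ t v • f (x - t) := by
    unfold smoothing
    rw [h1, convolution_def, ContinuousLinearMap.integral_apply]
    · simp
    · exact (hc.fderiv ℝ).convolutionExists_left _ (hρ.continuous_fderiv (by simp))
        h.locallyIntegrable x
  have h3 : ∀ j, smoothing ρ (D j) x
      = ∫ t, fderiv ℝ ρ t (EuclideanSpace.single j 1) • f (x - t) := by
    intro j
    have hψ : ContDiff ℝ ∞ fun t => ρ (x - t) := hρ.comp (contDiff_const.sub contDiff_id)
    have hψc : HasCompactSupport fun t => ρ (x - t) :=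
      hc.comp_homeomorph (Homeomorph.subLeft x)
    have h4 := h.integral_eq (fun t => ρ (x - t)) hψ hψc j
    have h5 : ∀ t, fderiv ℝ (fun t => ρ (x - t)) t = - fderiv ℝ ρ (x - t) := fun t => by
      have := ((hρ.differentiable (by simp) (x - t)).hasFDerivAt).comp t
        ((hasFDerivAt_id (𝕜 := ℝ) t).const_sub x)
      rw [show (fun t => ρ (x - t)) = ρ ∘ (fun t => x - t) from rfl]
      have h6 := this.fderiv
      rw [h6]
      ext w
      simp
    simp only [h5, FunLike.coe_neg, Pi.neg_apply, neg_smul, integral_neg, neg_inj] at h4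
    rw [smoothing_apply, ← integral_sub_left_eq_self _ volume x,
      ← integral_sub_left_eq_self (fun t => fderiv ℝ ρ t _ • f (x - t)) volume x]
    simp only [sub_sub_cancel]
    exact h4.symm
  rw [h2]
  simp only [h3]
  have hi : ∀ w : Plane, Integrable fun t => fderiv ℝ ρ t w • f (x - t) := fun w => by
    have hcw : HasCompactSupport fun t => fderiv ℝ ρ t w := (hc.fderiv ℝ).comp_left
      (g := fun L : Plane →L[ℝ] ℝ => L w) rfl
    exact hcw.convolutionExists_left (ContinuousLinearMap.lsmul ℝ ℝ)
      ((hρ.continuous_fderiv (by simp)).clm_apply continuous_const) h.locallyIntegrable x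
  simp only [← integral_smul]
  have hi2 : ∀ j, Integrable fun t =>
      v j • fderiv ℝ ρ t (EuclideanSpace.single j 1) • f (x - t) := fun j => (hi _).smul (v j)
  rw [← integral_finsetSum _ fun j _ => hi2 j]
  congr 1
  ext t
  have hv : v = ∑ j, v j • EuclideanSpace.single j (1 : ℝ) := by
    ext i
    fin_cases i <;> simp
  conv_lhs => rw [hv]
  simp only [map_sum, map_smul, Finset.sum_smul, smul_eq_mul, mul_smul]

theorem enorm_sum_smul_sq_le (v : Plane) (w : Fin 2 → F) :
    ‖∑ j, v j • w j‖ₑ ^ 2 ≤ ‖v‖ₑ ^ 2 * ∑ j, ‖w j‖ₑ ^ 2 := by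
  have h : ‖∑ j, v j • w j‖ ^ 2 ≤ ‖v‖ ^ 2 * ∑ j, ‖w j‖ ^ 2 := by
    have h1 : ‖∑ j, v j • w j‖ ≤ ∑ j, ‖v j‖ * ‖w j‖ :=
      (norm_sum_le _ _).trans (le_of_eq (by simp only [norm_smul]))
    rw [EuclideanSpace.norm_sq_eq]
    exact (pow_le_pow_left₀ (norm_nonneg _) h1 2).trans (Finset.sum_mul_sq_le_sq_mul_sq _ _ _)
  simp only [enorm_eq_nnnorm]
  exact_mod_cast h

theorem lintegral_sq_smoothing_le_of_aestronglyMeasurable {ρ : Plane → ℝ} (hρ : Continuous ρ)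
    {f : Plane → F} (hf : AEStronglyMeasurable f volume) :
    ∫⁻ x, ‖smoothing ρ f x‖ₑ ^ 2 ≤ (∫⁻ y, ‖ρ y‖ₑ) ^ 2 * ∫⁻ x, ‖f x‖ₑ ^ 2 := by
  have e : ∫⁻ x, ‖f x‖ₑ ^ 2 = ∫⁻ x, ‖hf.mk f x‖ₑ ^ 2 :=
    lintegral_congr_ae (hf.ae_eq_mk.mono fun x hx => by simp only [hx])
  rw [smoothing_congr_ae ρ hf.ae_eq_mk, e]
  refine (lintegral_mono fun x => pow_le_pow_left' (enorm_smoothing_le ρ _ x) 2).trans ?_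
  exact lintegral_weight_sub_sq_le hρ.enorm.measurable hf.stronglyMeasurable_mk.enorm

/-- The difference quotients of a function are bounded in `L²` by its weak gradient. -/
theorem IsWeakGrad.lintegral_sq_add_sub_le {f : Plane → F} {D : Fin 2 → Plane → F}
    (h : IsWeakGrad f D) (y : Plane) :
    ∫⁻ x, ‖f (x + y) - f x‖ₑ ^ 2 ≤ (∫⁻ x, ∑ j, ‖D j x‖ₑ ^ 2) * ‖y‖ₑ ^ 2 := by
  -- The mollifiers shrink with a fixed ratio `2` of outer to inner radius, as almost everywhere
  -- convergence requires for a function that is only locally integrable.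
  set b : ℕ → ContDiffBump (0 : Plane) := fun n =>
    ⟨1 / ((n : ℝ) + 1), 2 / ((n : ℝ) + 1), by positivity, by gcongr; norm_num⟩ with hb
  set ρ : ℕ → Plane → ℝ := fun n => (b n).normed volume with hρdef
  have hρ : ∀ n, ContDiff ℝ ∞ (ρ n) := fun n => (b n).contDiff_normed
  have hc : ∀ n, HasCompactSupport (ρ n) := fun n => (b n).hasCompactSupport_normed
  have hρ1 : ∀ n, ∫⁻ y, ‖ρ n y‖ₑ = 1 := fun n => by
    have h1 := (b n).integral_normed (μ := (volume : Measure Plane))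
    have h2 : ∀ y, ‖ρ n y‖ₑ = ENNReal.ofReal (ρ n y) := fun y =>
      Real.enorm_of_nonneg ((b n).nonneg_normed y)
    simp only [h2]
    rw [← ofReal_integral_eq_lintegral_ofReal ((b n).integrable_normed)
      (ae_of_all _ fun y => (b n).nonneg_normed y), h1, ENNReal.ofReal_one]
  have hlim : ∀ᵐ x, Tendsto (fun n => smoothing (ρ n) f x) atTop (nhds (f x)) := by
    refine ContDiffBump.ae_convolution_tendsto_right_of_locallyIntegrable (K := 2) ?_ ?_
      h.locallyIntegrable
    · simp only [hb]
      exact tendsto_const_div_atTop_nhds_zero_nat 2 |>.comp (tendsto_add_atTop_nat 1) |>.congr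
        fun n => by simp
    · refine Eventually.of_forall fun n => ?_
      simp only [hb]
      exact le_of_eq (by ring)
  have hlim' : ∀ᵐ x, Tendsto (fun n => smoothing (ρ n) f (x + y)) atTop (nhds (f (x + y))) :=
    (measurePreserving_add_right volume y).quasiMeasurePreserving.ae hlim
  have hbound : ∀ n, ∫⁻ x, ‖smoothing (ρ n) f (x + y) - smoothing (ρ n) f x‖ₑ ^ 2
      ≤ (∫⁻ x, ∑ j, ‖D j x‖ₑ ^ 2) * ‖y‖ₑ ^ 2 := by
    intro n
    have hsm : ContDiff ℝ 1 (smoothing (ρ n) f) :=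
      (hc n).contDiff_convolution_left _ ((hρ n).of_le (by norm_cast)) h.locallyIntegrable
    have hm : ∀ j, Measurable fun x => ‖smoothing (ρ n) (D j) x‖ₑ ^ 2 := fun j =>
      (((hc n).continuous_convolution_left _ (hρ n).continuous
        (h.locallyIntegrable_grad j)).enorm.measurable.pow_const 2)
    have hDm : ∀ j, AEMeasurable (fun x => ‖D j x‖ₑ ^ 2) volume := fun j =>
      (h.locallyIntegrable_grad j).aestronglyMeasurable.enorm.pow_const 2
    refine (lintegral_sq_enorm_add_sub_le hsm y).trans ?_
    calc ∫⁻ z, ‖fderiv ℝ (smoothing (ρ n) f) z y‖ₑ ^ 2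
        ≤ ∫⁻ z, ‖y‖ₑ ^ 2 * ∑ j, ‖smoothing (ρ n) (D j) z‖ₑ ^ 2 := by
          refine lintegral_mono fun z => ?_
          rw [h.fderiv_smoothing (hρ n) (hc n)]
          exact enorm_sum_smul_sq_le _ _
      _ = ‖y‖ₑ ^ 2 * ∑ j, ∫⁻ z, ‖smoothing (ρ n) (D j) z‖ₑ ^ 2 := by
          rw [lintegral_const_mul' _ _ (by finiteness), lintegral_finsetSum _ fun j _ => hm j]
      _ ≤ ‖y‖ₑ ^ 2 * ∑ j, ∫⁻ z, ‖D j z‖ₑ ^ 2 := by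
          refine mul_le_mul_right (Finset.sum_le_sum fun j _ => ?_) _
          have := lintegral_sq_smoothing_le_of_aestronglyMeasurable (hρ n).continuous
            (h.locallyIntegrable_grad j).aestronglyMeasurable
          rwa [hρ1, one_pow, one_mul] at this
      _ = _ := by
          rw [mul_comm, lintegral_finsetSum' _ fun j _ => hDm j]
  -- Fatou's lemma transfers the bound from the mollified functions to `f`.
  calc ∫⁻ x, ‖f (x + y) - f x‖ₑ ^ 2
      = ∫⁻ x, liminf (fun n => ‖smoothing (ρ n) f (x + y) - smoothing (ρ n) f x‖ₑ ^ 2) atTop := by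
        refine lintegral_congr_ae ?_
        filter_upwards [hlim, hlim'] with x h1 h2
        have : Tendsto (fun n => ‖smoothing (ρ n) f (x + y) - smoothing (ρ n) f x‖ₑ ^ 2) atTop
            (nhds (‖f (x + y) - f x‖ₑ ^ 2)) :=
          ((ENNReal.continuous_pow 2).tendsto _).comp (h2.sub h1).enorm
        exact this.liminf_eq.symm
    _ ≤ liminf (fun n => ∫⁻ x, ‖smoothing (ρ n) f (x + y) - smoothing (ρ n) f x‖ₑ ^ 2) atTop := by
        refine lintegral_liminf_le fun n => ?_
        have hcont : Continuous (smoothing (ρ n) f) :=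
          (hc n).continuous_convolution_left _ (hρ n).continuous h.locallyIntegrable
        exact ((hcont.comp (continuous_add_const y)).sub hcont).enorm.measurable.pow_const 2
    _ ≤ _ := by
        refine liminf_le_of_frequently_le' (Frequently.of_forall fun n => ?_)
        exact hbound n

end WeakGradient

/-! ### Littlewood-Paley blocks and consequences of small dispersion -/

section LittlewoodPaleyBounds

open scoped NNReal

set_option linter.unusedSectionVars false

variable {F : Type*} [NormedAddCommGroup F] [NormedSpace ℝ F] [MeasurableSpace F] [BorelSpace F]
  [SecondCountableTopology F] [CompleteSpace F] {χ : Plane → ℝ} {c : ℝ≥0}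

theorem lintegral_sq_sub_le {f g : Plane → F} (hg : Measurable g) :
    ∫⁻ x, ‖f x - g x‖ₑ ^ 2 ≤ 2 * ((∫⁻ x, ‖f x‖ₑ ^ 2) + ∫⁻ x, ‖g x‖ₑ ^ 2) := by
  rw [← lintegral_add_right _ (hg.enorm.pow_const 2), ← lintegral_const_mul' _ _ (by finiteness)]
  exact lintegral_mono fun x => (pow_le_pow_left' enorm_sub_le 2).trans (add_sq_le_two_mul _ _)

theorem lintegral_sq_lpBlock_le (hK : ∀ k : ℤ, IsKernelAtScale c (2 ^ k) (lowKernel χ k))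
    {z : Plane → F} (hz : Measurable z) (k : ℤ) :
    ∫⁻ x, ‖lpBlock χ k z x‖ₑ ^ 2 ≤ 4 * c ^ 2 * ∫⁻ x, ‖z x‖ₑ ^ 2 := by
  refine (lintegral_sq_sub_le (measurable_smoothing (hK k).continuous hz)).trans ?_
  calc _ ≤ 2 * (c ^ 2 * (∫⁻ x, ‖z x‖ₑ ^ 2) + c ^ 2 * ∫⁻ x, ‖z x‖ₑ ^ 2) := by
        gcongr
        · exact (hK (k + 1)).lintegral_sq_smoothing_le hz
        · exact (hK k).lintegral_sq_smoothing_le hz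
    _ = _ := by ring

theorem lintegral_sq_lpBlock_le_of_lintegral
    (hK : ∀ k : ℤ, IsKernelAtScale c (2 ^ k) (lowKernel χ k))
    {z : Plane → F} (hz : Measurable z) (k : ℤ) :
    ∫⁻ x, ‖lpBlock χ k z x‖ₑ ^ 2
      ≤ 10 * c * ((2 : ℝ≥0) ^ k : ℝ≥0) ^ 2 * (∫⁻ x, ‖z x‖ₑ) ^ 2 := by
  refine (lintegral_sq_sub_le (measurable_smoothing (hK k).continuous hz)).trans ?_
  calc _ ≤ 2 * (c * (((2 : ℝ≥0) ^ (k + 1) : ℝ≥0)) ^ 2 * (∫⁻ x, ‖z x‖ₑ) ^ 2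
        + c * ((2 : ℝ≥0) ^ k : ℝ≥0) ^ 2 * (∫⁻ x, ‖z x‖ₑ) ^ 2) := by
        gcongr
        · exact (hK (k + 1)).lintegral_sq_smoothing_le' hz
        · exact (hK k).lintegral_sq_smoothing_le' hz
    _ = _ := by
        rw [zpow_add₀ two_ne_zero, zpow_one, ENNReal.coe_mul, ENNReal.coe_ofNat]
        ring

/-- The block has a kernel of mean zero: `z` may be subtracted from both truncations, and each
difference gains the inverse frequency. -/
theorem lintegral_sq_lpBlock_le_of_add_sub
    (hK : ∀ k : ℤ, IsKernelAtScale c (2 ^ k) (lowKernel χ k))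
    {z : Plane → F} (hz : Measurable z) (h2 : ∫⁻ x, ‖z x‖ₑ ^ 2 ≠ ⊤) {G : ℝ≥0∞}
    (hG : ∀ y, ∫⁻ x, ‖z (x + y) - z x‖ₑ ^ 2 ≤ G * ‖y‖ₑ ^ 2) (k : ℤ) :
    ∫⁻ x, ‖lpBlock χ k z x‖ₑ ^ 2 ≤ 4 * c ^ 2 * (((2 : ℝ≥0) ^ k)⁻¹ : ℝ≥0) ^ 2 * G := by
  have hG' : ∀ y, ∫⁻ x, ‖z (x - y) - z x‖ₑ ^ 2 ≤ G * ‖y‖ₑ ^ 2 := fun y => by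
    simpa only [sub_eq_add_neg, enorm_neg] using hG (-y)
  have e : ∀ x, lpBlock χ k z x = (smoothing (lowKernel χ (k + 1)) z x - z x)
      - (smoothing (lowKernel χ k) z x - z x) := fun x => by
    simp only [lpBlock, lpLow_eq_smoothing]; abel
  simp only [e]
  refine (lintegral_sq_sub_le ((measurable_smoothing (hK k).continuous hz).sub hz)).trans ?_
  have h1 := (hK (k + 1)).lintegral_sq_smoothing_sub_le hz ((hK (k + 1)).integrable_of_sq hz h2) hG'
  have h0 := (hK k).lintegral_sq_smoothing_sub_le hz ((hK k).integrable_of_sq hz h2) hG'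
  have hle : (((2 : ℝ≥0) ^ (k + 1))⁻¹ : ℝ≥0) ≤ ((2 : ℝ≥0) ^ k)⁻¹ := by
    gcongr
    · exact one_le_two
    · exact Int.le_add_one le_rfl
  calc _ ≤ 2 * (c ^ 2 * (((2 : ℝ≥0) ^ k)⁻¹ : ℝ≥0) ^ 2 * G
        + c ^ 2 * (((2 : ℝ≥0) ^ k)⁻¹ : ℝ≥0) ^ 2 * G) := by
        gcongr
        · exact h1.trans (by gcongr)
        · exact h0
    _ = _ := by ring

theorem enorm_lpLow_add_sub_le {ε : ℝ≥0} {φ : Plane → F}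
    (hε : ∀ k x, ‖lpBlock χ k φ x‖ₑ ≤ ε) (l : ℤ) (J : ℕ) (x : Plane) :
    ‖lpLow χ (l + J) φ x - lpLow χ l φ x‖ₑ ≤ J * ε := by
  induction J with
  | zero => simp
  | succ J ih =>
    have e : lpLow χ (l + (J + 1 : ℕ)) φ x - lpLow χ l φ x
        = lpBlock χ (l + J) φ x + (lpLow χ (l + J) φ x - lpLow χ l φ x) := by
      simp only [lpBlock, Nat.cast_add, Nat.cast_one, add_assoc]; abel
    rw [e]
    refine (enorm_add_le _ _).trans ?_
    calc _ ≤ (ε : ℝ≥0∞) + J * ε := by gcongr; exact hε _ _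
      _ = _ := by push_cast; ring

/-- Small energy dispersion forces nearby frequency truncations to be almost constant. -/
theorem enorm_lpLow_sub_le (hK : ∀ k : ℤ, IsKernelAtScale c (2 ^ k) (lowKernel χ k))
    {ε R : ℝ≥0} {φ : Plane → F} (hφ : Measurable φ) (hR : ∀ x, ‖φ x‖ ≤ R)
    (hε : ∀ k x, ‖lpBlock χ k φ x‖ₑ ≤ ε) (l : ℤ) (J : ℕ) (x y : Plane) :
    ‖lpLow χ (l + J) φ (x - y) - lpLow χ l φ x‖ₑ
      ≤ (3 * J * ε : ℝ≥0) + (c * 2 ^ (l - J) * R : ℝ≥0) * ‖y‖ₑ := by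
  -- Both truncations are compared with the one at frequency `l - J`, which is Lipschitz with
  -- constant `c 2^(l-J) R`. The descent crosses `2J` blocks from `l + J` and `J` blocks from `l`,
  -- hence `3J`.
  have h1 := enorm_lpLow_add_sub_le hε (l - J) (J + J) (x - y)
  have h2 := enorm_lpLow_add_sub_le hε (l - J) J x
  have h3 := (hK (l - J)).enorm_smoothing_add_sub_le hφ hR x (-y)
  rw [show l - J + ((J + J : ℕ) : ℤ) = l + J by push_cast; ring] at h1
  rw [sub_add_cancel] at h2
  rw [← sub_eq_add_neg, enorm_neg, ← lpLow_eq_smoothing] at h3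
  have e : lpLow χ (l + J) φ (x - y) - lpLow χ l φ x
      = (lpLow χ (l + J) φ (x - y) - lpLow χ (l - J) φ (x - y))
        + (lpLow χ (l - J) φ (x - y) - lpLow χ (l - J) φ x)
        - (lpLow χ l φ x - lpLow χ (l - J) φ x) := by abel
  rw [e]
  refine enorm_sub_le.trans ((add_le_add_left (enorm_add_le _ _) _).trans ?_)
  calc _ ≤ (((J + J : ℕ) : ℝ≥0∞) * ε + c * ((2 : ℝ≥0) ^ (l - J : ℤ) : ℝ≥0) * R * ‖y‖ₑ) + J * ε := by
        gcongr
    _ = _ := by push_cast; ring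

theorem IsKernelAtScale.continuous_smoothing {κ : Plane → ℝ} {s : ℝ≥0}
    (K : IsKernelAtScale c s κ) {R : ℝ≥0} {φ : Plane → F} (hφ : Measurable φ)
    (hR : ∀ x, ‖φ x‖ ≤ R) : Continuous (smoothing κ φ) :=
  continuous_iff_continuousAt.mpr fun x => (K.differentiableAt_smoothing hφ hR x).continuousAt

/-- The dispersion is an essential supremum; the blocks are continuous, so the bound holds at every
point. -/
theorem enorm_lpBlock_le_of_energyDispersion
    (hK : ∀ k : ℤ, IsKernelAtScale c (2 ^ k) (lowKernel χ k))
    {ε R : ℝ≥0} {φ : Plane → F} (hφ : Measurable φ) (hR : ∀ x, ‖φ x‖ ≤ R)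
    (hε : energyDispersion χ φ ≤ ε) (k : ℤ) (x : Plane) : ‖lpBlock χ k φ x‖ₑ ≤ ε := by
  have h1 : eLpNorm (lpBlock χ k φ) ⊤ volume ≤ ε := (le_iSup _ k).trans hε
  rw [eLpNorm_exponent_top] at h1
  have hc : Continuous (lpBlock χ k φ) :=
    ((hK (k + 1)).continuous_smoothing hφ hR).sub ((hK k).continuous_smoothing hφ hR)
  have h2 : ∀ᵐ x, ‖lpBlock χ k φ x‖ₑ ≤ ε :=
    (enorm_ae_le_eLpNormEssSup _ _).mono fun x hx => hx.trans h1
  have h3 : IsClosed {x | ‖lpBlock χ k φ x‖ₑ ≤ ε} := isClosed_le hc.enorm continuous_const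
  have h4 : Dense {x | ‖lpBlock χ k φ x‖ₑ ≤ ε} := Measure.dense_of_ae h2
  have h5 : x ∈ closure {x | ‖lpBlock χ k φ x‖ₑ ≤ ε} := h4 x
  rwa [h3.closure_eq] at h5

/-- The frequency truncations of a function of small energy dispersion with values in `M` stay
close to `M`. -/
theorem infDist_lpLow_le (hK : ∀ k : ℤ, IsKernelAtScale c (2 ^ k) (lowKernel χ k))
    {ε R A : ℝ≥0} {φ : Plane → F} (hφ : Measurable φ) (hR : ∀ x, ‖φ x‖ ≤ R)
    (hε : ∀ k x, ‖lpBlock χ k φ x‖ₑ ≤ ε) {M : Set F} (hM : ∀ x, φ x ∈ M)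
    (hA : ∀ y, ∫⁻ x, ‖φ (x - y) - φ x‖ₑ ^ 2 ≤ (A : ℝ≥0∞) ^ 2 * ‖y‖ₑ ^ 2) (l : ℤ) (J : ℕ)
    (x : Plane) :
    Metric.infDist (lpLow χ l φ x) M ≤ 3 * J * ε + c * (R + A) * (2 ^ J)⁻¹ := by
  set v := lpLow χ (l + J) φ with hv
  set d := Metric.infDist (lpLow χ l φ x) M with hd
  set m : ℝ≥0 := 3 * J * ε + c * R * (2 ^ J)⁻¹ with hm
  have hpow : (2 : ℝ≥0) ^ (l - J : ℤ) = 2 ^ l * (2 ^ J)⁻¹ := by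
    rw [zpow_sub₀ two_ne_zero, zpow_natCast, div_eq_mul_inv]
  have hpow' : ((2 : ℝ≥0) ^ (l + J : ℤ))⁻¹ = (2 ^ l)⁻¹ * (2 ^ J)⁻¹ := by
    rw [zpow_add₀ two_ne_zero, zpow_natCast, mul_inv]
  have h2l : (2 : ℝ≥0) ^ l ≠ 0 := zpow_ne_zero _ two_ne_zero
  have hsq := (hK (l + J)).lintegral_sq_smoothing_sub_le hφ
    ((hK (l + J)).integrable_of_bound hφ hR) hA
  rw [← lpLow_eq_smoothing, ← hv, hpow'] at hsq
  -- Otherwise `v` and `φ` differ by at least some `r > c A 2^(-J)` on the whole disc of radius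
  -- `2^(-l)` about `x`, because `v` is within `m` of `lpLow χ l φ x` there and `φ` takes values in
  -- `M`. The disc has area `π 2^(-2l)` with `π ≥ 1`, which contradicts the `L²` bound for `v - φ`.
  by_contra! hcon
  obtain ⟨r, hr, hdr⟩ : ∃ r : ℝ≥0, c * A * (2 ^ J)⁻¹ < r ∧ d = r + m := by
    have hdm : (m : ℝ) + c * A * (2 ^ J)⁻¹ < d := by
      rw [hm]; push_cast; linarith
    have h0 : (0 : ℝ) ≤ c * A * (2 ^ J)⁻¹ := by positivity
    have h1 : ((d - m).toNNReal : ℝ) = d - m := Real.coe_toNNReal _ (by linarith)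
    refine ⟨(d - m).toNNReal, ?_, by rw [h1]; ring⟩
    rw [← NNReal.coe_lt_coe, h1]
    push_cast
    linarith
  have hlow : ∀ y ∈ Metric.ball (0 : Plane) (((2 : ℝ≥0) ^ l)⁻¹ : ℝ≥0),
      (r : ℝ≥0∞) ≤ ‖v (x - y) - φ (x - y)‖ₑ := by
    intro y hy
    have h1 := enorm_lpLow_sub_le hK hφ hR hε l J x y
    have hy' : ‖y‖ₑ ≤ ((((2 : ℝ≥0) ^ l)⁻¹ : ℝ≥0) : ℝ≥0∞) := by
      rw [enorm_le_coe]
      exact (mem_ball_zero_iff.mp hy).le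
    have h2 : ‖v (x - y) - lpLow χ l φ x‖ₑ ≤ m := by
      refine h1.trans ?_
      calc _ ≤ ((3 * J * ε : ℝ≥0) : ℝ≥0∞)
            + (c * 2 ^ (l - J : ℤ) * R : ℝ≥0) * ((((2 : ℝ≥0) ^ l)⁻¹ : ℝ≥0) : ℝ≥0∞) := by gcongr
        _ = m := by
          rw [← ENNReal.coe_mul, ← ENNReal.coe_add, hm, hpow]
          congr 2
          field_simp
    have h3 : ‖v (x - y) - lpLow χ l φ x‖ ≤ m := by
      rw [enorm_le_coe] at h2; exact h2
    have h4 : d ≤ dist (lpLow χ l φ x) (φ (x - y)) := Metric.infDist_le_dist_of_mem (hM _)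
    have h5 : dist (lpLow χ l φ x) (φ (x - y))
        ≤ ‖v (x - y) - lpLow χ l φ x‖ + ‖v (x - y) - φ (x - y)‖ := by
      rw [dist_eq_norm, ← norm_neg (v (x - y) - lpLow χ l φ x)]
      refine le_trans (le_of_eq ?_) (norm_add_le _ _)
      congr 1; abel
    have h6 : (r : ℝ) ≤ ‖v (x - y) - φ (x - y)‖ := by linarith
    rw [enorm_eq_nnnorm, ENNReal.coe_le_coe]
    exact h6
  have hkey : (r : ℝ≥0∞) ^ 2 * volume (Metric.ball (0 : Plane) (((2 : ℝ≥0) ^ l)⁻¹ : ℝ≥0))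
      ≤ c ^ 2 * (((2 ^ l)⁻¹ * (2 ^ J)⁻¹ : ℝ≥0) : ℝ≥0∞) ^ 2 * (A : ℝ≥0∞) ^ 2 := by
    refine le_trans ?_ hsq
    rw [← lintegral_sub_left_eq_self _ x, ← setLIntegral_const]
    refine (setLIntegral_mono' measurableSet_ball fun y hy => ?_).trans
      (setLIntegral_le_lintegral _ _)
    exact pow_le_pow_left' (hlow y hy) 2
  rw [EuclideanSpace.volume_ball_fin_two, ENNReal.ofReal_coe_nnreal, ← NNReal.coe_real_pi,
    ENNReal.ofReal_coe_nnreal] at hkey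
  have hkey' : r ^ 2 * (((2 ^ l)⁻¹) ^ 2 * NNReal.pi)
      ≤ c ^ 2 * ((2 ^ l)⁻¹ * (2 ^ J)⁻¹) ^ 2 * A ^ 2 := by exact_mod_cast hkey
  have h7 : (r : ℝ) ^ 2 ≤ (c * A * (2 ^ J)⁻¹) ^ 2 := by
    have h8 : (r : ℝ) ^ 2 * ((((2 : ℝ) ^ l)⁻¹) ^ 2 * Real.pi)
      ≤ c ^ 2 * (((2 : ℝ) ^ l)⁻¹ * (2 ^ J)⁻¹) ^ 2 * A ^ 2 := by exact_mod_cast hkey'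
    have h9 : (0 : ℝ) < (((2 : ℝ) ^ l)⁻¹) ^ 2 := by positivity
    have h10 : (r : ℝ) ^ 2 * Real.pi ≤ (c * A * (2 ^ J)⁻¹) ^ 2 := by
      refine le_of_mul_le_mul_left ?_ h9
      calc _ = (r : ℝ) ^ 2 * ((((2 : ℝ) ^ l)⁻¹) ^ 2 * Real.pi) := by ring
        _ ≤ _ := h8
        _ = _ := by ring
    nlinarith [Real.pi_gt_three, sq_nonneg (r : ℝ)]
  have h11 : (r : ℝ) ≤ c * A * (2 ^ J)⁻¹ :=
    (pow_le_pow_iff_left₀ r.2 (by positivity) two_ne_zero).mp h7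
  have hr' : (c * A * (2 ^ J)⁻¹ : ℝ) < r := by exact_mod_cast hr
  linarith

end LittlewoodPaleyBounds

/-! ### Existence of a tubular neighbourhood -/

section Tubular

open scoped Topology

variable {N : ℕ}

theorem nearestPoint_eq_of_existsUnique {M : Set (Ambient N)} {p q : Ambient N}
    (h : ∃! q, IsNearest M p q) (hq : IsNearest M p q) : nearestPoint M p = q :=
  h.unique (Classical.epsilon_spec h.exists) hq

/-- The real inner product as a bounded bilinear map. -/
noncomputable def innerBilin (E : Type*) [NormedAddCommGroup E] [InnerProductSpace ℝ E] :
    E →L[ℝ] E →L[ℝ] ℝ :=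
  (isBoundedBilinearMap_inner (𝕜 := ℝ) (E := E)).toContinuousLinearMap

theorem innerBilin_apply {E : Type*} [NormedAddCommGroup E] [InnerProductSpace ℝ E] (x y : E) :
    innerBilin E x y = inner ℝ x y := rfl

/-- An injective differential between finite dimensional spaces of the same dimension yields a
local diffeomorphism which is smooth in both directions. -/
theorem exists_openPartialHomeomorph_contDiffAt_symm {X Y : Type*} [NormedAddCommGroup X]
    [NormedSpace ℝ X] [FiniteDimensional ℝ X] [NormedAddCommGroup Y] [NormedSpace ℝ Y]
    [FiniteDimensional ℝ Y] (hXY : Module.finrank ℝ X = Module.finrank ℝ Y) {H : X → Y}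
    {Ω : Set X} (hΩ : IsOpen Ω) (hH : ContDiffOn ℝ ∞ H Ω) {a : X} (ha : a ∈ Ω)
    (hinj : ∀ v, fderiv ℝ H a v = 0 → v = 0) :
    ∃ h : OpenPartialHomeomorph X Y, a ∈ h.source ∧ h.source ⊆ Ω ∧ (∀ x, h x = H x) ∧
      ∀ y ∈ h.target, ContDiffAt ℝ ∞ h.symm y := by
  have : CompleteSpace X := FiniteDimensional.complete ℝ X
  have hHa : ContDiffAt ℝ ∞ H a := hH.contDiffAt (hΩ.mem_nhds ha)
  have hinj' : Function.Injective (fderiv ℝ H a : X →ₗ[ℝ] Y) :=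
    (injective_iff_map_eq_zero _).mpr hinj
  set L : X ≃L[ℝ] Y :=
    (LinearEquiv.ofInjectiveOfFinrankEq (fderiv ℝ H a : X →ₗ[ℝ] Y) hinj' hXY).toContinuousLinearEquiv
    with hL
  have hLc : (L : X →L[ℝ] Y) = fderiv ℝ H a := by
    ext v; rfl
  have hda : HasFDerivAt H (L : X →L[ℝ] Y) a := by
    rw [hLc]; exact (hHa.differentiableAt (by simp)).hasFDerivAt
  set h0 := hHa.toOpenPartialHomeomorph H hda (by simp) with hh0
  -- Restricting to the points where the differential is invertible makes the inverse smooth on the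
  -- whole target, not only at the image of `a`.
  set S : Set X := Ω ∩ fderiv ℝ H ⁻¹' Set.range ((↑) : (X ≃L[ℝ] Y) → X →L[ℝ] Y) with hS
  have hSo : IsOpen S :=
    (hH.continuousOn_fderiv_of_isOpen hΩ (by norm_cast)).isOpen_inter_preimage hΩ
      ContinuousLinearEquiv.isOpen
  refine ⟨h0.restrOpen S hSo, ?_, ?_, fun x => rfl, fun y hy => ?_⟩
  · exact ⟨hHa.mem_toOpenPartialHomeomorph_source hda (by simp), ha, L, hLc⟩
  · exact fun x hx => hx.2.1
  · have hs : (h0.restrOpen S hSo).symm y ∈ S :=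
      ((h0.restrOpen S hSo).map_target hy).2
    obtain ⟨hs1, L', hL'⟩ := hs
    have hc : ContDiffAt ℝ ∞ H ((h0.restrOpen S hSo).symm y) := hH.contDiffAt (hΩ.mem_nhds hs1)
    refine OpenPartialHomeomorph.contDiffAt_symm _ (f₀' := L') hy ?_ hc
    rw [hL']
    exact (hc.differentiableAt (by simp)).hasFDerivAt

theorem IsLocalMin.innerBilin_comp_eq_zero {E W : Type*} [NormedAddCommGroup E]
    [InnerProductSpace ℝ E] [NormedAddCommGroup W] [NormedSpace ℝ W] {F : W → E} {F' : W →L[ℝ] E}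
    {s : W} {q : E} (h : IsLocalMin (fun w => ‖F w - q‖ ^ 2) s) (hF : HasFDerivAt F F' s) :
    (innerBilin E (F s - q)).comp F' = 0 := by
  have hder : HasFDerivAt (fun w => ‖F w - q‖ ^ 2) _ s := (hF.sub_const q).norm_sq
  have hzero := h.hasFDerivAt_eq_zero hder
  ext w
  have := congrArg (fun T : W →L[ℝ] ℝ => T w) hzero
  simpa [innerBilin_apply] using this

/-- The critical points of the squared distance from `q` along an immersion `F` depend smoothly
on `q`. -/
theorem exists_openPartialHomeomorph_critical {E W : Type*} [NormedAddCommGroup E]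
    [InnerProductSpace ℝ E] [FiniteDimensional ℝ E] [NormedAddCommGroup W] [NormedSpace ℝ W]
    [FiniteDimensional ℝ W] {F : W → E} {O : Set W} (hOo : IsOpen O) (hFs : ContDiffOn ℝ ∞ F O)
    {s₀ : W} (hs₀ : s₀ ∈ O) (hDFinj : ∀ w, fderiv ℝ F s₀ w = 0 → w = 0) :
    ∃ h : OpenPartialHomeomorph (E × W) (E × (W →L[ℝ] ℝ)), (F s₀, s₀) ∈ h.source ∧
      h.source ⊆ Prod.snd ⁻¹' O ∧
      (∀ x, h x = (x.1, (innerBilin E (F x.2 - x.1)).comp (fderiv ℝ F x.2))) ∧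
      ∀ y ∈ h.target, ContDiffAt ℝ ∞ h.symm y := by
  have hDF : ContDiffOn ℝ ∞ (fderiv ℝ F) O := hFs.fderiv_of_isOpen hOo (by norm_cast)
  have hFd : HasFDerivAt F (fderiv ℝ F s₀) s₀ :=
    ((hFs.contDiffAt (hOo.mem_nhds hs₀)).differentiableAt (by simp)).hasFDerivAt
  have hΩo : IsOpen (Prod.snd ⁻¹' O : Set (E × W)) := hOo.preimage continuous_snd
  have hFc : ContDiffOn ℝ ∞ (fun x : E × W => F x.2) (Prod.snd ⁻¹' O) :=
    hFs.comp contDiff_snd.contDiffOn fun x hx => hx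
  have hDFc : ContDiffOn ℝ ∞ (fun x : E × W => fderiv ℝ F x.2) (Prod.snd ⁻¹' O) :=
    hDF.comp contDiff_snd.contDiffOn fun x hx => hx
  have hGs : ContDiffOn ℝ ∞ (fun x : E × W => (innerBilin E (F x.2 - x.1)).comp (fderiv ℝ F x.2))
      (Prod.snd ⁻¹' O) :=
    ((innerBilin E).contDiff.comp_contDiffOn (hFc.sub contDiff_fst.contDiffOn)).clm_comp hDFc
  have hHs := (contDiff_fst (𝕜 := ℝ) (E := E) (F := W)).contDiffOn.prodMk hGs
  have haΩ : (F s₀, s₀) ∈ (Prod.snd ⁻¹' O : Set (E × W)) := hs₀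
  have hrank : Module.finrank ℝ (E × W) = Module.finrank ℝ (E × (W →L[ℝ] ℝ)) := by
    have : Module.finrank ℝ (W →L[ℝ] ℝ) = Module.finrank ℝ W := by
      rw [← (LinearMap.toContinuousLinearMap (𝕜 := ℝ) (E := W) (F' := ℝ)).finrank_eq,
        Module.finrank_linearMap_self]
    rw [Module.finrank_prod, Module.finrank_prod, this]
  refine exists_openPartialHomeomorph_contDiffAt_symm hrank hΩo hHs haΩ fun v hv => ?_
  have hFd' : HasFDerivAt (fun x : E × W => F x.2 - x.1)
      ((fderiv ℝ F s₀).comp (ContinuousLinearMap.snd ℝ E W)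
        - ContinuousLinearMap.fst ℝ E W) (F s₀, s₀) :=
    (HasFDerivAt.comp (g := F) (F s₀, s₀) hFd hasFDerivAt_snd).sub hasFDerivAt_fst
  have hDFd : HasFDerivAt (fun x : E × W => fderiv ℝ F x.2) _ (F s₀, s₀) :=
    ((hDFc.contDiffAt (hΩo.mem_nhds haΩ)).differentiableAt (by simp)).hasFDerivAt
  have hGd := ((innerBilin E).hasFDerivAt.comp (F s₀, s₀) hFd').clm_comp hDFd
  have hHd := (hasFDerivAt_fst (𝕜 := ℝ) (E := E) (F := W) (p := (F s₀, s₀))).prodMk hGd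
  have hv' := (congrArg (fun T : E × W →L[ℝ] E × (W →L[ℝ] ℝ) => T v) hHd.fderiv).symm.trans hv
  have hv1 : v.1 = 0 := congrArg Prod.fst hv'
  -- The second derivative of `F` is multiplied by `F s₀ - F s₀ = 0`, so evaluation on `v.2` leaves
  -- the squared length of `fderiv ℝ F s₀ v.2`.
  have h7 := congrArg (fun T : E × (W →L[ℝ] ℝ) => T.2 v.2) hv'
  simp [hv1, innerBilin_apply] at h7
  exact Prod.ext hv1 (hDFinj _ h7)

/-- A nearest point to `q` exists by compactness. For `q` near `p` it lies near `p`, hence in a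
chart, where it is a critical point of the squared distance to `q`. The local diffeomorphism of
`exists_openPartialHomeomorph_critical` allows only one such point nearby and makes it smooth in
`q`. -/
theorem IsSmoothSubmanifold.exists_nhds_nearestPoint {n : ℕ} {M : Set (Ambient N)}
    (hM : IsCompact M) (hMn : IsSmoothSubmanifold n M) {p : Ambient N} (hp : p ∈ M) :
    ∃ U : Set (Ambient N), IsOpen U ∧ p ∈ U ∧ (∀ q ∈ U, ∃! y, IsNearest M q y) ∧
      ContDiffOn ℝ ∞ (nearestPoint M) U := by
  obtain ⟨e, W, hpe, hes, het, -, him⟩ := hMn p hp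
  set F : W → Ambient N := fun w => e.symm w with hF
  set O : Set W := {w | (w : Ambient N) ∈ e.target} with hO
  have hOo : IsOpen O := e.open_target.preimage continuous_subtype_val
  have hFs : ContDiffOn ℝ ∞ F O :=
    het.comp W.subtypeL.contDiff.contDiffOn fun w hw => hw
  have hFM : ∀ w ∈ O, F w ∈ M := fun w hw => (him.symm_apply_mem_iff hw).mpr w.2
  have hepW : e p ∈ W := (him.apply_mem_iff hpe).mpr hp
  set s₀ : W := ⟨e p, hepW⟩ with hs₀
  have hs₀O : s₀ ∈ O := e.map_source hpe
  have hFs₀ : F s₀ = p := e.left_inv hpe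
  have hFd : ∀ w ∈ O, HasFDerivAt F (fderiv ℝ F w) w := fun w hw =>
    ((hFs.contDiffAt (hOo.mem_nhds hw)).differentiableAt (by simp)).hasFDerivAt
  -- the differential of the parametrization is injective
  have hDFinj : ∀ w, fderiv ℝ F s₀ w = 0 → w = 0 := by
    intro w hw
    have h1 : HasFDerivAt e (fderiv ℝ e (F s₀)) (F s₀) := by
      rw [hFs₀]
      exact ((hes.contDiffAt (e.open_source.mem_nhds hpe)).differentiableAt (by simp)).hasFDerivAt
    have h2 := h1.comp s₀ (hFd s₀ hs₀O)
    have h3 : (e ∘ F) =ᶠ[𝓝 s₀] W.subtypeL := by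
      filter_upwards [hOo.mem_nhds hs₀O] with w hw
      exact e.right_inv hw
    have h4 := (h2.congr_of_eventuallyEq h3.symm).unique W.subtypeL.hasFDerivAt
    have h5 := congrArg (fun T : W →L[ℝ] Ambient N => T w) h4
    simp only [ContinuousLinearMap.comp_apply, hw, map_zero] at h5
    exact Subtype.ext h5.symm
  obtain ⟨h, hah, hhΩ, hhH, hhs⟩ := exists_openPartialHomeomorph_critical hOo hFs hs₀O hDFinj
  rw [hFs₀] at hah
  have htp : (p, (0 : W →L[ℝ] ℝ)) ∈ h.target := by
    have hHa : h (p, s₀) = (p, 0) := by rw [hhH]; simp [hFs₀]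
    rw [← hHa]; exact h.map_source hah
  -- points of `M` close to `p`, in the chart
  have hclose : ∀ᶠ x in 𝓝 p ×ˢ 𝓝 p, x.2 ∈ e.source ∧
      (x.1, W.orthogonalProjectionOnto (e x.2)) ∈ h.source := by
    rw [← nhds_prod_eq]
    have hc : ContinuousAt (fun x : Ambient N × Ambient N =>
        (x.1, W.orthogonalProjectionOnto (e x.2))) (p, p) := by
      refine continuousAt_fst.prodMk ?_
      refine W.orthogonalProjectionOnto.continuous.continuousAt.comp ?_
      exact (e.continuousAt hpe).comp continuousAt_snd
    have hval : (p, W.orthogonalProjectionOnto (e p)) = (p, s₀) := by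
      have : W.orthogonalProjectionOnto (e p) = s₀ :=
        Submodule.orthogonalProjectionOnto_mem_subspace_eq_self s₀
      rw [this]
    refine ((continuousAt_snd (p := (p, p))).eventually (e.open_source.mem_nhds hpe)).and ?_
    refine hc.eventually (h.open_source.mem_nhds ?_)
    show (p, W.orthogonalProjectionOnto (e p)) ∈ h.source
    rw [hval]; exact hah
  obtain ⟨δ, hδ, hδc⟩ : ∃ δ > 0, ∀ q y, dist q p < δ → dist y p < δ → y ∈ e.source ∧
      (q, W.orthogonalProjectionOnto (e y)) ∈ h.source := by
    rw [← nhds_prod_eq, Metric.eventually_nhds_iff] at hclose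
    obtain ⟨δ, hδ, h1⟩ := hclose
    exact ⟨δ, hδ, fun q y hq hy => h1 (y := (q, y)) (by rw [Prod.dist_eq]; exact max_lt hq hy)⟩
  set U : Set (Ambient N) := Metric.ball p (δ / 2) ∩ {q | (q, (0 : W →L[ℝ] ℝ)) ∈ h.target} with hU
  set σ : Ambient N → W := fun q => (h.symm (q, 0)).2 with hσ
  have hUo : IsOpen U := Metric.isOpen_ball.inter
    (h.open_target.preimage (by fun_prop : Continuous fun q : Ambient N => (q, (0 : W →L[ℝ] ℝ))))
  have huniq : ∀ q ∈ U, ∀ y, IsNearest M q y → y = F (σ q) := by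
    intro q hq y hy
    have hq1 : dist q p < δ / 2 := hq.1
    -- Since `p` competes with `y`, the point `y` is within `2 dist q p` of `p`; this is why `U` has
    -- radius `δ / 2`.
    have hyp : dist y p < δ := by
      have h1 : dist q y ≤ dist q p := hy.2 ▸ Metric.infDist_le_dist_of_mem hp
      have h2 := dist_triangle y q p
      rw [dist_comm y q] at h2
      linarith
    obtain ⟨hye, hys⟩ := hδc q y (by linarith) hyp
    have heyW : e y ∈ W := (him.apply_mem_iff hye).mpr hy.1
    set s : W := ⟨e y, heyW⟩
    have hPs : W.orthogonalProjectionOnto (e y) = s :=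
      Submodule.orthogonalProjectionOnto_mem_subspace_eq_self s
    rw [hPs] at hys
    have hsO : s ∈ O := e.map_source hye
    have hFsy : F s = y := e.left_inv hye
    have hmin : IsLocalMin (fun w => ‖F w - q‖ ^ 2) s := by
      filter_upwards [hOo.mem_nhds hsO] with w hw
      have h1 : dist q y ≤ dist q (F w) := hy.2 ▸ Metric.infDist_le_dist_of_mem (hFM w hw)
      rw [dist_eq_norm', dist_eq_norm'] at h1
      rw [hFsy]
      gcongr
    have hG0 := hmin.innerBilin_comp_eq_zero (hFd s hsO)
    have : h.symm (q, 0) = (q, s) := by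
      have h1 : h (q, s) = (q, 0) := by rw [hhH]; simp only [hG0]
      rw [← h1, h.left_inv hys]
    simp only [hσ, this, hFsy]
  have hex : ∀ q, ∃ y, IsNearest M q y := fun q => by
    obtain ⟨y, hy, hyd⟩ := hM.exists_infDist_eq_dist ⟨p, hp⟩ q
    exact ⟨y, hy, hyd.symm⟩
  have hEU : ∀ q ∈ U, ∃! y, IsNearest M q y := fun q hq => by
    obtain ⟨y, hy⟩ := hex q
    exact ⟨y, hy, fun y' hy' => (huniq q hq y' hy').trans (huniq q hq y hy).symm⟩
  refine ⟨U, hUo, ⟨Metric.mem_ball_self (by linarith), htp⟩, hEU, ?_⟩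
  have hcd : ContDiffOn ℝ ∞ (fun q => F (σ q)) U := by
    intro q hq
    refine ContDiffAt.contDiffWithinAt ?_
    have hσO : σ q ∈ O := hhΩ (h.map_target hq.2)
    have h1 : ContDiffAt ℝ ∞ σ q :=
      contDiffAt_snd.comp q ((hhs _ hq.2).comp q (contDiffAt_id.prodMk contDiffAt_const))
    exact (hFs.contDiffAt (hOo.mem_nhds hσO)).comp q h1
  refine hcd.congr fun q hq => ?_
  obtain ⟨y, hy⟩ := hex q
  rw [nearestPoint_eq_of_existsUnique (hEU q hq) hy, huniq q hq y hy]

theorem IsSmoothSubmanifold.exists_isTubularNhd {n : ℕ} {M : Set (Ambient N)} (hM : IsCompact M)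
    (hMn : IsSmoothSubmanifold n M) : ∃ V : Set (Ambient N), IsTubularNhd M V := by
  choose! U hUo hpU hEU hcd using fun p (hp : p ∈ M) => hMn.exists_nhds_nearestPoint hM hp
  refine ⟨⋃ p ∈ M, U p, isOpen_biUnion hUo, fun p hp => Set.mem_biUnion hp (hpU p hp), ?_, ?_⟩
  · intro q hq
    obtain ⟨p, hp, hq⟩ := Set.mem_iUnion₂.mp hq
    exact hEU p hp q hq
  · intro q hq
    obtain ⟨p, hp, hq⟩ := Set.mem_iUnion₂.mp hq
    exact ((hcd p hp).contDiffAt ((hUo p hp).mem_nhds hq)).contDiffWithinAt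

end Tubular

/-! ### The differential of the nearest-point projection and a global extension -/

section Projection

open scoped Topology NNReal

variable {N : ℕ} {M V : Set (Ambient N)}

namespace IsTubularNhd

theorem isNearest_nearestPoint (hV : IsTubularNhd M V) {p : Ambient N} (hp : p ∈ V) :
    IsNearest M p (nearestPoint M p) :=
  Classical.epsilon_spec (hV.existsUnique p hp).exists

theorem nearestPoint_of_mem (hV : IsTubularNhd M V) {q : Ambient N} (hq : q ∈ M) :
    nearestPoint M q = q :=
  nearestPoint_eq_of_existsUnique (hV.existsUnique q (hV.subset hq))
    ⟨hq, by rw [dist_self, Metric.infDist_zero_of_mem hq]⟩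

theorem hasFDerivAt (hV : IsTubularNhd M V) {p : Ambient N} (hp : p ∈ V) :
    HasFDerivAt (nearestPoint M) (fderiv ℝ (nearestPoint M) p) p :=
  ((hV.contDiffOn.contDiffAt (hV.isOpen.mem_nhds hp)).differentiableAt (by simp)).hasFDerivAt

theorem hasDerivAt_line (hV : IsTubularNhd M V) {q : Ambient N} (hq : q ∈ M) (v : Ambient N) :
    HasDerivAt (fun t : ℝ => nearestPoint M (q + t • v)) (fderiv ℝ (nearestPoint M) q v) 0 := by
  have h1 : HasDerivAt (fun t : ℝ => q + t • v) v 0 := by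
    simpa using ((hasDerivAt_id (0 : ℝ)).smul_const v).const_add q
  have h2 : HasFDerivAt (nearestPoint M) (fderiv ℝ (nearestPoint M) q) (q + (0 : ℝ) • v) := by
    simpa using hV.hasFDerivAt (hV.subset hq)
  exact h2.comp_hasDerivAt (0 : ℝ) h1

theorem eventually_line_mem (hV : IsTubularNhd M V) {q : Ambient N} (hq : q ∈ M) (v : Ambient N) :
    ∀ᶠ t : ℝ in 𝓝 0, q + t • v ∈ V := by
  have hc : ContinuousAt (fun t : ℝ => q + t • v) 0 := by fun_prop
  exact hc.eventually (hV.isOpen.mem_nhds (by simpa using hV.subset hq))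

theorem fderiv_mem_tangentAt (hV : IsTubularNhd M V) {q : Ambient N} (hq : q ∈ M)
    (v : Ambient N) : fderiv ℝ (nearestPoint M) q v ∈ tangentAt M q := by
  refine Submodule.subset_span ⟨fun t => nearestPoint M (q + t • v), ?_, ?_,
    hV.hasDerivAt_line hq v⟩
  · simpa using hV.nearestPoint_of_mem hq
  · exact (hV.eventually_line_mem hq v).mono fun t ht => (hV.isNearest_nearestPoint ht).1

/-- The projection fixes every curve in `M`, hence its velocity. -/
theorem fderiv_of_mem_tangentAt (hV : IsTubularNhd M V) {q : Ambient N} (hq : q ∈ M)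
    {v : Ambient N} (hv : v ∈ tangentAt M q) : fderiv ℝ (nearestPoint M) q v = v := by
  have hle : tangentAt M q ≤ LinearMap.eqLocus
      (fderiv ℝ (nearestPoint M) q : Ambient N →ₗ[ℝ] Ambient N) LinearMap.id := by
    refine Submodule.span_le.mpr ?_
    rintro v ⟨γ, hγ0, hγM, hγ⟩
    have h1 : HasFDerivAt (nearestPoint M) (fderiv ℝ (nearestPoint M) q) (γ 0) := by
      rw [hγ0]; exact hV.hasFDerivAt (hV.subset hq)
    have h2 := h1.comp_hasDerivAt (0 : ℝ) hγ
    have h3 : (nearestPoint M ∘ γ) =ᶠ[𝓝 0] γ :=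
      hγM.mono fun t ht => hV.nearestPoint_of_mem ht
    exact (h2.congr_of_eventuallyEq h3.symm).unique hγ
  exact hle hv

/-- At points of `M` the differential of the nearest point projection is the orthogonal
projection onto the tangent space. -/
theorem fderiv_eq_starProjection (hV : IsTubularNhd M V) {q : Ambient N} (hq : q ∈ M)
    (v : Ambient N) : fderiv ℝ (nearestPoint M) q v = (tangentAt M q).starProjection v := by
  set L := fderiv ℝ (nearestPoint M) q with hL
  set w := (tangentAt M q).starProjection v with hw
  have hwT : w ∈ tangentAt M q := Submodule.starProjection_apply_mem _ _
  have hLw : L w = w := hV.fderiv_of_mem_tangentAt hq hwT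
  have hLv : L v ∈ tangentAt M q := hV.fderiv_mem_tangentAt hq v
  have hslope : ∀ a : Ambient N, Tendsto (fun t : ℝ => t⁻¹ • (q + t • v - nearestPoint M (q + t • a)))
      (𝓝[>] 0) (𝓝 (v - L a)) := by
    intro a
    have h1 : HasDerivAt (fun t : ℝ => q + t • v) v 0 := by
      simpa using ((hasDerivAt_id (0 : ℝ)).smul_const v).const_add q
    have h2 := (h1.sub (hV.hasDerivAt_line hq a)).tendsto_slope_zero_right
    refine h2.congr fun t => ?_
    simp [hV.nearestPoint_of_mem hq]
  -- The point `nearestPoint M (q + t • w)` of `M` is no closer to `q + t • v` than the nearest one.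
  -- Divide by `t` and let `t → 0`, using `L w = w`. By Pythagoras `w` is the unique closest tangent
  -- vector to `v`, so `L v = w`.
  have hle : ‖v - L v‖ ≤ ‖v - w‖ := by
    have h1 := (hslope v).norm
    have h2 := (hslope w).norm
    rw [hLw] at h2
    refine le_of_tendsto_of_tendsto h1 h2 ?_
    have e1 := (hV.eventually_line_mem hq v).filter_mono
      (nhdsWithin_le_nhds (s := Set.Ioi 0))
    have e2 := (hV.eventually_line_mem hq w).filter_mono
      (nhdsWithin_le_nhds (s := Set.Ioi 0))
    filter_upwards [e1, e2] with t ht1 ht2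
    rw [norm_smul, norm_smul]
    gcongr
    rw [← dist_eq_norm, ← dist_eq_norm, (hV.isNearest_nearestPoint ht1).2]
    exact Metric.infDist_le_dist_of_mem (hV.isNearest_nearestPoint ht2).1
  have hpyth : ‖v - L v‖ * ‖v - L v‖ = ‖v - w‖ * ‖v - w‖ + ‖w - L v‖ * ‖w - L v‖ := by
    have e : v - L v = (v - w) + (w - L v) := by abel
    rw [e]
    refine norm_add_sq_eq_norm_sq_add_norm_sq_real ?_
    exact Submodule.starProjection_inner_eq_zero _ _ ((tangentAt M q).sub_mem hwT hLv)
  have hz : ‖w - L v‖ = 0 := by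
    nlinarith [norm_nonneg (v - L v), norm_nonneg (v - w), norm_nonneg (w - L v)]
  exact (sub_eq_zero.mp (norm_eq_zero.mp hz)).symm

end IsTubularNhd

/-- Mean value inequality on the ball of radius `‖b - a‖`. When `f` fixes `a` and `b`, it says that
`b - a` is tangent up to a quadratic error. -/
theorem norm_sub_sub_fderiv_le_of_lipschitzWith {E : Type*} [NormedAddCommGroup E] [NormedSpace ℝ E]
    {f : E → E} (hf : Differentiable ℝ f) {Λ : ℝ≥0} (hΛ : LipschitzWith Λ (fderiv ℝ f)) (a b : E) :
    ‖f b - f a - fderiv ℝ f a (b - a)‖ ≤ Λ * ‖b - a‖ ^ 2 := by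
  have h := (convex_closedBall a ‖b - a‖).norm_image_sub_le_of_norm_fderiv_le' (𝕜 := ℝ) (f := f)
    (φ := fderiv ℝ f a) (C := Λ * ‖b - a‖) (x := a) (y := b) (fun x _ => hf x) (fun x hx => ?_)
    (Metric.mem_closedBall_self (norm_nonneg _)) (by simp [dist_eq_norm])
  · calc _ ≤ _ := h
      _ = _ := by ring
  · rw [← dist_eq_norm]
    refine (hΛ.dist_le_mul x a).trans ?_
    gcongr
    exact hx

/-- The nearest point projection onto `M` extends from a neighbourhood of `M` to a smooth map with
compact support. -/
theorem IsTubularNhd.exists_extension (hM : IsCompact M) (hne : M.Nonempty)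
    (hV : IsTubularNhd M V) :
    ∃ (P : Ambient N → Ambient N) (δ : ℝ), 0 < δ ∧ ContDiff ℝ ∞ P ∧ HasCompactSupport P ∧
      ∀ p, Metric.infDist p M < δ → p ∈ V ∧ P =ᶠ[𝓝 p] nearestPoint M := by
  obtain ⟨δ, hδ, hδV⟩ := hM.exists_cthickening_subset_open hV.isOpen hV.subset
  have hbd : Bornology.IsBounded (Metric.cthickening δ M) := hM.isBounded.cthickening
  have hdisj : Disjoint (Metric.thickening δ M)ᶜ (Metric.cthickening (δ / 2) M) :=
    Set.disjoint_compl_left_iff_subset.mpr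
      (Metric.cthickening_subset_thickening' hδ (by linarith) M)
  -- The cutoff is `1` near the closed `δ / 2`-thickening, so that derivatives agree there too, and
  -- `0` near the complement of the `δ`-thickening.
  obtain ⟨θ, hθ0, hθ1, -⟩ := exists_contMDiffMap_zero_one_nhds_of_isClosed
    (modelWithCornersSelf ℝ (Ambient N)) Metric.isOpen_thickening.isClosed_compl
    Metric.isClosed_cthickening hdisj (n := ⊤)
  have hθs : ContDiff ℝ ∞ θ := θ.contMDiff.contDiff
  refine ⟨fun p => θ p • nearestPoint M p, δ / 2, by linarith, ?_, ?_, ?_⟩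
  · rw [contDiff_iff_contDiffAt]
    intro p
    by_cases hp : p ∈ Metric.thickening δ M
    · exact hθs.contDiffAt.smul (hV.contDiffOn.contDiffAt (hV.isOpen.mem_nhds
        (hδV (Metric.thickening_subset_cthickening _ _ hp))))
    · have h0 : ∀ᶠ x in 𝓝 p, θ x = 0 :=
        hθ0.filter_mono (nhds_le_nhdsSet hp)
      refine contDiffAt_const (c := (0 : Ambient N)) |>.congr_of_eventuallyEq ?_
      filter_upwards [h0] with x hx
      rw [hx, zero_smul]
  · refine HasCompactSupport.of_support_subset_isCompact
      (Metric.isCompact_of_isClosed_isBounded Metric.isClosed_cthickening hbd) fun p hp => ?_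
    by_contra hpt
    refine hp ?_
    have hpc : p ∈ (Metric.thickening δ M)ᶜ := fun h =>
      hpt (Metric.thickening_subset_cthickening _ _ h)
    have h0 : θ p = 0 := (hθ0.filter_mono (nhds_le_nhdsSet hpc)).self_of_nhds
    simp only [h0, zero_smul]
  · intro p hp
    have hp' : p ∈ Metric.cthickening (δ / 2) M :=
      Metric.thickening_subset_cthickening _ _ ((Metric.mem_thickening_iff_infDist_lt hne).mpr hp)
    refine ⟨hδV (Metric.cthickening_mono (by linarith) _ hp'), ?_⟩
    filter_upwards [hθ1.filter_mono (nhds_le_nhdsSet hp')] with x hx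
    rw [hx, one_smul]

end Projection

/-! ### Weak gradients of Littlewood-Paley blocks -/

section WeakGradientOfBlock

open scoped NNReal Topology

set_option linter.unusedSectionVars false

variable {F : Type*} [NormedAddCommGroup F] [NormedSpace ℝ F] [MeasurableSpace F] [BorelSpace F]
  [SecondCountableTopology F] [CompleteSpace F]

theorem lintegral_enorm_pow_le_of_tendsto {Z : ℕ → Plane → F} {z : Plane → F} (p : ℕ)
    (hZ : ∀ n, Measurable (Z n)) (hlim : ∀ x, Tendsto (fun n => Z n x) atTop (𝓝 (z x)))
    {r : ℕ → ℝ≥0∞} {r₀ : ℝ≥0∞} (hr : ∀ n, ∫⁻ x, ‖Z n x‖ₑ ^ p ≤ r n)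
    (hr₀ : Tendsto r atTop (𝓝 r₀)) : ∫⁻ x, ‖z x‖ₑ ^ p ≤ r₀ := by
  calc ∫⁻ x, ‖z x‖ₑ ^ p = ∫⁻ x, liminf (fun n => ‖Z n x‖ₑ ^ p) atTop := by
        refine lintegral_congr fun x => ?_
        have : Tendsto (fun n => ‖Z n x‖ₑ ^ p) atTop (𝓝 (‖z x‖ₑ ^ p)) :=
          ((ENNReal.continuous_pow p).tendsto _).comp (hlim x).enorm
        exact this.liminf_eq.symm
    _ ≤ liminf (fun n => ∫⁻ x, ‖Z n x‖ₑ ^ p) atTop :=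
        lintegral_liminf_le fun n => (hZ n).enorm.pow_const p
    _ ≤ liminf r atTop := liminf_le_liminf (Eventually.of_forall hr)
    _ = r₀ := hr₀.liminf_eq

theorem IsKernelAtScale.hasLineDerivAt_smoothing {c s : ℝ≥0} {κ : Plane → ℝ}
    (K : IsKernelAtScale c s κ) {w z : Plane → F} {R R' : ℝ≥0} (hw : Measurable w)
    (hwR : ∀ x, ‖w x‖ ≤ R) (hz : Measurable z) (hzR : ∀ x, ‖z x‖ ≤ R') {e : Plane}
    (hd : ∀ x, HasLineDerivAt ℝ w (z x) x e) (x : Plane) :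
    HasLineDerivAt ℝ (smoothing κ w) (smoothing κ z x) x e := by
  have hd' : ∀ x (t : ℝ), HasDerivAt (fun t : ℝ => w (x + t • e)) (z (x + t • e)) t := by
    intro x t
    have h1 : HasDerivAt (fun τ : ℝ => w (x + t • e + τ • e)) (z (x + t • e)) (t - t) := by
      rw [sub_self]; exact hd (x + t • e)
    refine (h1.comp_sub_const t t).congr_of_eventuallyEq (Eventually.of_forall fun τ => ?_)
    have e1 : x + τ • e = x + t • e + (τ - t) • e := by module
    simp only [← e1]
  have hm : ∀ t : ℝ, Measurable fun y : Plane => x + t • e - y := fun t =>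
    measurable_const.sub measurable_id
  have h := (hasDerivAt_integral_of_dominated_loc_of_deriv_le (μ := (volume : Measure Plane))
    (𝕜 := ℝ) (F := fun t y => κ y • w (x + t • e - y)) (F' := fun t y => κ y • z (x + t • e - y))
    (x₀ := 0) (s := Set.univ) (bound := fun y => ‖κ y‖ * R') univ_mem
    (Eventually.of_forall fun t => (K.integrable_of_bound hw hwR (x + t • e)).1)
    (K.integrable_of_bound hw hwR _) (K.integrable_of_bound hz hzR _).1
    (ae_of_all _ fun y t _ => ?_) (K.integrable.norm.mul_const _) (ae_of_all _ fun y t _ => ?_)).2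
  · simp only [zero_smul, add_zero] at h
    exact h
  · rw [norm_smul]
    gcongr
    exact hzR _
  · have := (hd' (x - y) t).const_smul (κ y)
    simp only [sub_add_eq_add_sub] at this
    exact this

/-- Coordinate line derivatives suffice to integrate by parts against a test function, so `z` need
not be continuous. The energy is an infimum over weak gradients, hence exhibiting this one bounds
it. -/
theorem isWeakGrad_lpBlock {χ : Plane → ℝ} {c : ℝ≥0}
    (hK : ∀ k : ℤ, IsKernelAtScale c (2 ^ k) (lowKernel χ k)) {w : Plane → F}
    {z : Fin 2 → Plane → F} {R R' : ℝ≥0} (hw : Measurable w) (hwR : ∀ x, ‖w x‖ ≤ R)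
    (hz : ∀ j, Measurable (z j)) (hzR : ∀ j x, ‖z j x‖ ≤ R')
    (hd : ∀ j x, HasLineDerivAt ℝ w (z j x) x (EuclideanSpace.single j 1)) (k : ℤ) :
    IsWeakGrad (lpBlock χ k w) (fun j => lpBlock χ k (z j)) := by
  have hwc : Continuous (lpBlock χ k w) :=
    ((hK (k + 1)).continuous_smoothing hw hwR).sub ((hK k).continuous_smoothing hw hwR)
  have hzc : ∀ j, Continuous (lpBlock χ k (z j)) := fun j =>
    ((hK (k + 1)).continuous_smoothing (hz j) (hzR j)).sub
      ((hK k).continuous_smoothing (hz j) (hzR j))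
  refine ⟨hwc.locallyIntegrable, fun j => (hzc j).locallyIntegrable, fun ψ hψ hψc j => ?_⟩
  have hline : ∀ x, HasLineDerivAt ℝ (lpBlock χ k w) (lpBlock χ k (z j) x) x
      (EuclideanSpace.single j 1) := fun x =>
    HasDerivAt.sub ((hK (k + 1)).hasLineDerivAt_smoothing hw hwR (hz j) (hzR j) (hd j) x)
      ((hK k).hasLineDerivAt_smoothing hw hwR (hz j) (hzR j) (hd j) x)
  have hψ' : Continuous fun x => fderiv ℝ ψ x (EuclideanSpace.single j 1) :=
    (hψ.continuous_fderiv (by simp)).clm_apply continuous_const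
  have hψ'c : HasCompactSupport fun x => fderiv ℝ ψ x (EuclideanSpace.single j 1) :=
    (hψc.fderiv ℝ).comp_left (g := fun L : Plane →L[ℝ] ℝ => L (EuclideanSpace.single j 1)) rfl
  have := integral_bilinear_hasLineDerivAt_right_eq_neg_left_of_integrable
    (μ := (volume : Measure Plane)) (f := ψ)
    (f' := fun x => fderiv ℝ ψ x (EuclideanSpace.single j 1)) (g := lpBlock χ k w)
    (g' := lpBlock χ k (z j)) (v := EuclideanSpace.single j 1) (B := ContinuousLinearMap.lsmul ℝ ℝ)
    ((hψ'.smul hwc).integrable_of_hasCompactSupport hψ'c.smul_right)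
    ((hψ.continuous.smul (hzc j)).integrable_of_hasCompactSupport hψc.smul_right)
    ((hψ.continuous.smul hwc).integrable_of_hasCompactSupport hψc.smul_right)
    (fun x _ => ((hψ.differentiable (by simp) x).hasFDerivAt).hasLineDerivAt _)
    (fun x _ => hline x)
  simp only [ContinuousLinearMap.lsmul_apply] at this
  rw [this, neg_neg]

end WeakGradientOfBlock

/-! ### The three bounds for the normal part of truncated data -/

section TruncationEstimate

open scoped NNReal Topology

variable {N : ℕ} {χ : Plane → ℝ} {c : ℝ≥0}

/-- Bounds for the part of a frequency localised field normal to `M`: in `L²` and `L¹`, and for its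
translation differences. -/
structure NormalBounds (a b g : ℝ≥0) (z : Plane → Ambient N) : Prop where
  measurable : Measurable z
  sq_le : ∫⁻ x, ‖z x‖ₑ ^ 2 ≤ a
  le : ∫⁻ x, ‖z x‖ₑ ≤ b
  add_sub_le : ∀ y, ∫⁻ x, ‖z (x + y) - z x‖ₑ ^ 2 ≤ g * ‖y‖ₑ ^ 2

theorem NormalBounds.of_tendsto {Z : ℕ → Plane → Ambient N} {z : Plane → Ambient N}
    {a b : ℕ → ℝ≥0} {a₀ b₀ g : ℝ≥0} (hZ : ∀ n, NormalBounds (a n) (b n) g (Z n))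
    (hlim : ∀ x, Tendsto (fun n => Z n x) atTop (𝓝 (z x))) (ha : Tendsto a atTop (𝓝 a₀))
    (hb : Tendsto b atTop (𝓝 b₀)) : NormalBounds a₀ b₀ g z where
  measurable := measurable_of_tendsto_metrizable (fun n => (hZ n).measurable)
    (tendsto_pi_nhds.mpr hlim)
  sq_le := lintegral_enorm_pow_le_of_tendsto 2 (fun n => (hZ n).measurable) hlim
    (fun n => (hZ n).sq_le) (ENNReal.tendsto_coe.mpr ha)
  le := by
    have := lintegral_enorm_pow_le_of_tendsto 1 (fun n => (hZ n).measurable) hlim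
      (r := fun n => b n) (fun n => by simpa using (hZ n).le) (ENNReal.tendsto_coe.mpr hb)
    simpa using this
  add_sub_le y := lintegral_enorm_pow_le_of_tendsto 2
    (fun n => ((hZ n).measurable.comp (measurable_id.add_const y)).sub (hZ n).measurable)
    (fun x => (hlim (x + y)).sub (hlim x)) (fun n => (hZ n).add_sub_le y) tendsto_const_nhds

/-- Respectively boundedness on `L²`, Bernstein's inequality from `L¹`, and the mean-zero
cancellation of the block. -/
theorem NormalBounds.lpBlock_sq_le
    (hK : ∀ k : ℤ, IsKernelAtScale c (2 ^ k) (lowKernel χ k)) {a b g : ℝ≥0}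
    {z : Plane → Ambient N} (hz : NormalBounds a b g z) (k : ℤ) :
    ∫⁻ x, ‖lpBlock χ k z x‖ₑ ^ 2 ≤ (4 * c ^ 2 * a : ℝ≥0) ∧
    ∫⁻ x, ‖lpBlock χ k z x‖ₑ ^ 2 ≤ (10 * c * (2 ^ k) ^ 2 * b ^ 2 : ℝ≥0) ∧
    ∫⁻ x, ‖lpBlock χ k z x‖ₑ ^ 2 ≤ (4 * c ^ 2 * ((2 ^ k)⁻¹) ^ 2 * g : ℝ≥0) := by
  have hfin : ∫⁻ x, ‖z x‖ₑ ^ 2 ≠ ⊤ := ne_top_of_le_ne_top ENNReal.coe_ne_top hz.sq_le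
  refine ⟨?_, ?_, ?_⟩
  · refine (lintegral_sq_lpBlock_le hK hz.measurable k).trans ?_
    push_cast
    gcongr
    exact hz.sq_le
  · refine (lintegral_sq_lpBlock_le_of_lintegral hK hz.measurable k).trans ?_
    simp only [ENNReal.coe_mul, ENNReal.coe_pow, ENNReal.coe_ofNat]
    gcongr
    exact hz.le
  · refine (lintegral_sq_lpBlock_le_of_add_sub hK hz.measurable hfin hz.add_sub_le k).trans ?_
    simp only [ENNReal.coe_mul, ENNReal.coe_pow, ENNReal.coe_ofNat]
    exact le_rfl

/-- The standing assumptions on the first component of the data. -/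
structure IsDispersed (χ : Plane → ℝ) (ε R A : ℝ≥0) (φ : Plane → Ambient N) : Prop where
  measurable : Measurable φ
  bound : ∀ x, ‖φ x‖ ≤ R
  block_le : ∀ k x, ‖lpBlock χ k φ x‖ₑ ≤ ε
  add_sub_le : ∀ y, ∫⁻ x, ‖φ (x + y) - φ x‖ₑ ^ 2 ≤ (A : ℝ≥0∞) ^ 2 * ‖y‖ₑ ^ 2

theorem IsDispersed.sub_sub_le {ε R A : ℝ≥0} {φ : Plane → Ambient N}
    (hφ : IsDispersed χ ε R A φ) (y : Plane) :
    ∫⁻ x, ‖φ (x - y) - φ x‖ₑ ^ 2 ≤ (A : ℝ≥0∞) ^ 2 * ‖y‖ₑ ^ 2 := by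
  simpa only [sub_eq_add_neg, enorm_neg] using hφ.add_sub_le (-y)

theorem IsDispersed.lintegral_sq_sub_lpLow_le
    (hK : ∀ k : ℤ, IsKernelAtScale c (2 ^ k) (lowKernel χ k)) {ε R A : ℝ≥0}
    {φ : Plane → Ambient N} (hφ : IsDispersed χ ε R A φ) (l : ℤ) :
    ∫⁻ x, ‖φ x - lpLow χ l φ x‖ₑ ^ 2 ≤ ((c * (2 ^ l)⁻¹ * A : ℝ≥0) : ℝ≥0∞) ^ 2 := by
  have := (hK l).lintegral_sq_smoothing_sub_le hφ.measurable
    ((hK l).integrable_of_bound hφ.measurable hφ.bound) hφ.sub_sub_le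
  simp only [fun x => enorm_sub_rev (φ x) (lpLow χ l φ x)]
  refine this.trans (le_of_eq ?_)
  simp only [ENNReal.coe_mul]
  ring

/-- The comparison map is `P_{<l+J} φ` in the `L²` bound and `P_{<l} φ` itself in the `L¹` bound.
The defect `δ` leaves room for fields that are only approximately tangent, such as difference
quotients. -/
theorem IsDispersed.normalBounds (hK : ∀ k : ℤ, IsKernelAtScale c (2 ^ k) (lowKernel χ k))
    {ε R A Λ β δ : ℝ≥0} {φ ψ : Plane → Ambient N} (hφ : IsDispersed χ ε R A φ)
    {B : Ambient N → Ambient N →L[ℝ] Ambient N} (hB : LipschitzWith Λ B)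
    (hβ : ∀ a w, ‖w - B a w‖ₑ ≤ β * ‖w‖ₑ) (hψ : Measurable ψ)
    (hψA : ∫⁻ x, ‖ψ x‖ₑ ^ 2 ≤ (A : ℝ≥0∞) ^ 2) (hδ : ∫⁻ x, ‖ψ x - B (φ x) (ψ x)‖ₑ ≤ δ)
    (l : ℤ) (J : ℕ) :
    NormalBounds
      (2 * (c * (2 ^ l) ^ 2 * (δ + Λ * (c * (2 ^ (l + J : ℤ))⁻¹ * A * A)) ^ 2
        + (Λ * (c * (3 * J * ε) + c * (2 ^ l)⁻¹ * (c * 2 ^ (l - J : ℤ) * R))) ^ 2 * A ^ 2))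
      (c * δ + Λ * (c * (2 ^ l)⁻¹ * A * A + c * (2 ^ l)⁻¹ * A * (c * A)))
      (2 * ((β * (c * 2 ^ l)) ^ 2 + (Λ * (c * 2 ^ l * R) * c) ^ 2) * A ^ 2)
      (normalPart (lowKernel χ l) B (lpLow χ l φ) ψ) := by
  have hu : Measurable (lpLow χ l φ) := measurable_smoothing (hK l).continuous hφ.measurable
  refine ⟨?_, ?_, ?_, fun y => ?_⟩
  · have hg : Measurable (smoothing (lowKernel χ l) ψ) := measurable_smoothing (hK l).continuous hψ
    exact hg.sub (measurable_clm_comp hB.continuous hu hg)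
  · have := (hK l).lintegral_sq_normalPart_le hB hφ.measurable
      (measurable_smoothing (hK (l + J)).continuous hφ.measurable) hψ hψA
      (hφ.lintegral_sq_sub_lpLow_le hK (l + J)) hδ
      (enorm_lpLow_sub_le hK hφ.measurable hφ.bound hφ.block_le l J)
    refine this.trans (le_of_eq ?_)
    simp only [ENNReal.coe_mul, ENNReal.coe_add, ENNReal.coe_pow, ENNReal.coe_ofNat]
  · have := (hK l).lintegral_normalPart_le hB hφ.measurable hu hψ hψA
      (hφ.lintegral_sq_sub_lpLow_le hK l) hφ.sub_sub_le hδ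
    refine this.trans (le_of_eq ?_)
    simp only [ENNReal.coe_mul, ENNReal.coe_add]
  · have := (hK l).lintegral_sq_normalPart_add_sub_le hB hβ hψ hψA (u := lpLow χ l φ)
      (ℓ := c * 2 ^ l * R) (fun x h => by
        have := (hK l).enorm_smoothing_add_sub_le hφ.measurable hφ.bound x h
        simp only [ENNReal.coe_mul]
        exact this) y
    refine this.trans (le_of_eq ?_)
    simp only [ENNReal.coe_mul, ENNReal.coe_add, ENNReal.coe_pow, ENNReal.coe_ofNat]

/-- The normal part of the gradient of a frequency truncation. -/
theorem IsDispersed.normalBounds_fderiv (hK : ∀ k : ℤ, IsKernelAtScale c (2 ^ k) (lowKernel χ k))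
    {ε R A Λ β : ℝ≥0} {φ : Plane → Ambient N} (hφ : IsDispersed χ ε R A φ)
    {P : Ambient N → Ambient N} (hP : Differentiable ℝ P) (hB : LipschitzWith Λ (fderiv ℝ P))
    (hβ : ∀ a w, ‖w - fderiv ℝ P a w‖ₑ ≤ β * ‖w‖ₑ) (hPφ : ∀ x, P (φ x) = φ x)
    {e : Plane} (he : ‖e‖ = 1) (l : ℤ) (J : ℕ) :
    NormalBounds
      (2 * (c * (2 ^ l) ^ 2 * (0 + Λ * (c * (2 ^ (l + J : ℤ))⁻¹ * A * A)) ^ 2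
        + (Λ * (c * (3 * J * ε) + c * (2 ^ l)⁻¹ * (c * 2 ^ (l - J : ℤ) * R))) ^ 2 * A ^ 2))
      (c * 0 + Λ * (c * (2 ^ l)⁻¹ * A * A + c * (2 ^ l)⁻¹ * A * (c * A)))
      (2 * ((β * (c * 2 ^ l)) ^ 2 + (Λ * (c * 2 ^ l * R) * c) ^ 2) * A ^ 2)
      (fun x => fderiv ℝ (lpLow χ l φ) x e
        - fderiv ℝ P (lpLow χ l φ x) (fderiv ℝ (lpLow χ l φ) x e)) := by
  set t : ℕ → ℝ≥0 := fun n => ((n : ℝ≥0) + 1)⁻¹ with ht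
  have ht0 : ∀ n, t n ≠ 0 := fun n => by simp [ht]
  have htr : ∀ n, (t n : ℝ) ≠ 0 := fun n => by exact_mod_cast ht0 n
  have htlim : Tendsto t atTop (𝓝 0) := by
    have := tendsto_one_div_add_atTop_nhds_zero_nat (𝕜 := ℝ)
    rw [← NNReal.tendsto_coe]
    simpa [ht] using this
  -- Difference quotients with step `t n → 0` stand in for the weak derivative of `φ`, which avoids
  -- a chain rule for `P ∘ φ`.
  set q : ℕ → Plane → Ambient N := fun n x => ((t n : ℝ)⁻¹) • (φ (x + (t n : ℝ) • e) - φ x) with hq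
  have hqm : ∀ n, Measurable (q n) := fun n =>
    ((hφ.measurable.comp (measurable_id.add_const ((t n : ℝ) • e))).sub
      hφ.measurable).const_smul ((t n : ℝ)⁻¹)
  have hnt : ∀ n, ‖(t n : ℝ)‖ₑ = t n := fun n => by simp
  have hnt' : ∀ n, ‖((t n : ℝ)⁻¹)‖ₑ * t n = 1 := fun n => by
    rw [← hnt n, ← enorm_mul, inv_mul_cancel₀ (htr n), enorm_one]
  have hqsq : ∀ n, ∫⁻ x, ‖q n x‖ₑ ^ 2 ≤ (A : ℝ≥0∞) ^ 2 := by
    intro n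
    simp only [hq, enorm_smul, mul_pow]
    rw [lintegral_const_mul' _ _ (by finiteness)]
    calc _ ≤ ‖((t n : ℝ)⁻¹)‖ₑ ^ 2 * ((A : ℝ≥0∞) ^ 2 * ‖(t n : ℝ) • e‖ₑ ^ 2) := by
          gcongr; exact hφ.add_sub_le _
      _ = (‖((t n : ℝ)⁻¹)‖ₑ * t n) ^ 2 * (A : ℝ≥0∞) ^ 2 := by
          have : ‖e‖ₑ = 1 := by rw [← enorm_norm, he, enorm_one]
          rw [enorm_smul, this, hnt]; ring
      _ = _ := by rw [hnt']; simp
  -- Since `P` fixes the values of `φ`, the normal part of the quotient is a Taylor remainder of `P`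
  -- divided by `t n`; it is quadratic in `q n` and so is `O(t n)` in `L¹`.
  have hqδ : ∀ n, ∫⁻ x, ‖q n x - fderiv ℝ P (φ x) (q n x)‖ₑ ≤ (Λ * t n * A ^ 2 : ℝ≥0) := by
    intro n
    have hpt : ∀ x, ‖q n x - fderiv ℝ P (φ x) (q n x)‖ₑ ≤ Λ * t n * ‖q n x‖ₑ ^ 2 := by
      intro x
      set b := φ (x + (t n : ℝ) • e)
      have e1 : q n x - fderiv ℝ P (φ x) (q n x)
          = ((t n : ℝ)⁻¹) • (P b - P (φ x) - fderiv ℝ P (φ x) (b - φ x)) := by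
        simp only [hq, map_smul, ← smul_sub]
        rw [hPφ, hPφ]
      have h1 : ‖P b - P (φ x) - fderiv ℝ P (φ x) (b - φ x)‖ₑ ≤ Λ * ‖b - φ x‖ₑ ^ 2 := by
        have := norm_sub_sub_fderiv_le_of_lipschitzWith hP hB (φ x) b
        simp only [enorm_eq_nnnorm]
        exact_mod_cast this
      have e2 : b - φ x = (t n : ℝ) • q n x := by
        simp only [hq]; rw [smul_inv_smul₀ (htr n)]
      rw [e1, enorm_smul]
      calc _ ≤ ‖((t n : ℝ)⁻¹)‖ₑ * (Λ * ‖b - φ x‖ₑ ^ 2) := by gcongr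
        _ = (‖((t n : ℝ)⁻¹)‖ₑ * t n) * (Λ * t n * ‖q n x‖ₑ ^ 2) := by
            rw [e2, enorm_smul, hnt]; ring
        _ = _ := by rw [hnt', one_mul]
    refine (lintegral_mono hpt).trans ?_
    rw [lintegral_const_mul' _ _ (by finiteness)]
    simp only [ENNReal.coe_mul, ENNReal.coe_pow]
    gcongr
    exact hqsq n
  have hδlim : Tendsto (fun n => Λ * t n * A ^ 2) atTop (𝓝 0) := by
    have := (htlim.const_mul Λ).mul_const (A ^ 2)
    simpa using this
  have hlow : ∀ n x, smoothing (lowKernel χ l) (q n) x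
      = ((t n : ℝ)⁻¹) • (lpLow χ l φ (x + (t n : ℝ) • e) - lpLow χ l φ x) := by
    intro n x
    have hi := (hK l).integrable_of_bound hφ.measurable hφ.bound
    have hi' := (hK l).integrable_of_bound (f := fun z => φ (z + (t n : ℝ) • e))
      (hφ.measurable.comp (measurable_id.add_const _)) (fun _ => hφ.bound _) x
    rw [lpLow_eq_smoothing, ← smoothing_comp_add_right, smoothing_apply, smoothing_apply,
      smoothing_apply, ← integral_sub hi' (hi x), ← integral_smul]
    congr 1
    ext1 y
    simp only [hq]
    rw [smul_comm, smul_sub (lowKernel χ l y)]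
  have hdiff : ∀ x, Tendsto (fun n => smoothing (lowKernel χ l) (q n) x) atTop
      (𝓝 (fderiv ℝ (lpLow χ l φ) x e)) := by
    intro x
    simp only [hlow]
    have h1 := (((hK l).differentiableAt_smoothing hφ.measurable hφ.bound x).hasFDerivAt
      ).hasLineDerivAt e
    have h2 := h1.tendsto_slope_zero
    refine h2.comp (tendsto_nhdsWithin_iff.mpr ⟨?_, Eventually.of_forall fun n => htr n⟩)
    simpa only [NNReal.coe_zero] using NNReal.tendsto_coe.mpr htlim
  -- Only the defect varies with `n`, and only in the first two bounds; its limit is the literal `0`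
  -- in the statement.
  refine NormalBounds.of_tendsto (fun n => hφ.normalBounds hK hB hβ (hqm n) (hqsq n) (hqδ n) l J)
    (fun x => ?_) ?_ ?_
  · have := hdiff x
    exact this.sub (((fderiv ℝ P (lpLow χ l φ x)).continuous.tendsto _).comp this)
  · have hcont : Continuous fun δ : ℝ≥0 =>
        2 * (c * (2 ^ l) ^ 2 * (δ + Λ * (c * (2 ^ (l + J : ℤ))⁻¹ * A * A)) ^ 2
        + (Λ * (c * (3 * J * ε) + c * (2 ^ l)⁻¹ * (c * 2 ^ (l - J : ℤ) * R))) ^ 2 * A ^ 2) := by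
      fun_prop
    exact (hcont.tendsto 0).comp hδlim
  · have hcont : Continuous fun δ : ℝ≥0 =>
        c * δ + Λ * (c * (2 ^ l)⁻¹ * A * A + c * (2 ^ l)⁻¹ * A * (c * A)) := by fun_prop
    exact (hcont.tendsto 0).comp hδlim

end TruncationEstimate

/-! ### The energy of a block of the truncation error -/

section Energy

open scoped NNReal Topology

variable {N : ℕ} {χ : Plane → ℝ} {c : ℝ≥0}

/-- The constant in the bound for the blocks of the normal part. -/
noncomputable def normalConst (c Λ β R : ℝ≥0) : ℝ≥0 :=
  8 * c ^ 2 * Λ ^ 2 * (c ^ 3 + (3 * c + c ^ 2 * R) ^ 2) + 10 * c * Λ ^ 2 * (c + c ^ 2) ^ 2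
    + 8 * c ^ 2 * ((β * c) ^ 2 + (Λ * c ^ 2 * R) ^ 2)

/-- Each summand of `normalConst` comes from one bound: `L²` when the minimum is `J ε`, `L¹` when it
is the power and `k ≤ l`, increments when `k ≥ l`. In the first case `2^(-J) ≤ ε ≤ J ε` absorbs the
remaining terms; `A²` and `A⁴` are both at most `A² (1 + A²)`. -/
theorem NormalBounds.lpBlock_sq_le_min (hK : ∀ k : ℤ, IsKernelAtScale c (2 ^ k) (lowKernel χ k))
    {ε R A Λ β : ℝ≥0} {z : Plane → Ambient N} {l : ℤ} {J : ℕ} (hJ1 : 1 ≤ J)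
    (hJ : ((2 : ℝ≥0) ^ J)⁻¹ ≤ ε)
    (hz : NormalBounds
      (2 * (c * (2 ^ l) ^ 2 * (0 + Λ * (c * (2 ^ (l + J : ℤ))⁻¹ * A * A)) ^ 2
        + (Λ * (c * (3 * J * ε) + c * (2 ^ l)⁻¹ * (c * 2 ^ (l - J : ℤ) * R))) ^ 2 * A ^ 2))
      (c * 0 + Λ * (c * (2 ^ l)⁻¹ * A * A + c * (2 ^ l)⁻¹ * A * (c * A)))
      (2 * ((β * (c * 2 ^ l)) ^ 2 + (Λ * (c * 2 ^ l * R) * c) ^ 2) * A ^ 2) z) (k : ℤ) :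
    ∫⁻ x, ‖lpBlock χ k z x‖ₑ ^ 2 ≤ (normalConst c Λ β R * (A ^ 2 * (1 + A ^ 2))
      * (min (J * ε) (2 ^ (-|k - l|))) ^ 2 : ℝ≥0) := by
  obtain ⟨h1, h2, h3⟩ := hz.lpBlock_sq_le hK k
  have h2l : (2 : ℝ≥0) ^ l ≠ 0 := zpow_ne_zero _ two_ne_zero
  have h2k : (2 : ℝ≥0) ^ k ≠ 0 := zpow_ne_zero _ two_ne_zero
  have hA1 : A ^ 2 ≤ A ^ 2 * (1 + A ^ 2) := le_mul_of_one_le_right' (by simp)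
  have hA2 : A ^ 4 ≤ A ^ 2 * (1 + A ^ 2) := by
    calc A ^ 4 ≤ A ^ 2 + A ^ 4 := le_add_self
      _ = _ := by ring
  rcases min_choice ((J : ℝ≥0) * ε) (2 ^ (-|k - l|)) with hmin | hmin
  · rw [hmin]
    refine h1.trans (ENNReal.coe_le_coe.mpr ?_)
    set r : ℝ≥0 := (2 ^ J)⁻¹ with hr
    have hrX : r ≤ J * ε := hJ.trans (le_mul_of_one_le_left' (by exact_mod_cast hJ1))
    set X : ℝ≥0 := J * ε with hX
    have e1 : ((2 : ℝ≥0) ^ (l + J : ℤ))⁻¹ = (2 ^ l)⁻¹ * r := by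
      rw [zpow_add₀ two_ne_zero, zpow_natCast, mul_inv]
    have e2 : (2 : ℝ≥0) ^ (l - J : ℤ) = 2 ^ l * r := by
      rw [zpow_sub₀ two_ne_zero, zpow_natCast, div_eq_mul_inv]
    calc _ = 8 * c ^ 2 * Λ ^ 2 * (c ^ 3 * A ^ 4 * r ^ 2 + (3 * c * X + c ^ 2 * R * r) ^ 2 * A ^ 2) := by
          rw [e1, e2, hX]; field_simp; ring
      _ ≤ 8 * c ^ 2 * Λ ^ 2 * (c ^ 3 * (A ^ 2 * (1 + A ^ 2)) * X ^ 2
            + (3 * c * X + c ^ 2 * R * X) ^ 2 * (A ^ 2 * (1 + A ^ 2))) := by gcongr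
      _ = 8 * c ^ 2 * Λ ^ 2 * (c ^ 3 + (3 * c + c ^ 2 * R) ^ 2) * (A ^ 2 * (1 + A ^ 2)) * X ^ 2 := by
          ring
      _ ≤ _ := by
          gcongr
          rw [normalConst, add_assoc]
          exact le_self_add
  · rw [hmin]
    rcases le_total k l with hkl | hkl
    · refine h2.trans (ENNReal.coe_le_coe.mpr ?_)
      have e : (2 : ℝ≥0) ^ (-|k - l|) = 2 ^ k * (2 ^ l)⁻¹ := by
        rw [abs_of_nonpos (by linarith), neg_neg, zpow_sub₀ two_ne_zero, div_eq_mul_inv]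
      rw [e]
      calc _ = 10 * c * Λ ^ 2 * (c + c ^ 2) ^ 2 * A ^ 4 * (2 ^ k * (2 ^ l)⁻¹) ^ 2 := by ring
        _ ≤ 10 * c * Λ ^ 2 * (c + c ^ 2) ^ 2 * (A ^ 2 * (1 + A ^ 2)) * (2 ^ k * (2 ^ l)⁻¹) ^ 2 := by
            gcongr
        _ ≤ _ := by
            gcongr
            rw [normalConst, add_right_comm]
            exact le_add_self
    · refine h3.trans (ENNReal.coe_le_coe.mpr ?_)
      have e : (2 : ℝ≥0) ^ (-|k - l|) = (2 ^ k)⁻¹ * 2 ^ l := by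
        rw [abs_of_nonneg (by linarith), neg_sub, zpow_sub₀ two_ne_zero, div_eq_mul_inv, mul_comm]
      rw [e]
      calc _ = 8 * c ^ 2 * ((β * c) ^ 2 + (Λ * c ^ 2 * R) ^ 2) * A ^ 2 * ((2 ^ k)⁻¹ * 2 ^ l) ^ 2 := by
            ring
        _ ≤ 8 * c ^ 2 * ((β * c) ^ 2 + (Λ * c ^ 2 * R) ^ 2) * (A ^ 2 * (1 + A ^ 2))
              * ((2 ^ k)⁻¹ * 2 ^ l) ^ 2 := by gcongr
        _ ≤ _ := by
            gcongr
            rw [normalConst]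
            exact le_add_self

/-- The factor `3` counts the fields: two partial derivatives of `u - P(u)` and the second
component. The latter uses the differential at `P p`, because `Π` projects onto the tangent space at
the nearest point; on `M` both operator fields agree. -/
theorem IsDispersed.energy_lpBlock_le (hK : ∀ k : ℤ, IsKernelAtScale c (2 ^ k) (lowKernel χ k))
    {ε R A Λ β R' : ℝ≥0} {φ φ₁ : Plane → Ambient N} (hφ : IsDispersed χ ε R A φ)
    {P : Ambient N → Ambient N} (hP : ContDiff ℝ 1 P) (hPR : ∀ p, ‖P p‖ ≤ R')
    (hB : LipschitzWith Λ (fderiv ℝ P)) (hB₂ : LipschitzWith Λ fun p => fderiv ℝ P (P p))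
    (hβ : ∀ a w, ‖w - fderiv ℝ P a w‖ₑ ≤ β * ‖w‖ₑ) (hPφ : ∀ x, P (φ x) = φ x)
    (hφ₁ : Measurable φ₁) (hφ₁A : ∫⁻ x, ‖φ₁ x‖ₑ ^ 2 ≤ (A : ℝ≥0∞) ^ 2)
    (hPφ₁ : ∀ x, fderiv ℝ P (φ x) (φ₁ x) = φ₁ x) {J : ℕ} (hJ1 : 1 ≤ J)
    (hJ : ((2 : ℝ≥0) ^ J)⁻¹ ≤ ε) (k l : ℤ) :
    energy (lpBlock χ k fun x => lpLow χ l φ x - P (lpLow χ l φ x))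
      (lpBlock χ k fun x => lpLow χ l φ₁ x - fderiv ℝ P (P (lpLow χ l φ x)) (lpLow χ l φ₁ x))
      ≤ (3 * (normalConst c Λ β R * (A ^ 2 * (1 + A ^ 2))
        * (min (J * ε) (2 ^ (-|k - l|))) ^ 2) : ℝ≥0) := by
  have hPd : Differentiable ℝ P := hP.differentiable one_ne_zero
  set u := lpLow χ l φ with hu
  have hum : Measurable u := measurable_smoothing (hK l).continuous hφ.measurable
  have hud : ∀ x, DifferentiableAt ℝ u x :=
    (hK l).differentiableAt_smoothing hφ.measurable hφ.bound
  have huR : ∀ x, ‖u x‖ ≤ (c * R : ℝ≥0) := fun x => by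
    have h1 : ‖u x‖ₑ ≤ c * R := (hK l).enorm_smoothing_le_of_bound hφ.bound x
    rw [← ENNReal.coe_mul, enorm_le_coe] at h1
    exact h1
  have hulip : LipschitzWith (c * 2 ^ l * R) u := by
    intro x y
    have := (hK l).enorm_smoothing_add_sub_le hφ.measurable hφ.bound y (x - y)
    rw [add_sub_cancel] at this
    rw [edist_eq_enorm_sub, edist_eq_enorm_sub, ENNReal.coe_mul, ENNReal.coe_mul]
    exact this
  set e : Fin 2 → Plane := fun j => EuclideanSpace.single j 1 with he
  have hen : ∀ j, ‖e j‖ = 1 := fun j => by simp [he]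
  set z : Fin 2 → Plane → Ambient N := fun j x => fderiv ℝ u x (e j)
    - fderiv ℝ P (u x) (fderiv ℝ u x (e j)) with hz
  have hzb := fun j => hφ.normalBounds_fderiv hK hPd hB hβ hPφ (hen j) l J
  have hzR : ∀ j x, ‖z j x‖ ≤ (β * (c * 2 ^ l * R) : ℝ≥0) := by
    intro j x
    have h1 : ‖z j x‖ₑ ≤ β * ‖fderiv ℝ u x (e j)‖ₑ := hβ _ _
    have h2 : ‖fderiv ℝ u x (e j)‖ₑ ≤ (c * 2 ^ l * R : ℝ≥0) := by
      rw [enorm_le_coe]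
      have h3 := (fderiv ℝ u x).le_opNorm (e j)
      rw [hen, mul_one] at h3
      exact h3.trans (norm_fderiv_le_of_lipschitz ℝ hulip)
    have h4 : ‖z j x‖ₑ ≤ (β * (c * 2 ^ l * R) : ℝ≥0) := by
      rw [ENNReal.coe_mul]
      exact h1.trans (by gcongr)
    rw [enorm_le_coe] at h4
    exact h4
  have hwm : Measurable fun x => u x - P (u x) := hum.sub (hP.continuous.measurable.comp hum)
  have hwR : ∀ x, ‖u x - P (u x)‖ ≤ (c * R + R' : ℝ≥0) := fun x => by
    push_cast
    refine (norm_sub_le _ _).trans (add_le_add ?_ (hPR _))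
    simpa using huR x
  have hwd : ∀ j x, HasLineDerivAt ℝ (fun x => u x - P (u x)) (z j x) x (e j) := by
    intro j x
    have h1 := (hud x).hasFDerivAt
    have h2 := h1.sub ((hPd (u x)).hasFDerivAt.comp x h1)
    exact h2.hasLineDerivAt (e j)
  have hweak := isWeakGrad_lpBlock hK hwm hwR (fun j => (hzb j).measurable) hzR hwd k
  have hz₂ := hφ.normalBounds (δ := 0) hK hB₂ (fun a w => hβ (P a) w) hφ₁ hφ₁A
    (by simp [hPφ, hPφ₁]) l J
  have hmeas : ∀ {f : Plane → Ambient N}, Measurable f → Measurable fun x => ‖lpBlock χ k f x‖ₑ ^ 2 :=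
    fun hf => ((measurable_smoothing (hK (k + 1)).continuous hf).sub
      (measurable_smoothing (hK k).continuous hf)).enorm.pow_const 2
  refine (iInf₂_le _ hweak).trans ?_
  change ∫⁻ x, (‖lpBlock χ k (normalPart (lowKernel χ l) (fun p => fderiv ℝ P (P p)) u φ₁) x‖ₑ ^ 2
    + ∑ j, ‖lpBlock χ k (z j) x‖ₑ ^ 2) ≤ _
  rw [lintegral_add_left (hmeas hz₂.measurable),
    lintegral_finsetSum _ fun j _ => hmeas (hzb j).measurable]
  have b₂ := hz₂.lpBlock_sq_le_min hK hJ1 hJ k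
  have b := fun j => (hzb j).lpBlock_sq_le_min hK hJ1 hJ k
  rw [Fin.sum_univ_two]
  refine (add_le_add b₂ (add_le_add (b 0) (b 1))).trans (le_of_eq ?_)
  rw [← ENNReal.coe_add, ← ENNReal.coe_add]
  congr 1
  ring

end Energy

/-! ### Representatives of the data and elementary inequalities in `ε` -/

section Reduction

open scoped NNReal Topology

variable {N : ℕ}

/-- Initial data agree almost everywhere with measurable data that take values in `TM`
everywhere. -/
theorem IsInitialData.exists_measurable {M : Set (Ambient N)} {φ₀ φ₁ : Plane → Ambient N}
    (h : IsInitialData M φ₀ φ₁) : ∃ f g : Plane → Ambient N, Measurable f ∧ Measurable g ∧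
      φ₀ =ᵐ[volume] f ∧ φ₁ =ᵐ[volume] g ∧ (∀ x, f x ∈ M) ∧ ∀ x, g x ∈ tangentAt M (f x) := by
  classical
  obtain ⟨x₀, hx₀⟩ := h.mem.exists
  set f := h.aestronglyMeasurable₀.mk φ₀
  set g := h.aestronglyMeasurable₁.mk φ₁
  have hfm : Measurable f := h.aestronglyMeasurable₀.stronglyMeasurable_mk.measurable
  have hgm : Measurable g := h.aestronglyMeasurable₁.stronglyMeasurable_mk.measurable
  have hae : ∀ᵐ x, φ₀ x = f x ∧ φ₁ x = g x ∧ f x ∈ M ∧ g x ∈ tangentAt M (f x) := by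
    filter_upwards [h.aestronglyMeasurable₀.ae_eq_mk, h.aestronglyMeasurable₁.ae_eq_mk, h.mem,
      h.mem_tangent] with x h1 h2 h3 h4
    have h1' : φ₀ x = f x := h1
    have h2' : φ₁ x = g x := h2
    exact ⟨h1', h2', h1' ▸ h3, by rw [← h1', ← h2']; exact h4⟩
  -- The exceptional set is enlarged to a measurable null set, on which the data are replaced by a
  -- constant point of `M` and the zero tangent vector.
  set S := toMeasurable volume {x | ¬ (φ₀ x = f x ∧ φ₁ x = g x ∧ f x ∈ M ∧ g x ∈ tangentAt M (f x))}
  have hS : MeasurableSet S := measurableSet_toMeasurable _ _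
  have hS0 : volume S = 0 := by
    rw [measure_toMeasurable]; exact hae
  have hSc : ∀ x ∉ S, φ₀ x = f x ∧ φ₁ x = g x ∧ f x ∈ M ∧ g x ∈ tangentAt M (f x) := by
    intro x hx
    by_contra hcon
    exact hx (subset_toMeasurable _ _ hcon)
  have haeS : ∀ᵐ x, x ∉ S := measure_eq_zero_iff_ae_notMem.mp hS0
  refine ⟨S.piecewise (fun _ => φ₀ x₀) f, S.piecewise (fun _ => 0) g,
    measurable_const.piecewise hS hfm, measurable_const.piecewise hS hgm, ?_, ?_, fun x => ?_,
    fun x => ?_⟩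
  · filter_upwards [haeS] with x hx
    rw [Set.piecewise_eq_of_notMem _ _ _ hx]; exact (hSc x hx).1
  · filter_upwards [haeS] with x hx
    rw [Set.piecewise_eq_of_notMem _ _ _ hx]; exact (hSc x hx).2.1
  · by_cases hx : x ∈ S
    · rw [Set.piecewise_eq_of_mem _ _ _ hx]; exact hx₀
    · rw [Set.piecewise_eq_of_notMem _ _ _ hx]; exact (hSc x hx).2.2.1
  · by_cases hx : x ∈ S
    · rw [Set.piecewise_eq_of_mem _ _ _ hx, Set.piecewise_eq_of_mem _ _ _ hx]
      exact (tangentAt M _).zero_mem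
    · rw [Set.piecewise_eq_of_notMem _ _ _ hx, Set.piecewise_eq_of_notMem _ _ _ hx]
      exact (hSc x hx).2.2.2

/-- `J` is `log₂ (1/ε)` rounded up. The bound `ε ≤ 1/4` makes `|ln ε| ≥ 2 ln 2 ≥ 1`, which absorbs
the rounding. -/
theorem exists_two_pow_inv_le {ε : ℝ} (h0 : 0 < ε) (h1 : ε ≤ 1 / 4) :
    ∃ J : ℕ, 1 ≤ J ∧ ((2 : ℝ) ^ J)⁻¹ ≤ ε ∧ (J : ℝ) ≤ 4 * |Real.log ε| ∧ 1 ≤ |Real.log ε| := by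
  have hl2 := Real.log_two_gt_d9
  have hlog : Real.log ε ≤ -(2 * Real.log 2) := by
    have := Real.log_le_log h0 h1
    rw [one_div, Real.log_inv, show (4 : ℝ) = 2 ^ 2 by norm_num, Real.log_pow] at this
    push_cast at this
    exact this
  have habs : |Real.log ε| = -Real.log ε := abs_of_neg (by linarith)
  have hpos : 0 ≤ -Real.logb 2 ε := by
    rw [Real.logb, ← neg_div]
    exact div_nonneg (by linarith) (by linarith)
  refine ⟨⌈-Real.logb 2 ε⌉₊, ?_, ?_, ?_, by rw [habs]; linarith⟩
  · rw [Nat.one_le_ceil_iff, Real.logb, ← neg_div]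
    exact div_pos (by linarith) (by linarith)
  · have h2 : (2 : ℝ) ^ (-Real.logb 2 ε) = ε⁻¹ := by
      rw [Real.rpow_neg (by norm_num), Real.rpow_logb (by norm_num) (by norm_num) h0]
    have h3 : ε⁻¹ ≤ (2 : ℝ) ^ ⌈-Real.logb 2 ε⌉₊ := by
      rw [← h2, ← Real.rpow_natCast]
      exact Real.rpow_le_rpow_of_exponent_le (by norm_num) (Nat.le_ceil _)
    exact inv_le_of_inv_le₀ h0 h3
  · have h2 := (Nat.ceil_lt_add_one hpos).le
    refine h2.trans ?_
    rw [habs, Real.logb, ← neg_div]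
    have h3 : -Real.log ε / Real.log 2 ≤ 2 * (-Real.log ε) := by
      rw [div_le_iff₀ (by linarith)]
      nlinarith
    linarith

theorem mul_abs_log_le_sqrt {ε : ℝ} (h0 : 0 < ε) (h1 : ε ≤ 1) :
    ε * |Real.log ε| ≤ 2 * Real.sqrt ε := by
  have h := (Real.abs_log_mul_self_rpow_lt ε (1 / 2) h0 h1 (by norm_num)).le
  rw [← Real.sqrt_eq_rpow, abs_mul, abs_of_nonneg (Real.sqrt_nonneg ε)] at h
  have hs := Real.mul_self_sqrt h0.le
  calc ε * |Real.log ε| = (Real.sqrt ε * Real.sqrt ε) * |Real.log ε| := by rw [hs]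
    _ = (|Real.log ε| * Real.sqrt ε) * Real.sqrt ε := by ring
    _ ≤ 2 * Real.sqrt ε := by
        gcongr
        linarith

/-- Both entries are squares, of `a = ε^(1/2) |ln ε|` and of `T`, so the minimum is at most `a T`; a
quarter power of `ε` absorbs the logarithm. -/
theorem min_mul_log_sq_le {ε : ℝ} (h0 : 0 < ε) (h1 : ε ≤ 1) (k l : ℤ) :
    min (ε * |Real.log ε| ^ 2) ((2 : ℝ) ^ (-|k - l|))
      ≤ 4 * (ε ^ (1 / 4 : ℝ) * (2 : ℝ) ^ (-(1 / 2 : ℝ) * |(k : ℝ) - (l : ℝ)|)) := by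
  set T : ℝ := (2 : ℝ) ^ (-(1 / 2 : ℝ) * |(k : ℝ) - (l : ℝ)|) with hT
  have hT0 : 0 < T := by positivity
  have hTT : (2 : ℝ) ^ (-|k - l|) = T * T := by
    rw [hT, ← Real.rpow_add two_pos, ← Real.rpow_intCast]
    congr 1
    push_cast
    ring
  set q : ℝ := ε ^ (1 / 4 : ℝ) with hq
  have hq0 : 0 < q := by positivity
  have hq4 : q ^ 4 = ε := by
    rw [hq, ← Real.rpow_natCast, ← Real.rpow_mul h0.le]; norm_num
  have hlog : |Real.log ε| * q ≤ 4 := by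
    have h := (Real.abs_log_mul_self_rpow_lt ε (1 / 4) h0 h1 (by norm_num)).le
    rw [abs_mul, ← hq, abs_of_pos hq0] at h
    linarith
  set a : ℝ := q ^ 2 * |Real.log ε| with ha
  have haa : ε * |Real.log ε| ^ 2 = a * a := by rw [ha, ← hq4]; ring
  have ha0 : 0 ≤ a := by positivity
  have haq : a ≤ 4 * q := by
    calc a = (|Real.log ε| * q) * q := by rw [ha]; ring
      _ ≤ 4 * q := by gcongr
  have hmin : min (a * a) (T * T) ≤ a * T := by
    rcases le_total a T with h | h
    · exact (min_le_left _ _).trans (by gcongr)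
    · exact (min_le_right _ _).trans (by gcongr)
  rw [haa, hTT]
  refine hmin.trans ?_
  calc a * T ≤ 4 * q * T := by gcongr
    _ = _ := by ring

end Reduction

/-! ### From the extended projection to the truncation error -/

section Truncation

open scoped NNReal Topology

variable {N : ℕ} {χ : Plane → ℝ} {c : ℝ≥0} {M V : Set (Ambient N)}

theorem lpLow_congr_ae {f g : Plane → Ambient N} (h : f =ᵐ[volume] g) (k : ℤ) :
    lpLow χ k f = lpLow χ k g :=
  smoothing_congr_ae _ h

theorem lpBlock_congr_ae {f g : Plane → Ambient N} (h : f =ᵐ[volume] g) (k : ℤ) :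
    lpBlock χ k f = lpBlock χ k g := by
  unfold lpBlock
  rw [lpLow_congr_ae h, lpLow_congr_ae h]

/-- Initial data of finite energy and small energy dispersion have representatives with values in
`TM` that satisfy the corresponding translation bounds. -/
theorem IsInitialData.exists_isDispersed
    (hK : ∀ k : ℤ, IsKernelAtScale c (2 ^ k) (lowKernel χ k)) {φ₀ φ₁ : Plane → Ambient N}
    (h : IsInitialData M φ₀ φ₁) {ε R A : ℝ≥0} (hR : ∀ p ∈ M, ‖p‖ ≤ R)
    (hA : energy φ₀ φ₁ < (A : ℝ≥0∞) ^ 2) (hε : energyDispersion χ φ₀ ≤ ε) :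
    ∃ f g : Plane → Ambient N, IsDispersed χ ε R A f ∧ Measurable g ∧
      ∫⁻ x, ‖g x‖ₑ ^ 2 ≤ (A : ℝ≥0∞) ^ 2 ∧ φ₀ =ᵐ[volume] f ∧ φ₁ =ᵐ[volume] g ∧
      (∀ x, f x ∈ M) ∧ ∀ x, g x ∈ tangentAt M (f x) := by
  obtain ⟨f, g, hf, hg, hφf, hφg, hfM, hgM⟩ := h.exists_measurable
  -- The strict inequality selects one weak gradient from the infimum.
  obtain ⟨D, hD⟩ := iInf_lt_iff.mp hA
  obtain ⟨hgrad, hD⟩ := iInf_lt_iff.mp hD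
  have hfR : ∀ x, ‖f x‖ ≤ R := fun x => hR _ (hfM x)
  refine ⟨f, g, ⟨hf, hfR, ?_, fun y => ?_⟩, hg, ?_, hφf, hφg, hfM, hgM⟩
  · refine enorm_lpBlock_le_of_energyDispersion hK hf hfR ?_
    simpa only [energyDispersion, lpBlock_congr_ae hφf] using hε
  · have htr : ∀ᵐ x, φ₀ (x + y) = f (x + y) :=
      (measurePreserving_add_right volume y).quasiMeasurePreserving.ae hφf
    calc ∫⁻ x, ‖f (x + y) - f x‖ₑ ^ 2 = ∫⁻ x, ‖φ₀ (x + y) - φ₀ x‖ₑ ^ 2 := by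
          refine lintegral_congr_ae ?_
          filter_upwards [htr, hφf] with x h1 h2
          rw [h1, h2]
      _ ≤ (∫⁻ x, ∑ j, ‖D j x‖ₑ ^ 2) * ‖y‖ₑ ^ 2 := hgrad.lintegral_sq_add_sub_le y
      _ ≤ (A : ℝ≥0∞) ^ 2 * ‖y‖ₑ ^ 2 := by
          gcongr
          exact (lintegral_mono fun x => le_add_self).trans hD.le
  · calc ∫⁻ x, ‖g x‖ₑ ^ 2 = ∫⁻ x, ‖φ₁ x‖ₑ ^ 2 := by
          refine lintegral_congr_ae ?_
          filter_upwards [hφg] with x h1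
          rw [h1]
      _ ≤ (A : ℝ≥0∞) ^ 2 := (lintegral_mono fun x => le_self_add).trans hD.le

/-- A globally defined smooth map that agrees with the nearest point projection near `M`, together
with the bounds for its derivatives. -/
structure IsTubularExtension (M V : Set (Ambient N)) (δ : ℝ) (Λ β R' : ℝ≥0)
    (P : Ambient N → Ambient N) : Prop where
  contDiff : ContDiff ℝ 1 P
  bound : ∀ p, ‖P p‖ ≤ R'
  lipschitz : LipschitzWith Λ (fderiv ℝ P)
  lipschitz_comp : LipschitzWith Λ fun p => fderiv ℝ P (P p)
  enorm_sub_le : ∀ a w, ‖w - fderiv ℝ P a w‖ₑ ≤ β * ‖w‖ₑ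
  eventuallyEq : ∀ p, Metric.infDist p M < δ → p ∈ V ∧ P =ᶠ[𝓝 p] nearestPoint M

/-- Compact support makes all the derivative bounds global, so no later estimate has to track where
the truncated map lies. -/
theorem IsTubularNhd.exists_isTubularExtension (hM : IsCompact M) (hne : M.Nonempty)
    (hV : IsTubularNhd M V) : ∃ (P : Ambient N → Ambient N) (δ : ℝ) (Λ β R' : ℝ≥0),
      0 < δ ∧ IsTubularExtension M V δ Λ β R' P := by
  obtain ⟨P, δ, hδ, hP, hPc, hPδ⟩ := hV.exists_extension hM hne
  obtain ⟨L, hL⟩ := hP.lipschitzWith_of_hasCompactSupport hPc (by simp)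
  have hP1 : ContDiff ℝ 1 (fderiv ℝ P) := hP.fderiv_right (by norm_cast)
  obtain ⟨Λ, hΛ⟩ := hP1.lipschitzWith_of_hasCompactSupport (hPc.fderiv ℝ) (by simp)
  obtain ⟨R', hR'⟩ := hPc.exists_bound_of_continuous hP.continuous
  refine ⟨P, δ, Λ + Λ * L, 1 + L, R'.toNNReal, hδ, hP.of_le (by simp),
    fun p => (hR' p).trans (Real.le_coe_toNNReal _), hΛ.weaken le_self_add,
    (hΛ.comp hL).weaken le_add_self, fun a w => ?_, hPδ⟩
  calc ‖w - fderiv ℝ P a w‖ₑ ≤ ‖w‖ₑ + ‖fderiv ℝ P a w‖ₑ := enorm_sub_le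
    _ ≤ ‖w‖ₑ + L * ‖w‖ₑ := by
        gcongr
        rw [← enorm_norm w, ← enorm_norm (fderiv ℝ P a w), ← ofReal_norm, ← ofReal_norm,
          ← ENNReal.ofReal_coe_nnreal, ← ENNReal.ofReal_mul (by positivity)]
        refine ENNReal.ofReal_le_ofReal ?_
        rw [norm_norm, norm_norm]
        exact ((fderiv ℝ P a).le_opNorm w).trans
          (by gcongr; exact norm_fderiv_le_of_lipschitz ℝ hL)
    _ = ((1 + L : ℝ≥0) : ℝ≥0∞) * ‖w‖ₑ := by push_cast; ring

namespace IsTubularExtension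

variable {δ : ℝ} {Λ β R' : ℝ≥0} {P : Ambient N → Ambient N}

theorem fderiv_eq (hP : IsTubularExtension M V δ Λ β R' P) (hδ : 0 < δ) {q : Ambient N}
    (hq : q ∈ M) : P q = nearestPoint M q ∧ fderiv ℝ P q = fderiv ℝ (nearestPoint M) q := by
  have h := (hP.eventuallyEq q (by rwa [Metric.infDist_zero_of_mem hq])).2
  exact ⟨h.eq_of_nhds, h.fderiv_eq⟩

/-- `P p` lies on `M`, where the differential is the orthogonal tangent projection. The fibre
projection is thereby expressed through a globally Lipschitz operator field. -/
theorem fiberProj_eq (hP : IsTubularExtension M V δ Λ β R' P) (hV : IsTubularNhd M V) (hδ : 0 < δ)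
    {p : Ambient N} (hp : Metric.infDist p M < δ) (v : Ambient N) :
    fiberProj M p v = fderiv ℝ P (P p) v := by
  obtain ⟨hpV, hpP⟩ := hP.eventuallyEq p hp
  have hmem := (hV.isNearest_nearestPoint hpV).1
  rw [hpP.eq_of_nhds, (hP.fderiv_eq hδ hmem).2, hV.fderiv_eq_starProjection hmem, fiberProj]

/-- If the low frequency part of the data stays close to `M`, the truncation error obeys the
quantitative bound. -/
theorem truncationError_le (hP : IsTubularExtension M V δ Λ β R' P) (hV : IsTubularNhd M V)
    (hδ : 0 < δ) (hK : ∀ k : ℤ, IsKernelAtScale c (2 ^ k) (lowKernel χ k)) {ε R A : ℝ≥0}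
    {f g : Plane → Ambient N} (hf : IsDispersed χ ε R A f) (hg : Measurable g)
    (hgA : ∫⁻ x, ‖g x‖ₑ ^ 2 ≤ (A : ℝ≥0∞) ^ 2) (hfM : ∀ x, f x ∈ M)
    (hgM : ∀ x, g x ∈ tangentAt M (f x)) {J : ℕ} (hJ1 : 1 ≤ J) (hJ : ((2 : ℝ≥0) ^ J)⁻¹ ≤ ε)
    (k l : ℤ) (hl : ∀ x, Metric.infDist (lpLow χ l f x) M < δ) :
    truncationError M χ k l f g ≤ ((3 * (normalConst c Λ β R * (A ^ 2 * (1 + A ^ 2))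
        * (min (J * ε) (2 ^ (-|k - l|))) ^ 2) : ℝ≥0) : ℝ≥0∞) ^ (1 / 2 : ℝ) := by
  have h1 : (fun x => lpLow χ l f x - nearestPoint M (lpLow χ l f x))
      = fun x => lpLow χ l f x - P (lpLow χ l f x) := by
    funext x
    rw [(hP.eventuallyEq _ (hl x)).2.eq_of_nhds]
  have h2 : (fun x => lpLow χ l g x - fiberProj M (lpLow χ l f x) (lpLow χ l g x))
      = fun x => lpLow χ l g x - fderiv ℝ P (P (lpLow χ l f x)) (lpLow χ l g x) := by
    funext x
    rw [hP.fiberProj_eq hV hδ (hl x)]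
  rw [truncationError, energyNorm, h1, h2]
  refine ENNReal.rpow_le_rpow ?_ (by norm_num)
  refine hf.energy_lpBlock_le hK hP.contDiff hP.bound hP.lipschitz hP.lipschitz_comp
    hP.enorm_sub_le (fun x => ?_) hg hgA (fun x => ?_) hJ1 hJ k l
  · rw [(hP.fderiv_eq hδ (hfM x)).1, hV.nearestPoint_of_mem (hfM x)]
  · rw [(hP.fderiv_eq hδ (hfM x)).2, hV.fderiv_of_mem_tangentAt (hfM x) (hgM x)]

end IsTubularExtension

/-- The function of the energy that bounds the truncation error; it has linear growth. -/
noncomputable def truncationConst (C E : ℝ) : ℝ :=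
  4 * (4 * Real.sqrt (12 * C) + 1) * (1 + E)

theorem isPolynomialType_truncationConst (C : ℝ) : IsPolynomialType (truncationConst C) := by
  refine ⟨fun y hy => by unfold truncationConst; positivity, 2, ?_⟩
  set a : ℝ := 4 * (4 * Real.sqrt (12 * C) + 1) with ha
  have ha0 : 0 < a := by positivity
  filter_upwards [eventually_ge_atTop (2 * a + 1)] with y hy
  rw [truncationConst, ← ha]
  nlinarith

/-- The bound `3 C A² (1 + A²) m²` for the energy with `A² = 2 E`, in terms of the truncation
constant. -/
theorem rpow_half_le_truncationConst {C E ε : ℝ} {C' A e : ℝ≥0} {J : ℕ} {k l : ℤ} (hC : C' = C)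
    (he : e = ε) (hE : 0 < E) (hA : (A : ℝ) ^ 2 = 2 * E) (hJ : (J : ℝ) ≤ 4 * |Real.log ε|)
    (hlog : 1 ≤ |Real.log ε|) :
    ((3 * (C' * (A ^ 2 * (1 + A ^ 2)) * (min (J * e) (2 ^ (-|k - l|))) ^ 2) : ℝ≥0) : ℝ≥0∞)
        ^ (1 / 2 : ℝ)
      ≤ ENNReal.ofReal (truncationConst C E / 4
        * min (ε * |Real.log ε| ^ 2) ((2 : ℝ) ^ (-|k - l|))) := by
  have hε : 0 ≤ ε := he ▸ e.2
  have hC0 : 0 ≤ C := hC ▸ C'.2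
  set m : ℝ := min (ε * |Real.log ε| ^ 2) ((2 : ℝ) ^ (-|k - l|)) with hm
  have hm0 : 0 ≤ m := le_min (by positivity) (by positivity)
  -- One factor `|ln ε| ≥ 1` is given away here: the argument yields `ε |ln ε|`.
  have hmin : min ((J : ℝ) * ε) ((2 : ℝ) ^ (-|k - l|)) ≤ 4 * m := by
    rw [hm, mul_min_of_nonneg _ _ (by norm_num : (0 : ℝ) ≤ 4)]
    refine min_le_min ?_ (le_mul_of_one_le_left (by positivity) (by norm_num))
    calc (J : ℝ) * ε ≤ 4 * |Real.log ε| * ε := by gcongr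
      _ ≤ 4 * |Real.log ε| * ε * |Real.log ε| := le_mul_of_one_le_right (by positivity) hlog
      _ = 4 * (ε * |Real.log ε| ^ 2) := by ring
  have hmin0 : 0 ≤ min ((J : ℝ) * ε) ((2 : ℝ) ^ (-|k - l|)) :=
    le_min (by positivity) (by positivity)
  have hK0 : 0 ≤ truncationConst C E := by unfold truncationConst; positivity
  rw [one_div, ENNReal.rpow_inv_le_iff (by norm_num), ENNReal.rpow_ofNat,
    ← ENNReal.ofReal_pow (by positivity), ← ENNReal.ofReal_coe_nnreal]
  refine ENNReal.ofReal_le_ofReal ?_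
  push_cast
  rw [he, hC, hA]
  have hs := Real.sq_sqrt (show 0 ≤ 12 * C by positivity)
  have hs0 := Real.sqrt_nonneg (12 * C)
  calc 3 * (C * (2 * E * (1 + 2 * E)) * (min ((J : ℝ) * ε) ((2 : ℝ) ^ (-|k - l|))) ^ 2)
      ≤ 3 * (C * (2 * (1 + E) * (2 * (1 + E))) * (4 * m) ^ 2) := by
        gcongr
        all_goals linarith
    _ = (4 * Real.sqrt (12 * C) * (1 + E) * m) ^ 2 := by
        rw [show (4 * Real.sqrt (12 * C) * (1 + E) * m) ^ 2
          = Real.sqrt (12 * C) ^ 2 * (4 * (1 + E) * m) ^ 2 by ring, hs]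
        ring
    -- The summand `1` in `truncationConst` serves to keep it positive when `C = 0`.
    _ ≤ (truncationConst C E / 4 * m) ^ 2 := by
        gcongr
        unfold truncationConst
        nlinarith

/-- A threshold below which the dispersion keeps the truncated map in a `δ`-neighbourhood. -/
theorem exists_threshold {δ b : ℝ} (hδ : 0 < δ) (hb : 0 ≤ b) :
    ∃ ε₀ : ℝ, 0 < ε₀ ∧ ε₀ ≤ 1 / 4 ∧ ∀ ε, 0 < ε → ε ≤ ε₀ →
      12 * (ε * |Real.log ε|) + b * ε < δ := by
  -- The estimate needs `24 + b`; the extra `1` makes the final inequality strict.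
  set r : ℝ := δ / (25 + b) with hr
  have hr0 : 0 < r := by positivity
  refine ⟨min (1 / 4) (r ^ 2), by positivity, min_le_left _ _, fun ε h0 h1 => ?_⟩
  have hε1 : ε ≤ 1 := (h1.trans (min_le_left _ _)).trans (by norm_num)
  have hs : Real.sqrt ε ≤ r := Real.sqrt_le_iff.mpr ⟨hr0.le, h1.trans (min_le_right _ _)⟩
  have hlog := mul_abs_log_le_sqrt h0 hε1
  have hs1 : ε ≤ Real.sqrt ε := Real.le_sqrt_self_iff.mpr hε1
  have hrδ : (25 + b) * r = δ := by rw [hr]; field_simp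
  calc 12 * (ε * |Real.log ε|) + b * ε ≤ 12 * (2 * Real.sqrt ε) + b * Real.sqrt ε := by gcongr
    _ = (24 + b) * Real.sqrt ε := by ring
    _ ≤ (24 + b) * r := by gcongr
    _ < δ := by linarith

end Truncation

/-! ### Choice of the constants and conclusion -/

theorem proposition3p5 (N n : ℕ) (M : Set (Ambient N)) (hM : IsCompact M)
    (hMn : IsSmoothSubmanifold n M) (χ : Plane → ℝ) (hχ : IsLPCutoff χ) :
    (∃ V : Set (Ambient N), IsTubularNhd M V) ∧
    ∀ V : Set (Ambient N), IsTubularNhd M V →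
      ∃ K : ℝ → ℝ, IsPolynomialType K ∧
        ∀ E : ℝ, 0 < E → ∃ ε₀ : ℝ, 0 < ε₀ ∧
          ∀ φ₀ φ₁ : Plane → Ambient N, IsInitialData M φ₀ φ₁ →
            energy φ₀ φ₁ = ENNReal.ofReal E →
            ∀ ε : ℝ, 0 < ε → ε ≤ ε₀ → energyDispersion χ φ₀ ≤ ENNReal.ofReal ε →
              ∀ l : ℤ,
                (∀ x, lpLow χ l φ₀ x ∈ V) ∧
                ∀ k : ℤ,
                  truncationError M χ k l φ₀ φ₁ ≤
                    ENNReal.ofReal (K E * min (ε * |Real.log ε| ^ 2) ((2 : ℝ) ^ (-|k - l|))) ∧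
                  truncationError M χ k l φ₀ φ₁ ≤
                    ENNReal.ofReal (K E * (ε ^ (1 / 4 : ℝ) *
                      (2 : ℝ) ^ (-(1 / 2 : ℝ) * |(k : ℝ) - (l : ℝ)|))) := by
  refine ⟨hMn.exists_isTubularNhd hM, fun V hV => ?_⟩
  -- If `M` is empty there are no initial data, since membership must hold almost everywhere on a
  -- space of positive measure.
  rcases M.eq_empty_or_nonempty with rfl | hne
  · refine ⟨_, isPolynomialType_truncationConst 0, fun E _ => ⟨1, one_pos, fun φ₀ φ₁ h => ?_⟩⟩
    obtain ⟨x, hx⟩ := h.mem.exists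
    exact absurd hx (Set.notMem_empty _)
  obtain ⟨c, hK⟩ := hχ.exists_isKernelAtScale
  obtain ⟨P, δ, Λ, β, R', hδ, hP⟩ := hV.exists_isTubularExtension hM hne
  obtain ⟨R₀, hR₀⟩ := hM.isBounded.exists_norm_le
  set R := R₀.toNNReal
  have hR : ∀ p ∈ M, ‖p‖ ≤ R := fun p hp => (hR₀ p hp).trans (Real.le_coe_toNNReal _)
  refine ⟨_, isPolynomialType_truncationConst (normalConst c Λ β R), fun E hE => ?_⟩
  -- Taking `A² = 2E` rather than `E` makes the energy strictly smaller than `A²`. The energy enters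
  -- the threshold `ε₀` through `A`, whereas `c`, `Λ`, `β`, `R` were fixed before `E`.
  set A : NNReal := NNReal.sqrt (2 * E).toNNReal with hAdef
  have hA : (A : ℝ) ^ 2 = 2 * E := by
    rw [hAdef, ← NNReal.coe_pow, NNReal.sq_sqrt, Real.coe_toNNReal _ (by positivity)]
  obtain ⟨ε₀, hε₀, hε₀4, hε₀δ⟩ := exists_threshold hδ
    (show (0 : ℝ) ≤ c * (R + A) by positivity)
  refine ⟨ε₀, hε₀, fun φ₀ φ₁ hφ hφE ε hε hεε₀ hdisp l => ?_⟩
  obtain ⟨J, hJ1, hJε, hJlog, hlog⟩ := exists_two_pow_inv_le hε (hεε₀.trans hε₀4)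
  have heε : (ε.toNNReal : ℝ) = ε := Real.coe_toNNReal _ hε.le
  have hEA : energy φ₀ φ₁ < (A : ℝ≥0∞) ^ 2 := by
    rw [hφE, ← ENNReal.coe_pow, ← ENNReal.ofReal_coe_nnreal, NNReal.coe_pow, hA]
    exact (ENNReal.ofReal_lt_ofReal_iff (by positivity)).mpr (by linarith)
  obtain ⟨f, g, hf, hg, hgA, hφf, hφg, hfM, hgM⟩ := hφ.exists_isDispersed hK hR hEA hdisp
  have hfl : lpLow χ l φ₀ = lpLow χ l f := lpLow_congr_ae hφf l
  have hgl : lpLow χ l φ₁ = lpLow χ l g := lpLow_congr_ae hφg l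
  have hnear : ∀ x, Metric.infDist (lpLow χ l f x) M < δ := fun x => by
    refine (infDist_lpLow_le hK hf.measurable hf.bound hf.block_le hfM hf.sub_sub_le l J
      x).trans_lt (lt_of_le_of_lt ?_ (hε₀δ ε hε hεε₀))
    rw [heε]
    calc 3 * (J : ℝ) * ε + c * (R + A) * (2 ^ J)⁻¹
        ≤ 3 * (4 * |Real.log ε|) * ε + c * (R + A) * ε := by gcongr
      _ = 12 * (ε * |Real.log ε|) + c * (R + A) * ε := by ring
  refine ⟨fun x => hfl ▸ (hP.eventuallyEq _ (hnear x)).1, fun k => ?_⟩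
  have hJε' : ((2 : NNReal) ^ J)⁻¹ ≤ ε.toNNReal := by
    rw [← NNReal.coe_le_coe, heε]
    push_cast
    exact hJε
  set T := truncationConst (normalConst c Λ β R) E with hT
  have hT0 : 0 < T := (isPolynomialType_truncationConst _).1 E hE
  set m : ℝ := min (ε * |Real.log ε| ^ 2) ((2 : ℝ) ^ (-|k - l|)) with hm
  have hm0 : 0 ≤ m := le_min (by positivity) (by positivity)
  -- The spare factor `4` in `T` pays for the `4` of `min_mul_log_sq_le` in the last estimate.
  have hmain : truncationError M χ k l φ₀ φ₁ ≤ ENNReal.ofReal (T / 4 * m) := by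
    have h := hP.truncationError_le hV hδ hK hf hg hgA hfM hgM hJ1 hJε' k l hnear
    rw [truncationError, hfl, hgl]
    exact h.trans (rpow_half_le_truncationConst rfl heε hE hA hJlog hlog)
  have hm4 := min_mul_log_sq_le hε (hεε₀.trans (hε₀4.trans (by norm_num))) k l
  refine ⟨hmain.trans (ENNReal.ofReal_le_ofReal ?_), hmain.trans (ENNReal.ofReal_le_ofReal ?_)⟩
  · nlinarith
  · refine (mul_le_mul_of_nonneg_left hm4 (by positivity : 0 ≤ T / 4)).trans_eq ?_
    ring
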